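/- **Theorem.** Fix $r\in\mathbb N$, $r\ge 1$, and a real $s\ne 0$. For every $n\ge1$ let $d_n,l_n$ be integers with $l_n\ge1$, let $x^{(1)},\dots,x^{(l_n)}\in\mathbb R^n$, $y^{(1)},\dots,y^{(l_n)}\in\mathbb R^{d_n}$ and $\beta=\beta_n>0$ be given (all depending on $n$), with all norms $\|x^{(i)}\|,\|y^{(i)}\|$ bounded by a constant independent of $n$ ($\|\cdot\|$ is the Euclidean norm). Assume that either (i) $\beta_n$ is bounded in $n$ (e.g. $\beta$ is fixed), or (ii) $\beta_n=O(\sqrt n)$ and, for each $n$, all $x^{(i)}$ have the same norm and all $y^{(i)}$ have the same norm. *Definitions.* Let $p=(p_0,\dots,p_{r+1})$ and $q=(q_0,\dots,q_{r+1})$ with $1=p_0\ge p_1\ge\dots\ge p_r\ge p_{r+1}=0$, $1=q_0\ge q_1\ge\dots\ge q_r\ge q_{r+1}=0$, and $m=(m_0,\dots,m_{r+1})$ with $m_0=1$, $m_{r+1}=0$ and $m_1,\dots,m_r\neq0$. Call such $p,q,m$ admissible. Let $t\in[0,1]$. Let the entries of $G\in\mathbb R^{d_n\times n}$ and of $U_k=(u^{(4,k)},u^{(2,k)},h^{(k)})\in\mathbb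 R\times\mathbb R^{d_n}\times\mathbb R^n$, $1\le k\le r+1$, be i.i.d. standard normal; $E$ with a subscript is the expectation over the indicated variables. Put $a_k=\sqrt{p_{k-1}q_{k-1}-p_kq_k}$, $b_k=\sqrt{p_{k-1}-p_k}$, $c_k=\sqrt{q_{k-1}-q_k}$, $$D_0^{(i_1,i_2)}=\sqrt t\,(y^{(i_2)})^TGx^{(i_1)}+\sqrt{1-t}\,\|x^{(i_1)}\|(y^{(i_2)})^T\sum_{k=1}^{r+1}b_ku^{(2,k)}+\sqrt t\,\|x^{(i_1)}\|\|y^{(i_2)}\|\sum_{k=1}^{r+1}a_ku^{(4,k)}+\sqrt{1-t}\,\|y^{(i_2)}\|\Big(\sum_{k=1}^{r+1}c_kh^{(k)}\Big)^Tx^{(i_1)},$$ $A^{(i_1,i_2)}=e^{\beta D_0^{(i_1,i_2)}}$, $C^{(i_1)}=\sum_{i_2}A^{(i_1,i_2)}$, $Z=\sum_{i_1}(C^{(i_1)})^s$, $\zeta_0=Z$, $\zeta_k=E_{U_k}\zeta_{k-1}^{m_k/m_{k-1}}$ for $1\le k\le r$, $$\psi(p,q,m,t)=E_{G,U_{r+1}}\frac{1}{\beta|s|\sqrt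 n\,m_r}\log\zeta_r .$$ Let $\Phi_kf=E_{U_k}\big(\tfrac{\zeta_{k-1}^{m_k/m_{k-1}}}{\zeta_k}f\big)$, $\gamma_0(i_1,i_2)=\frac{(C^{(i_1)})^s}{Z}\frac{A^{(i_1,i_2)}}{C^{(i_1)}}$ and, for $1\le k\le r+1$, $$\gamma_k(i_1,i_2,p_1,p_2)=\Phi_r\cdots\Phi_k\Big(\big(\Phi_{k-1}\cdots\Phi_1\gamma_0(i_1,i_2)\big)\big(\Phi_{k-1}\cdots\Phi_1\gamma_0(p_1,p_2)\big)\Big),\qquad \langle f\rangle_{\gamma_k}=\sum_{i_1,i_2,p_1,p_2}\gamma_k(i_1,i_2,p_1,p_2)f(i_1,i_2,p_1,p_2).$$ With $N_k=E_{G,U_{r+1}}\langle\|x^{(i_1)}\|\|x^{(p_1)}\|\|y^{(i_2)}\|\|y^{(p_2)}\|\rangle_{\gamma_k}$ define $$\psi_1(p,q,m,t)=-\frac{\operatorname{sign}(s)\,s\,\beta}{2\sqrt n}\sum_{k=1}^{r+1}\big(p_{k-1}q_{k-1}N_k-p_kq_kN_{k+1}\big)m_k+\psi(p,q,m,t)$$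 (the term with $N_{r+2}$ is absent since $p_{r+1}=q_{r+1}=0$), and, for $1\le k\le r+1$, $$\phi_k=-s(m_{k-1}-m_k)\,E_{G,U_{r+1}}\big\langle(p_{k-1}\|x^{(i_1)}\|\|x^{(p_1)}\|-(x^{(p_1)})^Tx^{(i_1)})(q_{k-1}\|y^{(i_2)}\|\|y^{(p_2)}\|-(y^{(p_2)})^Ty^{(i_2)})\big\rangle_{\gamma_k}.$$ *Assumptions.* For every $n$ let $\bar p(t),\bar q(t),\bar m(t)$, $t\in[0,1]$, be differentiable paths of admissible vectors (depending on $n$), with $|\bar m_k(t)|$ bounded uniformly in $n,t,k$, such that: 1. for all $t\in[0,1]$ and $1\le k\le r$, the partial derivatives $\partial\psi_1/\partial p_k$, $\partial\psi_1/\partial q_k$, $\partial\psi_1/\partial m_k$ vanish at $(\bar p(t),\bar q(t),\bar m(t),t)$ (at points where some inequalities between consecutive $p$'s or $q$'s are equalities, the derivatives of $\psi_1$ in $p$ and in $q$ relative to the admissible set are meant); 2. $\bar m_1(t)\to1$ as $n\to\infty$ for all $t\in[0,1]$; 3. for all $t\in[0,1]$ and $1\le k\le r$, either the scaled overlaps concentrate,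 i.e. $$E_{G,U_{r+1}}\big\langle(\bar p_k(t)\|x^{(i_1)}\|\|x^{(p_1)}\|-(x^{(p_1)})^Tx^{(i_1)})^2\big\rangle_{\gamma_{k+1}}\to0,\quad E_{G,U_{r+1}}\big\langle(\bar q_k(t)\|y^{(i_2)}\|\|y^{(p_2)}\|-(y^{(p_2)})^Ty^{(i_2)})^2\big\rangle_{\gamma_{k+1}}\to0$$ as $n\to\infty$ (everything evaluated at $\bar p(t),\bar q(t),\bar m(t),t$), or $\phi_{k+1}=0$ for all large $n$. *Conclusion.* For every $n$ the function $t\mapsto\psi_1(\bar p(t),\bar q(t),\bar m(t),t)$ is differentiable on $[0,1]$ (one-sidedly at the endpoints), and for every $t\in[0,1]$ $$\frac{d}{dt}\psi_1(\bar p(t),\bar q(t),\bar m(t),t)\to0\qquad(n\to\infty).$$ For any $n$ and $t$ for which all $x^{(i)}$ have the same norm, all $y^{(i)}$ have the same norm, $\bar m_1(t)=1$ and $\phi_{k+1}=0$ for $1\le k\le r$, this derivative is exactly $0$. Moreover, for every $t\in[0,1]$, the differences of $\psi_1(\bar p(t),\bar q(t),\bar m(t),t)$ and each of $\psi_1(\bar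 p(0),\bar q(0),\bar m(0),0)$, $\psi_1(\bar p(1),\bar q(1),\bar m(1),1)$ tend to $0$ as $n\to\infty$; hence, if one of the three limits exists, all exist and $$\lim_{n\to\infty}\psi_1(\bar p(t),\bar q(t),\bar m(t),t)=\lim_{n\to\infty}\psi_1(\bar p(0),\bar q(0),\bar m(0),0)=\lim_{n\to\infty}\psi_1(\bar p(1),\bar q(1),\bar m(1),1).$$ -/

import Mathlib

open Filter Topology MeasureTheory ProbabilityTheory Set

noncomputable section

namespace FullyLifted

/-- The deterministic data: `l` vectors `x i` in `ℝⁿ`, `l` vectors `y i` in `ℝᵈ`, and the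
scalars `β` and `s`. -/
structure BilinearModel (n d l : ℕ) where
  x : Fin l → EuclideanSpace ℝ (Fin n)
  y : Fin l → EuclideanSpace ℝ (Fin d)
  β : ℝ
  s : ℝ

/-- The `k`-th entry of a vector indexed by `0, …, r + 1` (and `0` for larger `k`). -/
def entry {r : ℕ} (v : Fin (r + 2) → ℝ) (k : ℕ) : ℝ :=
  if h : k < r + 2 then v ⟨k, h⟩ else 0

/-- The admissible vectors `1 = p₀ ≥ p₁ ≥ … ≥ p_r ≥ p_{r+1} = 0`. -/
def overlapVectors (r : ℕ) : Set (Fin (r + 2) → ℝ) :=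
  {p | p 0 = 1 ∧ Antitone p ∧ p (Fin.last (r + 1)) = 0}

/-- The admissible vectors `m` : `m₀ = 1`, `m_{r+1} = 0`, and the entries `m₁, …, m_r`, by which
one divides, are nonzero. -/
def liftVectors (r : ℕ) : Set (Fin (r + 2) → ℝ) :=
  {m | m 0 = 1 ∧ m (Fin.last (r + 1)) = 0 ∧ ∀ k, k ≠ Fin.last (r + 1) → m k ≠ 0}

/-- A realisation of the level-`k` randomness `U_k = (u⁽⁴⁾, u⁽²⁾, h)`. -/
abbrev Noise (d n : ℕ) : Type := ℝ × (Fin d → ℝ) × (Fin n → ℝ)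

/-- The law of `U_k` : independent standard normal components. -/
def noiseLaw (d n : ℕ) : Measure (Noise d n) :=
  (gaussianReal 0 1).prod
    ((Measure.pi fun _ : Fin d => gaussianReal 0 1).prod
      (Measure.pi fun _ : Fin n => gaussianReal 0 1))

/-- The law of the `d × n` matrix `G` with independent standard normal entries. -/
def matrixLaw (d n : ℕ) : Measure (Fin d → Fin n → ℝ) :=
  Measure.pi fun _ : Fin d => Measure.pi fun _ : Fin n => gaussianReal 0 1

/-- `a_k = √(p_{k-1} q_{k-1} - p_k q_k)`. -/
def aCoef {r : ℕ} (p q : Fin (r + 2) → ℝ) (k : ℕ) : ℝ :=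
  √(entry p (k - 1) * entry q (k - 1) - entry p k * entry q k)

/-- `√(v_{k-1} - v_k)` : this is `b_k` for `v = p` and `c_k` for `v = q`. -/
def incCoef {r : ℕ} (v : Fin (r + 2) → ℝ) (k : ℕ) : ℝ :=
  √(entry v (k - 1) - entry v k)

variable {n d l r : ℕ}

/-- The interpolating process `D₀^{(i₁,i₂)}`. The argument `ω` lists the noises `U_k = ω k`; only
`k = 1, …, r + 1` occur. -/
def D0 (P : BilinearModel n d l) (p q : Fin (r + 2) → ℝ) (t : ℝ)
    (G : Fin d → Fin n → ℝ) (ω : ℕ → Noise d n) (i₁ i₂ : Fin l) : ℝ :=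
  √t * (∑ i, ∑ j, P.y i₂ i * G i j * P.x i₁ j)
    + √(1 - t) * ‖P.x i₁‖ *
        (∑ i, P.y i₂ i * ∑ k ∈ Finset.Icc 1 (r + 1), incCoef p k * (ω k).2.1 i)
    + √t * ‖P.x i₁‖ * ‖P.y i₂‖ * (∑ k ∈ Finset.Icc 1 (r + 1), aCoef p q k * (ω k).1)
    + √(1 - t) * ‖P.y i₂‖ *
        (∑ j, (∑ k ∈ Finset.Icc 1 (r + 1), incCoef q k * (ω k).2.2 j) * P.x i₁ j)

/-- `A^{(i₁,i₂)} = exp (β D₀^{(i₁,i₂)})`. -/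
def A (P : BilinearModel n d l) (p q : Fin (r + 2) → ℝ) (t : ℝ)
    (G : Fin d → Fin n → ℝ) (ω : ℕ → Noise d n) (i₁ i₂ : Fin l) : ℝ :=
  Real.exp (P.β * D0 P p q t G ω i₁ i₂)

/-- `C^{(i₁)} = ∑_{i₂} A^{(i₁,i₂)}`. -/
def C (P : BilinearModel n d l) (p q : Fin (r + 2) → ℝ) (t : ℝ)
    (G : Fin d → Fin n → ℝ) (ω : ℕ → Noise d n) (i₁ : Fin l) : ℝ :=
  ∑ i₂, A P p q t G ω i₁ i₂

/-- `Z = ∑_{i₁} (C^{(i₁)})^s`. -/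
def Z (P : BilinearModel n d l) (p q : Fin (r + 2) → ℝ) (t : ℝ)
    (G : Fin d → Fin n → ℝ) (ω : ℕ → Noise d n) : ℝ :=
  ∑ i₁, C P p q t G ω i₁ ^ P.s

/-- The expectation `E_{U_k}` over the level-`k` noise alone. -/
def expLevel (k : ℕ) (f : (ℕ → Noise d n) → ℝ) (ω : ℕ → Noise d n) : ℝ :=
  ∫ u, f (Function.update ω k u) ∂(noiseLaw d n)

/-- `ζ₀ = Z` and `ζ_k = E_{U_k} (ζ_{k-1} ^ (m_k / m_{k-1}))`. -/
def zeta (P : BilinearModel n d l) (p q m : Fin (r + 2) → ℝ) (t : ℝ)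
    (G : Fin d → Fin n → ℝ) : ℕ → (ℕ → Noise d n) → ℝ
  | 0 => Z P p q t G
  | k + 1 => expLevel (k + 1) fun ω => zeta P p q m t G k ω ^ (entry m (k + 1) / entry m k)

/-- The expectation `E_{G, U_{r+1}}` of a function of `G` and the noises that does not depend on
the noises of levels `1, …, r`. -/
def expOuter (r : ℕ) (f : (Fin d → Fin n → ℝ) → (ℕ → Noise d n) → ℝ) : ℝ :=
  ∫ G, expLevel (r + 1) (f G) 0 ∂(matrixLaw d n)

/-- The interpolating function `ψ`. -/
def psi (P : BilinearModel n d l) (p q m : Fin (r + 2) → ℝ) (t : ℝ) : ℝ :=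
  expOuter r fun G ω =>
    1 / (P.β * |P.s| * √(n : ℝ) * entry m r) * Real.log (zeta P p q m t G r ω)

/-- The operator `Φ_{U_k} f = E_{U_k} ((ζ_{k-1} ^ (m_k / m_{k-1}) / ζ_k) f)`, for `k ≥ 1`. -/
def Phi (P : BilinearModel n d l) (p q m : Fin (r + 2) → ℝ) (t : ℝ)
    (G : Fin d → Fin n → ℝ) (k : ℕ) (f : (ℕ → Noise d n) → ℝ) : (ℕ → Noise d n) → ℝ :=
  expLevel k fun ω =>
    zeta P p q m t G (k - 1) ω ^ (entry m k / entry m (k - 1)) / zeta P p q m t G k ω * f ω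

/-- The composition `Φ_{U_{a+j-1}} ⋯ Φ_{U_{a+1}} Φ_{U_a}` of `j` consecutive operators, the one
with the smallest index acting first. -/
def PhiComp (P : BilinearModel n d l) (p q m : Fin (r + 2) → ℝ) (t : ℝ)
    (G : Fin d → Fin n → ℝ) (a : ℕ) :
    ℕ → ((ℕ → Noise d n) → ℝ) → (ℕ → Noise d n) → ℝ
  | 0, f => f
  | j + 1, f => Phi P p q m t G (a + j) (PhiComp P p q m t G a j f)

/-- `γ₀(i₁,i₂) = ((C^{(i₁)})^s / Z) (A^{(i₁,i₂)} / C^{(i₁)})`. -/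
def gamma0 (P : BilinearModel n d l) (p q : Fin (r + 2) → ℝ) (t : ℝ)
    (G : Fin d → Fin n → ℝ) (i₁ i₂ : Fin l) (ω : ℕ → Noise d n) : ℝ :=
  C P p q t G ω i₁ ^ P.s / Z P p q t G ω * (A P p q t G ω i₁ i₂ / C P p q t G ω i₁)

/-- The weights `γ_k^{(r)}` of a quadruple `(i₁,i₂,p₁,p₂)`, for `k = 1, …, r + 1` :
`Φ_{U_r} ⋯ Φ_{U_k} ((Φ_{U_{k-1}} ⋯ Φ_{U_1} γ₀(i₁,i₂)) (Φ_{U_{k-1}} ⋯ Φ_{U_1} γ₀(p₁,p₂)))`. -/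
def gammaWeight (P : BilinearModel n d l) (p q m : Fin (r + 2) → ℝ) (t : ℝ)
    (G : Fin d → Fin n → ℝ) (k : ℕ) (i₁ i₂ p₁ p₂ : Fin l) : (ℕ → Noise d n) → ℝ :=
  PhiComp P p q m t G k (r + 1 - k) fun ω =>
    PhiComp P p q m t G 1 (k - 1) (gamma0 P p q t G i₁ i₂) ω *
      PhiComp P p q m t G 1 (k - 1) (gamma0 P p q t G p₁ p₂) ω

/-- `E_{G, U_{r+1}} ⟨f(i₁,i₂,p₁,p₂)⟩_{γ_k^{(r)}}`. -/
def gammaMean (P : BilinearModel n d l) (p q m : Fin (r + 2) → ℝ) (t : ℝ) (k : ℕ)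
    (f : Fin l → Fin l → Fin l → Fin l → ℝ) : ℝ :=
  expOuter r fun G ω =>
    ∑ i₁, ∑ i₂, ∑ p₁, ∑ p₂, gammaWeight P p q m t G k i₁ i₂ p₁ p₂ ω * f i₁ i₂ p₁ p₂

/-- `E ⟨‖x^{(i₁)}‖ ‖x^{(p₁)}‖ ‖y^{(i₂)}‖ ‖y^{(p₂)}‖⟩_{γ_k^{(r)}}`. -/
def normMean (P : BilinearModel n d l) (p q m : Fin (r + 2) → ℝ) (t : ℝ) (k : ℕ) : ℝ :=
  gammaMean P p q m t k fun i₁ i₂ p₁ p₂ => ‖P.x i₁‖ * ‖P.x p₁‖ * ‖P.y i₂‖ * ‖P.y p₂‖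

/-- The corrected interpolating function `ψ₁`. In the summand `k = r + 1` the second product
vanishes, as `p_{r+1} = q_{r+1} = 0`. -/
def psiOne (P : BilinearModel n d l) (p q m : Fin (r + 2) → ℝ) (t : ℝ) : ℝ :=
  -(Real.sign P.s * P.s * P.β / (2 * √(n : ℝ))) *
      ∑ k ∈ Finset.Icc 1 (r + 1),
        (entry p (k - 1) * entry q (k - 1) * normMean P p q m t k
          - entry p k * entry q k * normMean P p q m t (k + 1)) * entry m k
    + psi P p q m t

/-- Deviation of the overlap of `x^{(i₁)}` and `x^{(p₁)}` from `c ‖x^{(i₁)}‖ ‖x^{(p₁)}‖`. -/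
def xDev (P : BilinearModel n d l) (c : ℝ) (i₁ p₁ : Fin l) : ℝ :=
  c * ‖P.x i₁‖ * ‖P.x p₁‖ - inner ℝ (P.x p₁) (P.x i₁)

/-- Deviation of the overlap of `y^{(i₂)}` and `y^{(p₂)}` from `c ‖y^{(i₂)}‖ ‖y^{(p₂)}‖`. -/
def yDev (P : BilinearModel n d l) (c : ℝ) (i₂ p₂ : Fin l) : ℝ :=
  c * ‖P.y i₂‖ * ‖P.y p₂‖ - inner ℝ (P.y p₂) (P.y i₂)

/-- The quantity `φ_k^{(r)}`, for `k ≥ 1`. -/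
def phi (P : BilinearModel n d l) (p q m : Fin (r + 2) → ℝ) (t : ℝ) (k : ℕ) : ℝ :=
  -P.s * (entry m (k - 1) - entry m k) *
    gammaMean P p q m t k fun i₁ i₂ p₁ p₂ =>
      xDev P (entry p (k - 1)) i₁ p₁ * yDev P (entry q (k - 1)) i₂ p₂

/-- `(p, q, m)` is a stationary point of `ψ₁(·, ·, ·, t)` : the partial derivatives with respect to
`p_k`, `q_k`, `m_k`, `k = 1, …, r`, vanish. The derivatives in `p` and in `q` are taken within the
set of admissible vectors, so they are the usual ones at interior points and one-sided ones where
some of the constraints `1 ≥ p₁ ≥ … ≥ p_r ≥ 0`, `1 ≥ q₁ ≥ … ≥ q_r ≥ 0` are equalities. -/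
def IsStationary (P : BilinearModel n d l) (p q m : Fin (r + 2) → ℝ) (t : ℝ) : Prop :=
  HasFDerivWithinAt (fun p' => psiOne P p' q m t) (0 : (Fin (r + 2) → ℝ) →L[ℝ] ℝ)
      (overlapVectors r) p ∧
    HasFDerivWithinAt (fun q' => psiOne P p q' m t) (0 : (Fin (r + 2) → ℝ) →L[ℝ] ℝ)
      (overlapVectors r) q ∧
    ∀ k : Fin (r + 2), k ≠ 0 → k ≠ Fin.last (r + 1) →
      HasDerivAt (fun v : ℝ => psiOne P p q (Function.update m k v) t) 0 (m k)

/-- `E ⟨(p_k ‖x^{(i₁)}‖ ‖x^{(p₁)}‖ - ⟪x^{(p₁)}, x^{(i₁)}⟫)²⟩_{γ_{k+1}^{(r)}}`. -/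
def xOverlapVar (P : BilinearModel n d l) (p q m : Fin (r + 2) → ℝ) (t : ℝ) (k : ℕ) : ℝ :=
  gammaMean P p q m t (k + 1) fun i₁ _ p₁ _ => xDev P (entry p k) i₁ p₁ ^ 2

/-- `E ⟨(q_k ‖y^{(i₂)}‖ ‖y^{(p₂)}‖ - ⟪y^{(p₂)}, y^{(i₂)}⟫)²⟩_{γ_{k+1}^{(r)}}`. -/
def yOverlapVar (P : BilinearModel n d l) (p q m : Fin (r + 2) → ℝ) (t : ℝ) (k : ℕ) : ℝ :=
  gammaMean P p q m t (k + 1) fun _ i₂ _ p₂ => yDev P (entry q k) i₂ p₂ ^ 2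

end FullyLifted

end

open FullyLifted

/-!
`ψ₁` along a path of stationary points depends on time, to first order, only through its explicit
argument `t`, and the derivative in that argument is a combination of the overlap deviations `φ_k`
up to an error of order `1 / √n`. Four ideas carry this.

*Functions of a parameter and a field.* Up to the level `k`, the energies `D₀` consist of a field in
`ℝ^(l × l)`, built from the noises not yet averaged, and of the Gaussian noises of the levels `≤ k`.
The latter enter only through their standard deviations, which together with the ratios
`m_k / m_{k-1}` form a finite-dimensional parameter. So `log ζ_k` (`zeta_eq_exp_pot`) and the chains
of `Φ`s are functions of a parameter and a field. They are `Tame`: smooth, and growing at most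
exponentially in the field with all their directional derivatives. Every differentiation under an
integral rests on this class.

*The time derivative of `ψ`.* Gaussian integration by parts gives a heat equation
(`diffusion_gavg`): the operator `∂_τ + ½ ∑ R e e' ∂_e ∂_e'` passes through an average over a Gaussian
field if `R` is increased by the speed of the covariance of that field. Through a log-average or a
tilted average it passes with an additional square of gradients (`diffusion_logAvg`,
`diffusion_tilt`). The interpolation is such that the matrices
`(p_k ‖x‖ ‖x'‖ - ⟪x', x⟫) (q_k ‖y‖ ‖y'‖ - ⟪y', y⟫)` (`devCov`) differ from one level to the next exactly
by these speeds (`devCov_step`), and are exhausted beyond the last level (`devCov_last`). At level `0`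
they vanish on pairs `(i, j)`, `(i, j')`, as `p_0 = 1`; hence the operator annihilates functions of a
single row of the field such as `log C` (`IsRowFn.diffusion_eq_zero`), and only the squares of
gradients survive. They sum to
`∂_t ψ = sign s · β / (2 √n) · ∑ φ_k` (`potRate_eq`, `hasDerivAt_psi`).

*The mean norms.* The same operator gives the time derivatives of the `N_k`, and the bounds on these
have to be free of the dimensions and of the number of vectors. This holds because Gibbs weights and
tilted averages preserve bounds on suprema and on `ℓ¹`-norms of gradients (`RateBdd`,
`exists_normMean_speed_bound`). For bounded `β` the prefactor `1 / √n` then makes this part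
negligible; if all norms agree, the `N_k` are constant in time.

*Stationarity at the boundary.* Standard deviations are square roots of variances, which is singular
at `t = 0`, at `t = 1`, and where consecutive entries of `p` or `q` agree. But the laws of the noises
are symmetric, so all the functions concerned are even in every standard deviation, and an even `C²`
function of a standard deviation is differentiable in the variance up to `0`
(`differentiableWithinAt_comp_sqrtFst`). So `ψ₁` is jointly differentiable relative to the admissible
set (`differentiableWithinAt_psiOne`), the chain rule applies along the path, and stationarity removes
all but the explicit time derivative (`hasDerivWithinAt_psiOne_path`).

It remains to see that the `φ_k` vanish in the limit. As `m_0 = 1`, the first carries the factor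
`1 - m_1`, which tends to `0`; the others vanish or are bounded by the variances of the overlaps
(`abs_phi_le_overlapVar`). All derivatives being uniformly bounded, dominated convergence on `[0, 1]`
turns the limit of the derivatives into that of the differences of `ψ₁`
(`tendsto_sub_of_tendsto_derivWithin`).
-/


noncomputable section

set_option linter.unusedSectionVars false

namespace FullyLifted

/-! ### Tame functions of parameters and fields -/

section Tame

variable {Θ V : Type*} [NormedAddCommGroup Θ] [NormedSpace ℝ Θ] [NormedAddCommGroup V]
  [NormedSpace ℝ V]

/-- The directional derivative of `f` in the constant direction `h`. -/
def dirD (h : Θ × V) (f : Θ × V → ℝ) (w : Θ × V) : ℝ := fderiv ℝ f w h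

/-- Growth at most exponential in the field, locally uniformly in the parameter. -/
def LocExp (f : Θ × V → ℝ) : Prop :=
  ∀ B : ℝ, ∃ c : ℝ, 0 ≤ c ∧ ∀ w : Θ × V, ‖w.1‖ ≤ B → |f w| ≤ Real.exp (c * (1 + ‖w.2‖))

/-- Growth at most linear in the field, locally uniformly in the parameter. -/
def LocLin (f : Θ × V → ℝ) : Prop :=
  ∀ B : ℝ, ∃ c : ℝ, 0 ≤ c ∧ ∀ w : Θ × V, ‖w.1‖ ≤ B → |f w| ≤ c * (1 + ‖w.2‖)

/-- `f` is `k` times continuously differentiable, and it and its iterated directional derivatives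
up to order `k` grow at most exponentially in the field. -/
def TameN : ℕ → (Θ × V → ℝ) → Prop
  | 0, f => LocExp f ∧ Continuous f
  | k + 1, f => LocExp f ∧ Differentiable ℝ f ∧ ∀ h, TameN k (dirD h f)

/-- Smooth functions all of whose directional derivatives grow at most exponentially. -/
def Tame (f : Θ × V → ℝ) : Prop := ∀ k, TameN k f

lemma le_exp_of_nonneg (c : ℝ) : c ≤ Real.exp c := by
  linarith [Real.add_one_le_exp c]

lemma LocLin.locExp {f : Θ × V → ℝ} (hf : LocLin f) : LocExp f := by
  intro B
  obtain ⟨c, hc, h⟩ := hf B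
  exact ⟨c, hc, fun w hw => (h w hw).trans (le_exp_of_nonneg _)⟩

lemma LocExp.add {f g : Θ × V → ℝ} (hf : LocExp f) (hg : LocExp g) :
    LocExp (fun w => f w + g w) := by
  intro B
  obtain ⟨c, hc, h⟩ := hf B
  obtain ⟨c', hc', h'⟩ := hg B
  refine ⟨c + c' + 1, by positivity, fun w hw => ?_⟩
  have h1 := h w hw
  have h2 := h' w hw
  have hn : 0 ≤ ‖w.2‖ := norm_nonneg _
  have e1 : Real.exp (c * (1 + ‖w.2‖)) ≤ Real.exp ((c + c') * (1 + ‖w.2‖)) := by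
    gcongr; linarith
  have e2 : Real.exp (c' * (1 + ‖w.2‖)) ≤ Real.exp ((c + c') * (1 + ‖w.2‖)) := by
    gcongr; linarith
  have e3 : (2 : ℝ) ≤ Real.exp (1 * (1 + ‖w.2‖)) := by
    linarith [Real.add_one_le_exp (1 * (1 + ‖w.2‖))]
  calc |f w + g w| ≤ |f w| + |g w| := abs_add_le _ _
    _ ≤ Real.exp ((c + c') * (1 + ‖w.2‖)) * 2 := by linarith
    _ ≤ Real.exp ((c + c') * (1 + ‖w.2‖)) * Real.exp (1 * (1 + ‖w.2‖)) := by gcongr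
    _ = _ := by rw [← Real.exp_add]; ring_nf

lemma LocExp.mul {f g : Θ × V → ℝ} (hf : LocExp f) (hg : LocExp g) :
    LocExp (fun w => f w * g w) := by
  intro B
  obtain ⟨c, hc, h⟩ := hf B
  obtain ⟨c', hc', h'⟩ := hg B
  refine ⟨c + c', by positivity, fun w hw => ?_⟩
  rw [abs_mul, add_mul, Real.exp_add]
  exact mul_le_mul (h w hw) (h' w hw) (abs_nonneg _) (Real.exp_pos _).le

lemma locExp_const (a : ℝ) : LocExp (fun _ : Θ × V => a) := by
  intro B
  refine ⟨|a|, abs_nonneg _, fun w _ => (le_exp_of_nonneg _).trans ?_⟩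
  gcongr
  nlinarith [abs_nonneg a, norm_nonneg w.2]

lemma LocLin.exp {f : Θ × V → ℝ} (hf : LocLin f) : LocExp (fun w => Real.exp (f w)) := by
  intro B
  obtain ⟨c, hc, h⟩ := hf B
  refine ⟨c, hc, fun w hw => ?_⟩
  rw [abs_of_pos (Real.exp_pos _)]
  exact Real.exp_le_exp.2 ((le_abs_self _).trans (h w hw))

lemma LocLin.neg {f : Θ × V → ℝ} (hf : LocLin f) : LocLin (fun w => -f w) := by
  intro B
  obtain ⟨c, hc, h⟩ := hf B
  exact ⟨c, hc, fun w hw => by rw [abs_neg]; exact h w hw⟩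

/-- A linearly growing function stays so after multiplication by a continuous linear functional of
the parameter alone. -/
lemma LocLin.clm_mul {f : Θ × V → ℝ} (hf : LocLin f) (ρ : Θ →L[ℝ] ℝ) :
    LocLin (fun w => ρ w.1 * f w) := by
  intro B
  obtain ⟨c, hc, h⟩ := hf B
  refine ⟨‖ρ‖ * |B| * c, by positivity, fun w hw => ?_⟩
  rw [abs_mul, mul_assoc _ c]
  refine mul_le_mul ?_ (h w hw) (abs_nonneg _) (by positivity)
  exact (ρ.le_opNorm w.1).trans (by gcongr; exact hw.trans (le_abs_self _))

lemma TameN.locExp {k : ℕ} {f : Θ × V → ℝ} (hf : TameN k f) : LocExp f := by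
  cases k <;> exact hf.1

lemma TameN.continuous {k : ℕ} {f : Θ × V → ℝ} (hf : TameN k f) : Continuous f := by
  cases k
  · exact hf.2
  · exact hf.2.1.continuous

lemma TameN.pred {k : ℕ} : ∀ {f : Θ × V → ℝ}, TameN (k + 1) f → TameN k f := by
  induction k with
  | zero => exact fun hf => ⟨hf.1, hf.2.1.continuous⟩
  | succ k ih => exact fun hf => ⟨hf.1, hf.2.1, fun h => ih (hf.2.2 h)⟩

lemma dirD_add {f g : Θ × V → ℝ} (hf : Differentiable ℝ f) (hg : Differentiable ℝ g)
    (h : Θ × V) : dirD h (fun w => f w + g w) = fun w => dirD h f w + dirD h g w := by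
  funext w
  simp only [dirD]
  rw [fderiv_fun_add (hf w) (hg w)]; rfl

lemma dirD_mul {f g : Θ × V → ℝ} (hf : Differentiable ℝ f) (hg : Differentiable ℝ g)
    (h : Θ × V) :
    dirD h (fun w => f w * g w) = fun w => f w * dirD h g w + g w * dirD h f w := by
  funext w
  simp only [dirD]
  rw [fderiv_fun_mul (hf w) (hg w)]; simp

lemma dirD_const (a : ℝ) (h : Θ × V) : dirD h (fun _ => a) = fun _ => 0 := by
  funext w; simp [dirD]

lemma dirD_exp {f : Θ × V → ℝ} (hf : Differentiable ℝ f) (h : Θ × V) :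
    dirD h (fun w => Real.exp (f w)) = fun w => Real.exp (f w) * dirD h f w := by
  funext w
  simp only [dirD]
  rw [fderiv_exp (hf w)]; simp

lemma dirD_log {f : Θ × V → ℝ} (hf : Differentiable ℝ f) (h0 : ∀ w, f w ≠ 0) (h : Θ × V) :
    dirD h (fun w => Real.log (f w)) = fun w => (f w)⁻¹ * dirD h f w := by
  funext w
  simp only [dirD]
  rw [fderiv.log (hf w) (h0 w)]; simp

lemma TameN.add {k : ℕ} : ∀ {f g : Θ × V → ℝ}, TameN k f → TameN k g →
    TameN k (fun w => f w + g w) := by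
  induction k with
  | zero => exact fun hf hg => ⟨hf.1.add hg.1, hf.2.add hg.2⟩
  | succ k ih =>
    intro f g hf hg
    refine ⟨hf.1.add hg.1, hf.2.1.add hg.2.1, fun h => ?_⟩
    rw [dirD_add hf.2.1 hg.2.1]
    exact ih (hf.2.2 h) (hg.2.2 h)

lemma TameN.mul {k : ℕ} : ∀ {f g : Θ × V → ℝ}, TameN k f → TameN k g →
    TameN k (fun w => f w * g w) := by
  induction k with
  | zero => exact fun hf hg => ⟨hf.1.mul hg.1, hf.2.mul hg.2⟩
  | succ k ih =>
    intro f g hf hg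
    refine ⟨hf.1.mul hg.1, hf.2.1.mul hg.2.1, fun h => ?_⟩
    rw [dirD_mul hf.2.1 hg.2.1]
    exact (ih hf.pred (hg.2.2 h)).add (ih hg.pred (hf.2.2 h))

lemma tameN_const (k : ℕ) (a : ℝ) : TameN k (fun _ : Θ × V => a) := by
  induction k generalizing a with
  | zero => exact ⟨locExp_const a, continuous_const⟩
  | succ k ih =>
    exact ⟨locExp_const a, differentiable_const a, fun h => by rw [dirD_const]; exact ih 0⟩

lemma TameN.exp {k : ℕ} {f : Θ × V → ℝ} (hl : LocLin f) (hf : TameN k f) :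
    TameN k (fun w => Real.exp (f w)) := by
  induction k with
  | zero => exact ⟨hl.exp, Real.continuous_exp.comp hf.2⟩
  | succ k ih =>
    refine ⟨hl.exp, hf.2.1.exp, fun h => ?_⟩
    rw [dirD_exp hf.2.1]
    exact (ih hf.pred).mul (hf.2.2 h)

lemma Tame.locExp {f : Θ × V → ℝ} (hf : Tame f) : LocExp f := (hf 0).1

lemma Tame.continuous {f : Θ × V → ℝ} (hf : Tame f) : Continuous f := (hf 0).2

lemma Tame.differentiable {f : Θ × V → ℝ} (hf : Tame f) : Differentiable ℝ f := (hf 1).2.1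

lemma Tame.dirD {f : Θ × V → ℝ} (hf : Tame f) (h : Θ × V) : Tame (dirD h f) :=
  fun k => (hf (k + 1)).2.2 h

lemma Tame.add {f g : Θ × V → ℝ} (hf : Tame f) (hg : Tame g) : Tame (fun w => f w + g w) :=
  fun k => (hf k).add (hg k)

lemma Tame.mul {f g : Θ × V → ℝ} (hf : Tame f) (hg : Tame g) : Tame (fun w => f w * g w) :=
  fun k => (hf k).mul (hg k)

lemma tame_const (a : ℝ) : Tame (fun _ : Θ × V => a) := fun k => tameN_const k a

lemma Tame.const_mul {f : Θ × V → ℝ} (hf : Tame f) (a : ℝ) : Tame (fun w => a * f w) :=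
  (tame_const a).mul hf

lemma Tame.neg {f : Θ × V → ℝ} (hf : Tame f) : Tame (fun w => -f w) := by
  simpa using hf.const_mul (-1)

lemma Tame.sub {f g : Θ × V → ℝ} (hf : Tame f) (hg : Tame g) : Tame (fun w => f w - g w) := by
  simpa [sub_eq_add_neg] using hf.add hg.neg

lemma Tame.sum {ι : Type*} {s : Finset ι} {f : ι → Θ × V → ℝ} (hf : ∀ i ∈ s, Tame (f i)) :
    Tame (fun w => ∑ i ∈ s, f i w) := by
  classical
  induction s using Finset.induction_on with
  | empty => simpa using tame_const 0
  | insert a s ha ih =>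
    simp only [Finset.sum_insert ha]
    exact (hf a (by simp)).add (ih fun i hi => hf i (by simp [hi]))

lemma TameN.sum {k : ℕ} {ι : Type*} {s : Finset ι} {f : ι → Θ × V → ℝ}
    (hf : ∀ i ∈ s, TameN k (f i)) : TameN k (fun w => ∑ i ∈ s, f i w) := by
  classical
  induction s using Finset.induction_on with
  | empty => simpa using tameN_const k 0
  | insert a s ha ih =>
    simp only [Finset.sum_insert ha]
    exact (hf a (by simp)).add (ih fun i hi => hf i (by simp [hi]))

lemma Tame.exp {f : Θ × V → ℝ} (hl : LocLin f) (hf : Tame f) :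
    Tame (fun w => Real.exp (f w)) := fun k => (hf k).exp hl

/-- The logarithm of a positive tame function is tame as soon as it grows linearly. -/
lemma Tame.log {f : Θ × V → ℝ} (h0 : ∀ w, 0 < f w) (hl : LocLin (fun w => Real.log (f w)))
    (hf : Tame f) : Tame (fun w => Real.log (f w)) := by
  intro k
  induction k with
  | zero => exact ⟨hl.locExp, hf.continuous.log fun w => (h0 w).ne'⟩
  | succ k ih =>
    refine ⟨hl.locExp, hf.differentiable.log fun w => (h0 w).ne', fun h => ?_⟩
    rw [dirD_log hf.differentiable fun w => (h0 w).ne']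
    have e : (fun w => (f w)⁻¹ * FullyLifted.dirD h f w)
        = fun w => Real.exp (-Real.log (f w)) * FullyLifted.dirD h f w := by
      funext w; rw [Real.exp_neg, Real.exp_log (h0 w)]
    rw [e]
    refine TameN.mul (TameN.exp hl.neg ?_) (hf.dirD h k)
    simpa using (tameN_const k (-1)).mul ih

/-- A continuous linear functional of the parameter and the field is tame. -/
lemma tame_clm (ρ : Θ × V →L[ℝ] ℝ) : Tame (fun w => ρ w) := by
  have hl : LocExp (fun w => ρ w) := by
    refine LocLin.locExp fun B => ⟨‖ρ‖ * (|B| + 1), by positivity, fun w hw => ?_⟩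
    refine (ρ.le_opNorm w).trans ?_
    rw [mul_assoc]
    gcongr
    rw [Prod.norm_def]
    have h1 : ‖w.1‖ ≤ |B| := hw.trans (le_abs_self _)
    have h2 : 0 ≤ ‖w.2‖ := norm_nonneg _
    refine max_le ?_ ?_ <;> nlinarith [abs_nonneg B]
  intro k
  cases k with
  | zero => exact ⟨hl, ρ.continuous⟩
  | succ k =>
    refine ⟨hl, ρ.differentiable, fun h => ?_⟩
    have : dirD h (fun w => ρ w) = fun _ => ρ h := by
      funext w; simp [dirD]
    rw [this]; exact tameN_const k _

lemma tame_param (ρ : Θ →L[ℝ] ℝ) : Tame (fun w : Θ × V => ρ w.1) :=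
  tame_clm (ρ.comp (ContinuousLinearMap.fst ℝ Θ V))

variable [FiniteDimensional ℝ Θ] [FiniteDimensional ℝ V]

lemma TameN.continuous_fderiv {k : ℕ} {f : Θ × V → ℝ} (hf : TameN (k + 1) f) :
    Continuous (fderiv ℝ f) :=
  continuous_clm_apply.2 fun h => (hf.2.2 h).continuous

lemma TameN.locExp_fderiv {k : ℕ} {f : Θ × V → ℝ} (hf : TameN (k + 1) f) :
    LocExp (fun w => ‖fderiv ℝ f w‖) := by
  intro B
  let b := Module.finBasis ℝ (Θ × V)
  obtain ⟨C, hC, hb⟩ := b.exists_opNorm_le (F := ℝ)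
  choose c hc h using fun i => (hf.2.2 (b i)).locExp B
  refine ⟨C + ∑ i, c i, add_nonneg hC.le (Finset.sum_nonneg fun i _ => hc i), fun w hw => ?_⟩
  rw [abs_of_nonneg (norm_nonneg _)]
  have hn : 0 ≤ ‖w.2‖ := norm_nonneg _
  have h1 : ‖fderiv ℝ f w‖ ≤ C * Real.exp ((∑ i, c i) * (1 + ‖w.2‖)) := by
    refine hb (Real.exp_pos _).le fun i => (h i w hw).trans ?_
    gcongr
    exact Finset.single_le_sum (f := c) (fun i _ => hc i) (Finset.mem_univ i)
  have h2 : C ≤ Real.exp (C * (1 + ‖w.2‖)) :=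
    (le_exp_of_nonneg C).trans (by gcongr; nlinarith)
  rw [add_mul, Real.exp_add]
  exact h1.trans (by gcongr)

end Tame

/-! ### Averaging a tame function over a random shift of the field -/

section Average

variable {Θ E 𝒳 : Type*} [NormedAddCommGroup Θ] [NormedSpace ℝ Θ] [Fintype E] [DecidableEq E]
  [NormedAddCommGroup 𝒳] [NormedSpace ℝ 𝒳] [MeasurableSpace 𝒳]

/-- All exponential moments of the norm are finite. -/
def ExpMoments (ν : Measure 𝒳) : Prop := ∀ c : ℝ, Integrable (fun x => Real.exp (c * ‖x‖)) ν

/-- Continuous weights of at most exponential growth. -/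
def ExpWeight (q : 𝒳 → ℝ) : Prop :=
  Continuous q ∧ ∃ a : ℝ, 0 ≤ a ∧ ∀ x, |q x| ≤ Real.exp (a * (1 + ‖x‖))

/-- The shift of the field by `B θ x`, where `x` is the noise. -/
def shift (B : Θ →L[ℝ] 𝒳 →L[ℝ] (E → ℝ)) (x : 𝒳) (w : Θ × (E → ℝ)) : Θ × (E → ℝ) :=
  (w.1, w.2 + B w.1 x)

/-- For a fixed noise, the shift is linear in the parameter and the field. -/
def shiftL (B : Θ →L[ℝ] 𝒳 →L[ℝ] (E → ℝ)) (x : 𝒳) :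
    Θ × (E → ℝ) →L[ℝ] Θ × (E → ℝ) :=
  ContinuousLinearMap.id ℝ _ +
    (ContinuousLinearMap.inr ℝ Θ (E → ℝ)).comp
      ((B.flip x).comp (ContinuousLinearMap.fst ℝ Θ (E → ℝ)))

lemma shiftL_apply (B : Θ →L[ℝ] 𝒳 →L[ℝ] (E → ℝ)) (x : 𝒳) (w : Θ × (E → ℝ)) :
    shiftL B x w = shift B x w := by
  ext <;> simp [shiftL, shift]

/-- The average `∫ q(x) f(θ, v + B θ x) dν(x)`. -/
def wavg (ν : Measure 𝒳) (B : Θ →L[ℝ] 𝒳 →L[ℝ] (E → ℝ)) (q : 𝒳 → ℝ) (f : Θ × (E → ℝ) → ℝ)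
    (w : Θ × (E → ℝ)) : ℝ := ∫ x, q x * f (shift B x w) ∂ν

/-- The average `∫ f(θ, v + B θ x) dν(x)` over a random shift of the field. -/
def gavg (ν : Measure 𝒳) (B : Θ →L[ℝ] 𝒳 →L[ℝ] (E → ℝ)) (f : Θ × (E → ℝ) → ℝ)
    (w : Θ × (E → ℝ)) : ℝ := ∫ x, f (shift B x w) ∂ν

lemma gavg_eq_wavg (ν : Measure 𝒳) (B : Θ →L[ℝ] 𝒳 →L[ℝ] (E → ℝ)) (f : Θ × (E → ℝ) → ℝ) :
    gavg ν B f = wavg ν B (fun _ => 1) f := by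
  funext w; simp [gavg, wavg]

lemma expWeight_const (a : ℝ) : ExpWeight (fun _ : 𝒳 => a) := by
  refine ⟨continuous_const, |a|, abs_nonneg _, fun x => (le_exp_of_nonneg _).trans ?_⟩
  gcongr
  nlinarith [abs_nonneg a, norm_nonneg x]

lemma expWeight_clm (L : 𝒳 →L[ℝ] ℝ) : ExpWeight (fun x => L x) := by
  refine ⟨L.continuous, ‖L‖, norm_nonneg _, fun x => ?_⟩
  refine (L.le_opNorm x).trans ((le_exp_of_nonneg _).trans ?_)
  gcongr
  linarith

lemma ExpWeight.mul {q q' : 𝒳 → ℝ} (hq : ExpWeight q) (hq' : ExpWeight q') :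
    ExpWeight (fun x => q x * q' x) := by
  obtain ⟨h1, a, ha, h2⟩ := hq
  obtain ⟨h1', a', ha', h2'⟩ := hq'
  refine ⟨h1.mul h1', a + a', by positivity, fun x => ?_⟩
  rw [abs_mul, add_mul, Real.exp_add]
  exact mul_le_mul (h2 x) (h2' x) (abs_nonneg _) (Real.exp_pos _).le

lemma norm_shift_le (B : Θ →L[ℝ] 𝒳 →L[ℝ] (E → ℝ)) (x : 𝒳) {w : Θ × (E → ℝ)} {b : ℝ}
    (hw : ‖w.1‖ ≤ b) : ‖(shift B x w).2‖ ≤ ‖w.2‖ + ‖B‖ * b * ‖x‖ := by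
  refine (norm_add_le _ _).trans ?_
  gcongr
  exact (B.le_opNorm₂ w.1 x).trans (by gcongr)

lemma LocExp.shift_bound {f : Θ × (E → ℝ) → ℝ} (hf : LocExp f)
    (B : Θ →L[ℝ] 𝒳 →L[ℝ] (E → ℝ)) (b : ℝ) (hb : 0 ≤ b) :
    ∃ c c' : ℝ, 0 ≤ c ∧ 0 ≤ c' ∧ ∀ w : Θ × (E → ℝ), ‖w.1‖ ≤ b → ∀ x,
      |f (shift B x w)| ≤ Real.exp (c * (1 + ‖w.2‖)) * Real.exp (c' * ‖x‖) := by
  obtain ⟨c, hc, h⟩ := hf b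
  refine ⟨c, c * (‖B‖ * b), hc, by positivity, fun w hw x => ?_⟩
  refine (h (shift B x w) hw).trans ?_
  rw [← Real.exp_add]
  gcongr
  nlinarith [mul_le_mul_of_nonneg_left (norm_shift_le B x hw) hc]

lemma continuous_shift_noise (B : Θ →L[ℝ] 𝒳 →L[ℝ] (E → ℝ)) (w : Θ × (E → ℝ)) :
    Continuous (fun x => shift B x w) := by
  unfold shift; fun_prop

lemma continuous_shift (B : Θ →L[ℝ] 𝒳 →L[ℝ] (E → ℝ)) (x : 𝒳) :
    Continuous (fun w => shift B x w) := by
  simp_rw [← shiftL_apply]; exact (shiftL B x).continuous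

variable [BorelSpace 𝒳] [FiniteDimensional ℝ 𝒳]

section

variable {ν : Measure 𝒳} (hν : ExpMoments ν) {B : Θ →L[ℝ] 𝒳 →L[ℝ] (E → ℝ)} {q : 𝒳 → ℝ}
  (hq : ExpWeight q)

include hν hq

/-- The domination, locally uniform in the parameter and the field, that justifies differentiating
under the integral. -/
lemma weight_bound {f : Θ × (E → ℝ) → ℝ} (hf : LocExp f) (b : ℝ) (hb : 0 ≤ b) :
    ∃ c : ℝ, 0 ≤ c ∧ ∃ g : 𝒳 → ℝ, Integrable g ν ∧ (∀ x, 0 ≤ g x) ∧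
      ∀ w : Θ × (E → ℝ), ‖w.1‖ ≤ b → ∀ x,
      |q x * f (shift B x w)| ≤ Real.exp (c * (1 + ‖w.2‖)) * g x := by
  obtain ⟨c, c', hc, hc', h⟩ := hf.shift_bound B b hb
  obtain ⟨-, a, ha, hqa⟩ := hq
  refine ⟨c, hc, fun x => Real.exp a * Real.exp ((a + c') * ‖x‖), (hν _).const_mul _,
    fun x => by positivity, fun w hw x => ?_⟩
  rw [abs_mul]
  refine (mul_le_mul (hqa x) (h w hw x) (abs_nonneg _) (Real.exp_pos _).le).trans (le_of_eq ?_)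
  simp only [← Real.exp_add]
  ring_nf

lemma integrable_weight {f : Θ × (E → ℝ) → ℝ} (hf : LocExp f) (hc : Continuous f)
    (w : Θ × (E → ℝ)) : Integrable (fun x => q x * f (shift B x w)) ν := by
  obtain ⟨c, -, g, hg, -, h⟩ := weight_bound hν hq (B := B) hf ‖w.1‖ (norm_nonneg _)
  refine (hg.const_mul (Real.exp (c * (1 + ‖w.2‖)))).mono' ?_ ?_
  · exact (hq.1.mul (hc.comp (continuous_shift_noise B w))).aestronglyMeasurable
  · exact ae_of_all _ fun x => h w le_rfl x

lemma LocExp.wavg {f : Θ × (E → ℝ) → ℝ} (hf : LocExp f) : LocExp (wavg ν B q f) := by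
  intro b
  obtain ⟨c, hc, g, hg, hg0, h⟩ := weight_bound hν hq (B := B) hf |b| (abs_nonneg _)
  have hi : 0 ≤ ∫ x, g x ∂ν := integral_nonneg hg0
  refine ⟨c + ∫ x, g x ∂ν, by positivity, fun w hw => ?_⟩
  have h1 : |FullyLifted.wavg ν B q f w| ≤ Real.exp (c * (1 + ‖w.2‖)) * ∫ x, g x ∂ν := by
    rw [← integral_const_mul]
    exact norm_integral_le_of_norm_le (hg.const_mul _)
      (ae_of_all _ fun x => (Real.norm_eq_abs _).trans_le (h w (hw.trans (le_abs_self _)) x))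
  refine h1.trans ?_
  rw [add_mul, Real.exp_add]
  gcongr
  refine (le_exp_of_nonneg _).trans ?_
  gcongr
  nlinarith [norm_nonneg w.2]

lemma continuous_wavg {f : Θ × (E → ℝ) → ℝ} (hf : LocExp f) (hc : Continuous f) :
    Continuous (FullyLifted.wavg ν B q f) := by
  rw [continuous_iff_continuousAt]
  intro w₀
  obtain ⟨c, hc0, g, hg, hg0, h⟩ := weight_bound hν hq (B := B) hf (‖w₀.1‖ + 1) (by positivity)
  have hev : ∀ᶠ w in 𝓝 w₀, ‖w.1‖ ≤ ‖w₀.1‖ + 1 ∧ ‖w.2‖ ≤ ‖w₀.2‖ + 1 := by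
    refine Filter.Eventually.and ?_ ?_
    · exact (continuous_fst.norm.tendsto w₀).eventually (Iic_mem_nhds (by linarith))
    · exact (continuous_snd.norm.tendsto w₀).eventually (Iic_mem_nhds (by linarith))
  refine continuousAt_of_dominated
    (bound := fun x => Real.exp (c * (1 + (‖w₀.2‖ + 1))) * g x) ?_ ?_ (hg.const_mul _) ?_
  · exact Eventually.of_forall fun w =>
      (hq.1.mul (hc.comp (continuous_shift_noise B w))).aestronglyMeasurable
  · filter_upwards [hev] with w hw
    refine ae_of_all _ fun x => (h w hw.1 x).trans ?_
    have := hg0 x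
    gcongr
    exact hw.2
  · exact ae_of_all _ fun x =>
      (continuous_const.mul (hc.comp (continuous_shift B x))).continuousAt

variable [FiniteDimensional ℝ Θ]

/-- Differentiation under the average. The term with `B h.1` appears because the shift itself
depends on the parameter. -/
lemma wavg_hasFDerivAt {f : Θ × (E → ℝ) → ℝ} (hf : TameN 1 f) (w₀ : Θ × (E → ℝ)) :
    Differentiable ℝ (FullyLifted.wavg ν B q f) ∧ ∀ h, dirD h (FullyLifted.wavg ν B q f) w₀
      = FullyLifted.wavg ν B q (dirD h f) w₀ +
        ∑ e, FullyLifted.wavg ν B (fun x => q x * B h.1 x e) (dirD (0, Pi.single e 1) f) w₀ := by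
  let F' : Θ × (E → ℝ) → 𝒳 → (Θ × (E → ℝ) →L[ℝ] ℝ) := fun w x =>
    q x • (fderiv ℝ f (shift B x w)).comp (shiftL B x)
  have key : ∀ w₀ : Θ × (E → ℝ), Integrable (F' w₀) ν ∧
      HasFDerivAt (FullyLifted.wavg ν B q f) (∫ x, F' w₀ x ∂ν) w₀ := by
    intro w₀
    set κ : ℝ := ‖ContinuousLinearMap.inr ℝ Θ (E → ℝ)‖ * ‖B‖ * ‖ContinuousLinearMap.fst ℝ Θ (E → ℝ)‖
      + ‖ContinuousLinearMap.id ℝ (Θ × (E → ℝ))‖ with hκ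
    have hκ0 : 0 ≤ κ := by positivity
    have hopn : ∀ x, ‖shiftL B x‖ ≤ Real.exp (κ * (1 + ‖x‖)) := by
      intro x
      refine le_trans ?_ (le_exp_of_nonneg _)
      refine (norm_add_le _ _).trans ?_
      have h1 : ‖(ContinuousLinearMap.inr ℝ Θ (E → ℝ)).comp
          ((B.flip x).comp (ContinuousLinearMap.fst ℝ Θ (E → ℝ)))‖
          ≤ ‖ContinuousLinearMap.inr ℝ Θ (E → ℝ)‖ *
            ((‖B‖ * ‖x‖) * ‖ContinuousLinearMap.fst ℝ Θ (E → ℝ)‖) := by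
        refine (ContinuousLinearMap.opNorm_comp_le _ _).trans ?_
        gcongr
        refine (ContinuousLinearMap.opNorm_comp_le _ _).trans ?_
        gcongr
        exact (B.flip.le_opNorm x).trans (by rw [ContinuousLinearMap.opNorm_flip])
      have h2 : 0 ≤ ‖ContinuousLinearMap.inr ℝ Θ (E → ℝ)‖ * ‖B‖
        * ‖ContinuousLinearMap.fst ℝ Θ (E → ℝ)‖ := by positivity
      have h3 := mul_nonneg (norm_nonneg (ContinuousLinearMap.id ℝ (Θ × (E → ℝ)))) (norm_nonneg x)
      rw [hκ]
      nlinarith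
    obtain ⟨c, hc0, g, hg, hg0, h⟩ := weight_bound hν
      (ExpWeight.mul (q := fun x => Real.exp (κ * (1 + ‖x‖)))
        ⟨by fun_prop, κ, hκ0, fun x => (abs_of_pos (Real.exp_pos _)).le⟩ hq)
      (B := B) hf.locExp_fderiv (‖w₀.1‖ + 1) (by positivity)
    have hcont : ∀ w, Continuous (F' w) := by
      intro w
      have h1 : Continuous fun x => fderiv ℝ f (shift B x w) :=
        hf.continuous_fderiv.comp (continuous_shift_noise B w)
      have h2 : Continuous fun x => shiftL B x := by
        unfold shiftL
        have : Continuous fun x => B.flip x := B.flip.continuous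
        fun_prop
      exact hq.1.smul (h1.clm_comp h2)
    have hbound : ∀ w : Θ × (E → ℝ), ‖w.1‖ ≤ ‖w₀.1‖ + 1 → ∀ x,
        ‖F' w x‖ ≤ Real.exp (c * (1 + ‖w.2‖)) * g x := by
      intro w hw x
      have h1 := h w hw x
      rw [abs_mul, abs_mul, abs_of_pos (Real.exp_pos _), abs_of_nonneg (norm_nonneg _)] at h1
      simp only [F']
      rw [norm_smul, Real.norm_eq_abs]
      calc |q x| * ‖(fderiv ℝ f (shift B x w)).comp (shiftL B x)‖
          ≤ |q x| * (‖fderiv ℝ f (shift B x w)‖ * ‖shiftL B x‖) := by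
            gcongr; exact ContinuousLinearMap.opNorm_comp_le _ _
        _ ≤ |q x| * (‖fderiv ℝ f (shift B x w)‖ * Real.exp (κ * (1 + ‖x‖))) := by
            gcongr; exact hopn x
        _ = Real.exp (κ * (1 + ‖x‖)) * |q x| * ‖fderiv ℝ f (shift B x w)‖ := by ring
        _ ≤ _ := h1
    have hs : {w : Θ × (E → ℝ) | ‖w.1‖ ≤ ‖w₀.1‖ + 1 ∧ ‖w.2‖ ≤ ‖w₀.2‖ + 1} ∈ 𝓝 w₀ := by
      refine Filter.Eventually.and ?_ ?_
      · exact (continuous_fst.norm.tendsto w₀).eventually (Iic_mem_nhds (by linarith))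
      · exact (continuous_snd.norm.tendsto w₀).eventually (Iic_mem_nhds (by linarith))
    refine ⟨(hg.const_mul (Real.exp (c * (1 + ‖w₀.2‖)))).mono' (hcont w₀).aestronglyMeasurable
      (ae_of_all _ fun x => hbound w₀ (by linarith) x), ?_⟩
    refine hasFDerivAt_integral_of_dominated_of_fderiv_le
      (bound := fun x => Real.exp (c * (1 + (‖w₀.2‖ + 1))) * g x) hs ?_ ?_ ?_ ?_
      (hg.const_mul _) ?_
    · exact Eventually.of_forall fun w =>
        (hq.1.mul (hf.continuous.comp (continuous_shift_noise B w))).aestronglyMeasurable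
    · exact integrable_weight hν hq hf.locExp hf.continuous w₀
    · exact (hcont w₀).aestronglyMeasurable
    · refine ae_of_all _ fun x w hw => (hbound w hw.1 x).trans ?_
      have := hg0 x
      have := hw.2
      gcongr
    · refine ae_of_all _ fun x w _ => ?_
      have h1 : HasFDerivAt (fun w => f (shift B x w))
          ((fderiv ℝ f (shift B x w)).comp (shiftL B x)) w := by
        have h2 : HasFDerivAt (fun w => shift B x w) (shiftL B x) w := by
          simp_rw [← shiftL_apply]; exact (shiftL B x).hasFDerivAt
        exact ((hf.2.1 (shift B x w)).hasFDerivAt).comp w h2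
      exact h1.const_mul (q x)
  refine ⟨fun w => (key w).2.differentiableAt, fun h => ?_⟩
  have hq2 : ∀ e, ExpWeight (fun x => q x * B h.1 x e) := fun e =>
    hq.mul (expWeight_clm ((ContinuousLinearMap.proj (R := ℝ) (φ := fun _ : E => ℝ) e).comp
      (B h.1)))
  rw [dirD, (key w₀).2.fderiv, ContinuousLinearMap.integral_apply (key w₀).1]
  simp only [FullyLifted.wavg]
  rw [← integral_finsetSum _ fun e _ => integrable_weight hν (hq2 e)
      (hf.2.2 _).locExp (hf.2.2 _).continuous w₀,
    ← integral_add (integrable_weight hν hq (hf.2.2 _).locExp (hf.2.2 _).continuous w₀)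
      (integrable_finsetSum _ fun e _ => integrable_weight hν (hq2 e)
      (hf.2.2 _).locExp (hf.2.2 _).continuous w₀)]
  refine integral_congr_ae (ae_of_all _ fun x => ?_)
  simp only [F', _root_.smul_apply, ContinuousLinearMap.comp_apply, smul_eq_mul, dirD]
  have e1 : shiftL B x h = h + ∑ e, B h.1 x e • ((0 : Θ), (Pi.single e 1 : E → ℝ)) := by
    rw [shiftL_apply]
    refine Prod.ext ?_ ?_
    · simp [shift, Prod.fst_sum]
    · simp only [shift, Prod.snd_add, Prod.snd_sum, Prod.smul_snd]
      congr 1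
      funext e
      simp [Finset.sum_apply, Pi.single_apply]
  rw [e1, map_add, map_sum, mul_add, Finset.mul_sum]
  simp only [map_smul, smul_eq_mul]
  congr 1
  exact Finset.sum_congr rfl fun e _ => by ring

lemma TameN.wavg {k : ℕ} {f : Θ × (E → ℝ) → ℝ} (hf : TameN k f) :
    TameN k (FullyLifted.wavg ν B q f) := by
  induction k generalizing f q with
  | zero => exact ⟨hf.1.wavg hν hq, continuous_wavg hν hq hf.1 hf.2⟩
  | succ k ih =>
    have h1 : TameN 1 f := by
      clear ih
      induction k with
      | zero => exact hf
      | succ k ih => exact ih hf.pred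
    refine ⟨hf.1.wavg hν hq, (wavg_hasFDerivAt hν hq h1 0).1, fun h => ?_⟩
    have : dirD h (FullyLifted.wavg ν B q f) = fun w₀ => FullyLifted.wavg ν B q (dirD h f) w₀ +
        ∑ e, FullyLifted.wavg ν B (fun x => q x * B h.1 x e) (dirD (0, Pi.single e 1) f) w₀ := by
      funext w₀; exact (wavg_hasFDerivAt hν hq h1 w₀).2 h
    rw [this]
    refine (ih hq (hf.2.2 h)).add (TameN.sum fun e _ => ih ?_ (hf.2.2 _))
    exact hq.mul (expWeight_clm ((ContinuousLinearMap.proj (R := ℝ) (φ := fun _ : E => ℝ) e).comp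
      (B h.1)))

end

variable {ν : Measure 𝒳} {B : Θ →L[ℝ] 𝒳 →L[ℝ] (E → ℝ)}

lemma Tame.integrable_shift (hν : ExpMoments ν) {f : Θ × (E → ℝ) → ℝ} (hf : Tame f)
    (w : Θ × (E → ℝ)) : Integrable (fun x => f (shift B x w)) ν := by
  simpa using integrable_weight hν (expWeight_const 1) (B := B) hf.locExp hf.continuous w

variable [FiniteDimensional ℝ Θ]

lemma Tame.gavg (hν : ExpMoments ν) {f : Θ × (E → ℝ) → ℝ} (hf : Tame f) :
    Tame (gavg ν B f) := by
  rw [gavg_eq_wavg]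
  exact fun k => (hf k).wavg hν (expWeight_const 1)

/-- Averaging commutes with differentiation in the field. -/
lemma dirD_gavg_field (hν : ExpMoments ν) {f : Θ × (E → ℝ) → ℝ} (hf : Tame f) (e : E → ℝ) :
    FullyLifted.dirD (0, e) (FullyLifted.gavg ν B f)
      = FullyLifted.gavg ν B (FullyLifted.dirD (0, e) f) := by
  funext w
  rw [gavg_eq_wavg, (wavg_hasFDerivAt hν (expWeight_const 1) (hf 1) w).2, gavg_eq_wavg]
  simp [FullyLifted.wavg]

/-- The logarithm of the average of `exp ∘ U` grows linearly if `U` does. -/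
lemma LocLin.log_gavg_exp [IsProbabilityMeasure ν] (hν : ExpMoments ν) {U : Θ × (E → ℝ) → ℝ}
    (hl : LocLin U) (hU : Continuous U) :
    (∀ w, 0 < FullyLifted.gavg ν B (fun w => Real.exp (U w)) w) ∧
    LocLin (fun w => Real.log (FullyLifted.gavg ν B (fun w => Real.exp (U w)) w)) := by
  have hint : ∀ w, Integrable (fun x => Real.exp (U (shift B x w))) ν := fun w => by
    simpa using integrable_weight hν (expWeight_const 1) (B := B) hl.exp
      (Real.continuous_exp.comp hU) w
  have hpos : ∀ w, 0 < FullyLifted.gavg ν B (fun w => Real.exp (U w)) w := fun w =>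
    integral_exp_pos (hint w)
  refine ⟨hpos, fun b => ?_⟩
  obtain ⟨c, hc, h⟩ := hl |b|
  -- both bounds come from `|U(θ, v + B θ x)| ≤ c (1 + ‖v‖) + c' ‖x‖`
  set c' := c * (‖B‖ * |b|) with hc'
  have hU' : ∀ w : Θ × (E → ℝ), ‖w.1‖ ≤ b → ∀ x,
      |U (shift B x w)| ≤ c * (1 + ‖w.2‖) + c' * ‖x‖ := by
    intro w hw x
    have hw' : ‖w.1‖ ≤ |b| := hw.trans (le_abs_self _)
    refine (h (shift B x w) hw').trans ?_
    have := norm_shift_le B x hw'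
    rw [hc']
    nlinarith [mul_le_mul_of_nonneg_left this hc]
  have hp : 0 < ∫ x, Real.exp (c' * ‖x‖) ∂ν := integral_exp_pos (hν c')
  have hm : 0 < ∫ x, Real.exp (-c' * ‖x‖) ∂ν := integral_exp_pos (hν (-c'))
  set a₁ := Real.log (∫ x, Real.exp (c' * ‖x‖) ∂ν)
  set a₂ := Real.log (∫ x, Real.exp (-c' * ‖x‖) ∂ν)
  refine ⟨c + |a₁| + |a₂|, by positivity, fun w hw => ?_⟩
  have hup : FullyLifted.gavg ν B (fun w => Real.exp (U w)) w
      ≤ Real.exp (c * (1 + ‖w.2‖) + a₁) := by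
    rw [Real.exp_add, Real.exp_log hp, ← integral_const_mul]
    refine integral_mono (hint w) ((hν c').const_mul _) fun x => ?_
    simp only [← Real.exp_add]
    exact Real.exp_le_exp.2 ((le_abs_self _).trans (hU' w hw x))
  have hlo : Real.exp (-(c * (1 + ‖w.2‖)) + a₂)
      ≤ FullyLifted.gavg ν B (fun w => Real.exp (U w)) w := by
    rw [Real.exp_add, Real.exp_log hm, ← integral_const_mul]
    refine integral_mono ((hν (-c')).const_mul _) (hint w) fun x => ?_
    simp only [← Real.exp_add]
    refine Real.exp_le_exp.2 ?_
    have := (abs_le.1 (hU' w hw x)).1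
    linarith
  have h1 : Real.log (FullyLifted.gavg ν B (fun w => Real.exp (U w)) w)
      ≤ c * (1 + ‖w.2‖) + a₁ := (Real.log_le_iff_le_exp (hpos w)).2 hup
  have h2 : -(c * (1 + ‖w.2‖)) + a₂ ≤ Real.log (FullyLifted.gavg ν B (fun w => Real.exp (U w)) w) :=
    (Real.le_log_iff_exp_le (hpos w)).2 hlo
  have hn : 0 ≤ ‖w.2‖ := norm_nonneg _
  have i1 := le_abs_self a₁
  have i2 := neg_abs_le a₂
  have i3 := mul_nonneg (abs_nonneg a₁) hn
  have i4 := mul_nonneg (abs_nonneg a₂) hn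
  have i5 := abs_nonneg a₁
  have i6 := abs_nonneg a₂
  rw [abs_le]
  constructor <;> nlinarith

end Average

/-! ### Passing from standard deviations to variances -/

section Sqrt

lemma TameN.contDiff {Θ V : Type*} [NormedAddCommGroup Θ] [NormedSpace ℝ Θ]
    [NormedAddCommGroup V] [NormedSpace ℝ V] [FiniteDimensional ℝ Θ] [FiniteDimensional ℝ V]
    {k : ℕ} {f : Θ × V → ℝ} (hf : TameN k f) : ContDiff ℝ k f := by
  induction k generalizing f with
  | zero => exact contDiff_zero.2 hf.2
  | succ k ih =>
    rw [Nat.cast_succ, contDiff_succ_iff_fderiv]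
    refine ⟨hf.2.1, by simp, ?_⟩
    exact contDiff_clm_apply_iff.2 fun h => ih (hf.2.2 h)

variable {Θ : Type*} [NormedAddCommGroup Θ] [NormedSpace ℝ Θ]

/-- A `C²` function that is even in the direction `e` has there a derivative divisible by the
corresponding coordinate `c`. -/
lemma exists_continuous_quotient_of_even {F : Θ → ℝ} (hF : ContDiff ℝ 2 F) (e : Θ)
    (c : Θ →L[ℝ] ℝ) (hce : c e = 1) (heven : ∀ z, F (z - (2 * c z) • e) = F z) :
    ∃ G : Θ → ℝ, Continuous G ∧ ∀ z, fderiv ℝ F z e = c z * G z := by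
  set D : Θ → ℝ := fun z => fderiv ℝ F z e with hD
  have hD1 : ContDiff ℝ 1 D := by
    have : ContDiff ℝ 1 (fderiv ℝ F) := hF.fderiv_right (by norm_num)
    exact this.clm_apply contDiff_const
  have hDd : Differentiable ℝ D := hD1.differentiable (by norm_num)
  -- the derivative is odd, hence vanishes on the hyperplane `c = 0`
  have hD0 : ∀ z, c z = 0 → D z = 0 := by
    intro z hz
    let T : Θ →L[ℝ] Θ := ContinuousLinearMap.id ℝ Θ - (2 : ℝ) • c.smulRight e
    have hT : ∀ z, T z = z - (2 * c z) • e := fun z => by simp [T, mul_smul]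
    have h1 : (fun z => F (T z)) = F := by funext z; rw [hT]; exact heven z
    have h2 : HasFDerivAt (fun z => F (T z)) ((fderiv ℝ F (T z)).comp T) z :=
      ((hF.differentiable (by norm_num)) (T z)).hasFDerivAt.comp z T.hasFDerivAt
    rw [h1] at h2
    have h3 := h2.fderiv
    have h4 : T z = z := by rw [hT, hz]; simp
    have h5 : T e = -e := by rw [hT, hce, mul_one, two_smul]; abel
    have h6 : D z = -D z := by
      simp only [hD]
      conv_lhs => rw [h3]
      rw [ContinuousLinearMap.comp_apply, h4, h5, map_neg]
    linarith
  have hcont : Continuous fun z => fderiv ℝ D z e :=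
    (hD1.continuous_fderiv (by norm_num)).clm_apply continuous_const
  -- average the second derivative over the segment from the hyperplane to `z`
  refine ⟨fun z => ∫ s in (0 : ℝ)..1, fderiv ℝ D (z + ((s - 1) * c z) • e) e, ?_, fun z => ?_⟩
  · refine intervalIntegral.continuous_parametric_intervalIntegral_of_continuous' ?_ 0 1
    refine hcont.comp ?_
    fun_prop
  · have hder : ∀ s : ℝ, HasDerivAt (fun s : ℝ => D (z + ((s - 1) * c z) • e))
        (c z * fderiv ℝ D (z + ((s - 1) * c z) • e) e) s := by
      intro s
      have hp : HasDerivAt (fun s : ℝ => z + ((s - 1) * c z) • e) ((1 * c z) • e) s :=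
        ((((hasDerivAt_id s).sub_const 1).mul_const (c z)).smul_const e).const_add z
      have := ((hDd (z + ((s - 1) * c z) • e)).hasFDerivAt).comp_hasDerivAt s hp
      rw [map_smul, smul_eq_mul, one_mul] at this
      exact this
    have hint : IntervalIntegrable (fun s : ℝ => c z * fderiv ℝ D (z + ((s - 1) * c z) • e) e)
        volume 0 1 := by
      refine Continuous.intervalIntegrable ?_ _ _
      refine continuous_const.mul (hcont.comp ?_)
      fun_prop
    have h := intervalIntegral.integral_eq_sub_of_hasDerivAt (fun s _ => hder s) hint
    rw [intervalIntegral.integral_const_mul] at h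
    rw [h, hD0 (z + ((0 - 1) * c z) • e) (by simp [hce])]
    simp [hD]

/-- The substitution of square roots for the first block of coordinates. -/
def sqrtFst {ι R : Type*} (z : (ι → ℝ) × R) : (ι → ℝ) × R := (fun i => √(z.1 i), z.2)

/-- If `F` is `C²` and even in each of the coordinates `η i`, then `F`, as a function of the squares
`σ i = (η i)²`, is differentiable up to the boundary of the orthant `σ ≥ 0`. -/
lemma differentiableWithinAt_comp_sqrtFst {ι R : Type*} [Fintype ι] [DecidableEq ι]
    [NormedAddCommGroup R] [NormedSpace ℝ R] {F : (ι → ℝ) × R → ℝ} (hF : ContDiff ℝ 2 F)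
    (heven : ∀ i z, F (z - (2 * z.1 i) • (Pi.single i 1, 0)) = F z)
    (z₀ : (ι → ℝ) × R) :
    DifferentiableWithinAt ℝ (fun z => F (sqrtFst z)) {z | ∀ i, 0 ≤ z.1 i} z₀ := by
  let c : ι → ((ι → ℝ) × R →L[ℝ] ℝ) := fun i =>
    (ContinuousLinearMap.proj (R := ℝ) (φ := fun _ : ι => ℝ) i).comp
      (ContinuousLinearMap.fst ℝ (ι → ℝ) R)
  have hc : ∀ i z, c i z = z.1 i := fun i z => rfl
  choose G hG hGe using fun i => exists_continuous_quotient_of_even hF (Pi.single i 1, 0) (c i)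
    (by simp [hc]) (fun z => by simpa [hc] using heven i z)
  have hsq : Continuous (sqrtFst : (ι → ℝ) × R → (ι → ℝ) × R) := by
    unfold sqrtFst; fun_prop
  let S : Set ((ι → ℝ) × R) := {z | ∀ i, 0 < z.1 i}
  have hS : S = (Set.pi univ fun _ : ι => Ioi (0 : ℝ)) ×ˢ (univ : Set R) := by
    ext z; simp [S]
  have hSo : IsOpen S := by
    rw [hS]; exact (isOpen_set_pi finite_univ fun _ _ => isOpen_Ioi).prod isOpen_univ
  have hSc : Convex ℝ S := by
    rw [hS]; exact (convex_pi fun _ _ => convex_Ioi 0).prod convex_univ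
  have hcl : {z : (ι → ℝ) × R | ∀ i, 0 ≤ z.1 i} ⊆ closure S := by
    rw [hS, closure_prod_eq, closure_pi_set]
    intro z hz
    simp only [closure_Ioi, closure_univ]
    exact ⟨fun i _ => hz i, mem_univ _⟩
  have hFc : Continuous (fderiv ℝ F) := hF.continuous_fderiv (by norm_num)
  let Λ : (ι → ℝ) × R → ((ι → ℝ) × R →L[ℝ] ℝ) := fun z =>
    ∑ i, (G i (sqrtFst z) / 2) • c i + (fderiv ℝ F (sqrtFst z)).comp
      ((ContinuousLinearMap.inr ℝ (ι → ℝ) R).comp (ContinuousLinearMap.snd ℝ (ι → ℝ) R))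
  have hΛc : Continuous Λ := by
    refine Continuous.add ?_ ?_
    · refine continuous_finsetSum _ fun i _ => ?_
      exact (((hG i).comp hsq).div_const 2).smul continuous_const
    · exact (hFc.comp hsq).clm_comp continuous_const
  have hder : ∀ z ∈ S, HasFDerivAt (fun z => F (sqrtFst z)) (Λ z) z := by
    intro z hz
    let L : (ι → ℝ) × R →L[ℝ] (ι → ℝ) × R :=
      (ContinuousLinearMap.pi fun i => (1 / (2 * √(z.1 i))) • c i).prod
        (ContinuousLinearMap.snd ℝ (ι → ℝ) R)
    have hL : HasFDerivAt (sqrtFst : (ι → ℝ) × R → (ι → ℝ) × R) L z := by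
      refine HasFDerivAt.prodMk ?_ hasFDerivAt_snd
      refine hasFDerivAt_pi.2 fun i => ?_
      exact ((c i).hasFDerivAt (x := z)).sqrt (hz i).ne'
    have h1 := ((hF.differentiable (by norm_num)) (sqrtFst z)).hasFDerivAt.comp z hL
    have h2 : (fderiv ℝ F (sqrtFst z)).comp L = Λ z := by
      ext h
      · simp only [Λ, L, ContinuousLinearMap.coe_comp, Function.comp_apply,
          ContinuousLinearMap.inl_apply]
        have e1 : L (h, 0) = ∑ i, (h i / (2 * √(z.1 i))) • ((Pi.single i 1 : ι → ℝ), (0 : R)) := by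
          refine Prod.ext ?_ ?_
          · funext j
            simp [L, hc, Prod.fst_sum, Finset.sum_apply, Pi.single_apply]
            ring
          · simp [L, Prod.snd_sum]
        have e2 : (fderiv ℝ F (sqrtFst z)) (L (h, 0))
            = ∑ i, (G i (sqrtFst z) / 2) * h i := by
          rw [e1, map_sum]
          refine Finset.sum_congr rfl fun i _ => ?_
          rw [map_smul, hGe, hc, smul_eq_mul]
          have h0 : √(z.1 i) ≠ 0 := (Real.sqrt_pos.2 (hz i)).ne'
          simp only [sqrtFst]
          field_simp
        have e3 : (fderiv ℝ F (sqrtFst z)) ((0 : ι → ℝ), (0 : R)) = 0 := map_zero _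
        simpa [L, Λ, hc, e3] using e2
      · simp [Λ, L, hc]
        rfl
    rw [← h2]; exact h1
  have hmain := hasFDerivWithinAt_closure_of_tendsto_fderiv (f := fun z => F (sqrtFst z))
    (s := S) (x := z₀) (f' := Λ z₀)
    (fun z hz => (hder z hz).differentiableAt.differentiableWithinAt) hSc hSo
    (fun z _ => (hF.continuous.comp hsq).continuousWithinAt) (by
      refine (hΛc.tendsto z₀).mono_left nhdsWithin_le_nhds |>.congr' ?_
      filter_upwards [self_mem_nhdsWithin] with z hz
      exact (hder z hz).fderiv.symm)
  exact (hmain.mono hcl).differentiableWithinAt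

end Sqrt

/-! ### Gaussian integration by parts -/

section Stein

lemma ExpWeight.integrable {𝒳 : Type*} [NormedAddCommGroup 𝒳] [NormedSpace ℝ 𝒳]
    [FiniteDimensional ℝ 𝒳] [MeasurableSpace 𝒳] [BorelSpace 𝒳] {ν : Measure 𝒳}
    (hν : ExpMoments ν) {q : 𝒳 → ℝ} (hq : ExpWeight q) : Integrable q ν := by
  obtain ⟨hc, a, ha, h⟩ := hq
  refine ((hν a).const_mul (Real.exp a)).mono' hc.aestronglyMeasurable (ae_of_all _ fun x => ?_)
  refine (h x).trans (le_of_eq ?_)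
  rw [← Real.exp_add]; ring_nf

lemma ExpWeight.comp {𝒳 𝒴 : Type*} [NormedAddCommGroup 𝒳] [NormedAddCommGroup 𝒴]
    {q : 𝒳 → ℝ} (hq : ExpWeight q) {φ : 𝒴 → 𝒳} (hφ : Continuous φ) (b : ℝ)
    (hb : ∀ y, ‖φ y‖ ≤ b + ‖y‖) : ExpWeight (fun y => q (φ y)) := by
  obtain ⟨hc, a, ha, h⟩ := hq
  refine ⟨hc.comp hφ, a * (1 + |b|), by positivity, fun y => (h _).trans (Real.exp_le_exp.2 ?_)⟩
  have h1 := hb y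
  have h2 := le_abs_self b
  nlinarith [mul_nonneg ha (mul_nonneg (abs_nonneg b) (norm_nonneg y)),
    mul_le_mul_of_nonneg_left h1 ha, mul_le_mul_of_nonneg_left h2 ha]

variable {𝒳 𝒴 : Type*} [NormedAddCommGroup 𝒳] [NormedSpace ℝ 𝒳] [MeasurableSpace 𝒳]
  [NormedAddCommGroup 𝒴] [NormedSpace ℝ 𝒴] [MeasurableSpace 𝒴]

/-- Stein's identity: multiplication by the functional `g` integrates to the derivative in the
direction `b`, for integrands of at most exponential growth. -/
def IsStein (ν : Measure 𝒳) (g : 𝒳 →L[ℝ] ℝ) (b : 𝒳) : Prop :=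
  ∀ F F' : 𝒳 → ℝ, ExpWeight F → ExpWeight F' → (∀ x, HasLineDerivAt ℝ F (F' x) x b) →
    ∫ x, g x * F x ∂ν = ∫ x, F' x ∂ν

lemma expMoments_gaussianReal : ExpMoments (gaussianReal 0 1) := by
  intro c
  refine ((integrable_exp_mul_gaussianReal (μ := 0) (v := 1) c).add
    (integrable_exp_mul_gaussianReal (μ := 0) (v := 1) (-c))).mono'
    (by fun_prop) (ae_of_all _ fun x => ?_)
  rw [Real.norm_eq_abs, abs_of_pos (Real.exp_pos _)]
  rcases abs_cases x with h | h
  · simp only [Real.norm_eq_abs, h.1, Pi.add_apply]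
    linarith [Real.exp_pos (-c * x)]
  · simp only [Real.norm_eq_abs, h.1, Pi.add_apply, mul_neg, neg_mul]
    linarith [Real.exp_pos (c * x)]

lemma ExpMoments.prod {μ : Measure 𝒳} {ν : Measure 𝒴} [SFinite μ] [SFinite ν] [BorelSpace 𝒳]
    [BorelSpace 𝒴] [FiniteDimensional ℝ 𝒳] [FiniteDimensional ℝ 𝒴] (hμ : ExpMoments μ)
    (hν : ExpMoments ν) : ExpMoments (μ.prod ν) := by
  intro c
  refine ((hμ |c|).mul_prod (hν |c|)).mono' (by fun_prop) (ae_of_all _ fun z => ?_)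
  rw [Real.norm_eq_abs, abs_of_pos (Real.exp_pos _), ← Real.exp_add]
  refine Real.exp_le_exp.2 ?_
  have h1 : ‖z‖ ≤ ‖z.1‖ + ‖z.2‖ := by
    rw [Prod.norm_def]
    exact max_le (by linarith [norm_nonneg z.2]) (by linarith [norm_nonneg z.1])
  calc c * ‖z‖ ≤ |c| * ‖z‖ := by gcongr; exact le_abs_self c
    _ ≤ |c| * (‖z.1‖ + ‖z.2‖) := by gcongr
    _ = _ := by ring

lemma ExpMoments.pi {d : ℕ} {μ : Measure 𝒳} [SigmaFinite μ] [BorelSpace 𝒳]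
    [FiniteDimensional ℝ 𝒳] (hμ : ExpMoments μ) :
    ExpMoments (Measure.pi fun _ : Fin d => μ) := by
  intro c
  refine (Integrable.fintype_prod (ι := Fin d) (f := fun _ x => Real.exp (|c| * ‖x‖))
    (μ := fun _ => μ) fun _ => hμ |c|).mono' (by fun_prop) (ae_of_all _ fun z => ?_)
  rw [Real.norm_eq_abs, abs_of_pos (Real.exp_pos _), ← Real.exp_sum, ← Finset.mul_sum]
  refine Real.exp_le_exp.2 ?_
  have h1 : ‖z‖ ≤ ∑ i, ‖z i‖ := by
    refine (pi_norm_le_iff_of_nonneg (by positivity)).2 fun i => ?_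
    exact Finset.single_le_sum (f := fun i => ‖z i‖) (fun i _ => norm_nonneg _) (Finset.mem_univ i)
  calc c * ‖z‖ ≤ |c| * ‖z‖ := by gcongr; exact le_abs_self c
    _ ≤ _ := by gcongr

/-- Integration by parts against the density `φ`, with `φ' = -x φ`. -/
lemma isStein_gaussianReal : IsStein (gaussianReal 0 1) (ContinuousLinearMap.id ℝ ℝ) 1 := by
  intro F F' hF hF' hd
  have hder : ∀ x, HasDerivAt F (F' x) x := by
    intro x
    have h1 : HasDerivAt (fun t : ℝ => F (x + t • (1 : ℝ))) (F' x) 0 := hd x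
    have h2 : HasDerivAt (fun t : ℝ => F (x + t • (1 : ℝ))) (F' x) (x - x) := by simpa using h1
    simpa using h2.comp_sub_const x x
  have hpdf : ∀ x, HasDerivAt (gaussianPDFReal 0 1) (-(x * gaussianPDFReal 0 1 x)) x := by
    intro x
    have h1 : HasDerivAt (fun x : ℝ => -(x - 0) ^ 2 / (2 * ((1 : NNReal) : ℝ))) (-x) x := by
      have := ((hasDerivAt_id x).sub_const 0).pow 2 |>.neg |>.div_const (2 * ((1 : NNReal) : ℝ))
      refine this.congr_deriv ?_
      simp
      ring
    have h2 := (h1.exp).const_mul (√(2 * Real.pi * ((1 : NNReal) : ℝ)))⁻¹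
    rw [gaussianPDFReal_def]
    refine h2.congr_deriv ?_
    ring
  have hint : ∀ q : ℝ → ℝ, ExpWeight q → Integrable (fun x => gaussianPDFReal 0 1 x * q x) := by
    intro q hq
    have h1 := hq.integrable expMoments_gaussianReal
    rw [gaussianReal_of_var_ne_zero 0 one_ne_zero,
      integrable_withDensity_iff_integrable_smul' (measurable_gaussianPDF 0 1)
        (ae_of_all _ fun x => gaussianPDF_lt_top)] at h1
    simpa [toReal_gaussianPDF] using h1
  have hxF : ExpWeight fun x : ℝ => x * F x :=
    ExpWeight.mul (expWeight_clm (ContinuousLinearMap.id ℝ ℝ)) hF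
  rw [integral_gaussianReal_eq_integral_smul one_ne_zero,
    integral_gaussianReal_eq_integral_smul one_ne_zero]
  simp only [smul_eq_mul, ContinuousLinearMap.id_apply]
  have h := integral_mul_deriv_eq_deriv_mul_of_integrable (u := F) (v := gaussianPDFReal 0 1)
    (u' := F') (v' := fun x => -(x * gaussianPDFReal 0 1 x)) (fun x _ => hder x)
    (fun x _ => hpdf x)
    (((hint _ hxF).neg).congr (ae_of_all _ fun x => by simp; ring))
    ((hint _ hF').congr (ae_of_all _ fun x => by simp; ring))
    ((hint _ hF).congr (ae_of_all _ fun x => by simp; ring))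
  have e1 : ∫ x, F x * -(x * gaussianPDFReal 0 1 x)
      = -∫ x, gaussianPDFReal 0 1 x * (x * F x) := by
    rw [← integral_neg]; congr 1; funext x; ring
  have e2 : ∫ x, F' x * gaussianPDFReal 0 1 x = ∫ x, gaussianPDFReal 0 1 x * F' x := by
    congr 1; funext x; ring
  rw [e1, e2] at h
  exact neg_injective h

variable [BorelSpace 𝒳] [BorelSpace 𝒴] [FiniteDimensional ℝ 𝒳] [FiniteDimensional ℝ 𝒴]

lemma IsStein.prod_fst {μ : Measure 𝒳} {ν : Measure 𝒴} [SFinite μ] [SFinite ν]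
    (hμ : ExpMoments μ) (hν : ExpMoments ν) {g : 𝒳 →L[ℝ] ℝ} {b : 𝒳} (h : IsStein μ g b) :
    IsStein (μ.prod ν) (g.comp (ContinuousLinearMap.fst ℝ 𝒳 𝒴)) (b, 0) := by
  intro F F' hF hF' hd
  have hm := hμ.prod hν
  have hgF : ExpWeight fun z : 𝒳 × 𝒴 => (g.comp (ContinuousLinearMap.fst ℝ 𝒳 𝒴)) z * F z :=
    (expWeight_clm _).mul hF
  rw [integral_prod_symm _ (hgF.integrable hm), integral_prod_symm _ (hF'.integrable hm)]
  refine integral_congr_ae (ae_of_all _ fun y => ?_)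
  have hb : ∀ x : 𝒳, ‖(x, y)‖ ≤ ‖y‖ + ‖x‖ := fun x => by
    rw [Prod.norm_def]
    exact max_le (by simp) (by simp)
  refine h (fun x => F (x, y)) (fun x => F' (x, y)) (hF.comp (by fun_prop) _ hb)
    (hF'.comp (by fun_prop) _ hb) fun x => ?_
  have := hd (x, y)
  simpa [HasLineDerivAt] using this

lemma IsStein.prod_snd {μ : Measure 𝒳} {ν : Measure 𝒴} [SFinite μ] [SFinite ν]
    (hμ : ExpMoments μ) (hν : ExpMoments ν) {g : 𝒴 →L[ℝ] ℝ} {b : 𝒴} (h : IsStein ν g b) :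
    IsStein (μ.prod ν) (g.comp (ContinuousLinearMap.snd ℝ 𝒳 𝒴)) (0, b) := by
  intro F F' hF hF' hd
  have hm := hμ.prod hν
  have hgF : ExpWeight fun z : 𝒳 × 𝒴 => (g.comp (ContinuousLinearMap.snd ℝ 𝒳 𝒴)) z * F z :=
    (expWeight_clm _).mul hF
  rw [integral_prod _ (hgF.integrable hm), integral_prod _ (hF'.integrable hm)]
  refine integral_congr_ae (ae_of_all _ fun x => ?_)
  have hb : ∀ y : 𝒴, ‖(x, y)‖ ≤ ‖x‖ + ‖y‖ := fun y => by
    rw [Prod.norm_def]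
    exact max_le (by simp) (by simp)
  refine h (fun y => F (x, y)) (fun y => F' (x, y)) (hF.comp (by fun_prop) _ hb)
    (hF'.comp (by fun_prop) _ hb) fun y => ?_
  have := hd (x, y)
  simpa [HasLineDerivAt] using this

lemma IsStein.pi {d : ℕ} {μ : Measure 𝒳} [SigmaFinite μ] (hμ : ExpMoments μ) {g : 𝒳 →L[ℝ] ℝ}
    {b : 𝒳} (h : IsStein μ g b) (i : Fin d) :
    IsStein (Measure.pi fun _ : Fin d => μ)
      (g.comp (ContinuousLinearMap.proj (R := ℝ) (φ := fun _ : Fin d => 𝒳) i)) (Pi.single i b) := by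
  obtain _ | d := d
  · exact i.elim0
  intro F F' hF hF' hd
  have hmp := (measurePreserving_piFinSuccAbove (fun _ : Fin (d + 1) => μ) i).symm
  have hcont : Continuous fun z : 𝒳 × (Fin d → 𝒳) =>
      (i.insertNth z.1 z.2 : Fin (d + 1) → 𝒳) :=
    continuous_pi (i.forall_iff_succAbove.2 ⟨by simpa using continuous_fst, fun j => by
      simpa [Function.comp_def] using (continuous_apply j).comp continuous_snd⟩)
  have hb : ∀ z : 𝒳 × (Fin d → 𝒳), ‖(i.insertNth z.1 z.2 : Fin (d + 1) → 𝒳)‖ ≤ 0 + ‖z‖ := by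
    intro z
    rw [zero_add]
    refine (pi_norm_le_iff_of_nonneg (norm_nonneg _)).2 ?_
    refine i.forall_iff_succAbove.2 ⟨?_, fun j => ?_⟩
    · simpa using norm_fst_le z
    · simpa using (norm_le_pi_norm z.2 j).trans (norm_snd_le z)
  have key := h.prod_fst hμ (hμ.pi (d := d)) (fun z => F (i.insertNth z.1 z.2))
    (fun z => F' (i.insertNth z.1 z.2)) (hF.comp hcont 0 hb) (hF'.comp hcont 0 hb) (by
      intro z
      have h1 := hd (i.insertNth z.1 z.2)
      unfold HasLineDerivAt at h1 ⊢
      convert h1 using 3 with t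
      refine funext (i.forall_iff_succAbove.2 ⟨?_, fun j => ?_⟩)
      · simp
      · simp)
  have he : ∀ z : 𝒳 × (Fin d → 𝒳),
      (MeasurableEquiv.piFinSuccAbove (fun _ : Fin (d + 1) => 𝒳) i).symm z = i.insertNth z.1 z.2 :=
    fun z => rfl
  rw [← hmp.integral_comp', ← hmp.integral_comp']
  simpa [he] using key

end Stein

/-! ### Symmetry of the Gaussian noises -/

section Flip

instance : (gaussianReal 0 1).IsNegInvariant := by
  constructor
  rw [Measure.neg_def]
  simpa using gaussianReal_map_neg (μ := 0) (v := 1)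

lemma integral_flip_scalar {d n : ℕ} (f : Noise d n → ℝ) :
    ∫ u, f (-u.1, u.2.1, u.2.2) ∂(noiseLaw d n) = ∫ u, f u ∂(noiseLaw d n) := by
  have h : MeasurePreserving (fun u : Noise d n => (-u.1, u.2))
      (noiseLaw d n) (noiseLaw d n) :=
    (Measure.measurePreserving_neg (gaussianReal 0 1)).prod (MeasurePreserving.id _)
  exact h.integral_comp ((MeasurableEquiv.neg ℝ).prodCongr
    (MeasurableEquiv.refl _)).measurableEmbedding f

lemma integral_flip_left {d n : ℕ} (f : Noise d n → ℝ) :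
    ∫ u, f (u.1, -u.2.1, u.2.2) ∂(noiseLaw d n) = ∫ u, f u ∂(noiseLaw d n) := by
  have h : MeasurePreserving (fun u : Noise d n => (u.1, -u.2.1, u.2.2))
      (noiseLaw d n) (noiseLaw d n) :=
    (MeasurePreserving.id _).prod ((Measure.measurePreserving_neg _).prod (MeasurePreserving.id _))
  exact h.integral_comp ((MeasurableEquiv.refl ℝ).prodCongr
    ((MeasurableEquiv.neg _).prodCongr (MeasurableEquiv.refl _))).measurableEmbedding f

lemma integral_flip_right {d n : ℕ} (f : Noise d n → ℝ) :
    ∫ u, f (u.1, u.2.1, -u.2.2) ∂(noiseLaw d n) = ∫ u, f u ∂(noiseLaw d n) := by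
  have h : MeasurePreserving (fun u : Noise d n => (u.1, u.2.1, -u.2.2))
      (noiseLaw d n) (noiseLaw d n) :=
    (MeasurePreserving.id _).prod ((MeasurePreserving.id _).prod (Measure.measurePreserving_neg _))
  exact h.integral_comp ((MeasurableEquiv.refl ℝ).prodCongr
    ((MeasurableEquiv.refl _).prodCongr (MeasurableEquiv.neg _))).measurableEmbedding f

lemma integral_flip_matrix {d n : ℕ} (f : (Fin d → Fin n → ℝ) → ℝ) :
    ∫ G, f (-G) ∂(matrixLaw d n) = ∫ G, f G ∂(matrixLaw d n) := by
  have : (matrixLaw d n).IsNegInvariant := by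
    have h := Measure.pi.isNegInvariant (fun _ : Fin d => Measure.pi fun _ : Fin n => gaussianReal 0 1)
    exact h
  have h : MeasurePreserving (fun G : Fin d → Fin n → ℝ => -G) (matrixLaw d n) (matrixLaw d n) :=
    Measure.measurePreserving_neg _
  exact h.integral_comp (MeasurableEquiv.neg _).measurableEmbedding f

end Flip

/-! ### Second-order operators along a path of covariances -/

section Diffusion

variable {Θ E : Type*} [NormedAddCommGroup Θ] [NormedSpace ℝ Θ] [Fintype E] [DecidableEq E]

/-- The partial derivative in the field coordinate `e`. -/
def dE (e : E) (f : Θ × (E → ℝ) → ℝ) : Θ × (E → ℝ) → ℝ := dirD (0, Pi.single e 1) f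

/-- The operator `∂_τ + ½ ∑ R(e,e') ∂_e ∂_{e'}`, where `∂_τ` is the derivative in the parameter
direction `τ`. -/
def diffusion (τ : Θ) (R : E → E → ℝ) (f : Θ × (E → ℝ) → ℝ) (w : Θ × (E → ℝ)) : ℝ :=
  dirD (τ, 0) f w + 1 / 2 * ∑ e, ∑ e', R e e' * dE e (dE e' f) w

/-- The bilinear form `½ ∑ R(e,e') (∂_e f ∂_{e'} g + ∂_{e'} f ∂_e g)` measuring the failure of the
Leibniz rule for `diffusion`. -/
def carre (R : E → E → ℝ) (f g : Θ × (E → ℝ) → ℝ) (w : Θ × (E → ℝ)) : ℝ :=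
  1 / 2 * ∑ e, ∑ e', R e e' * (dE e f w * dE e' g w + dE e' f w * dE e g w)

lemma carre_self (R : E → E → ℝ) (f : Θ × (E → ℝ) → ℝ) (w : Θ × (E → ℝ)) :
    carre R f f w = ∑ e, ∑ e', R e e' * (dE e f w * dE e' f w) := by
  rw [carre, Finset.mul_sum]
  refine Finset.sum_congr rfl fun e _ => ?_
  rw [Finset.mul_sum]
  exact Finset.sum_congr rfl fun e' _ => by ring

lemma Tame.dE {f : Θ × (E → ℝ) → ℝ} (hf : Tame f) (e : E) : Tame (dE e f) := hf.dirD _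

lemma Tame.diffusion {f : Θ × (E → ℝ) → ℝ} (hf : Tame f) (τ : Θ) (R : E → E → ℝ) :
    Tame (diffusion τ R f) :=
  (hf.dirD _).add ((Tame.sum fun e _ => Tame.sum fun e' _ =>
    ((hf.dE e').dE e).const_mul _).const_mul _)

lemma Tame.carre {f g : Θ × (E → ℝ) → ℝ} (hf : Tame f) (hg : Tame g) (R : E → E → ℝ) :
    Tame (carre R f g) :=
  (Tame.sum fun e _ => Tame.sum fun e' _ =>
    (((hf.dE e).mul (hg.dE e')).add ((hf.dE e').mul (hg.dE e))).const_mul _).const_mul _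

lemma dE_mul {f g : Θ × (E → ℝ) → ℝ} (hf : Tame f) (hg : Tame g) (e : E) :
    dE e (fun w => f w * g w) = fun w => f w * dE e g w + g w * dE e f w :=
  dirD_mul hf.differentiable hg.differentiable _

lemma dE_add {f g : Θ × (E → ℝ) → ℝ} (hf : Tame f) (hg : Tame g) (e : E) :
    dE e (fun w => f w + g w) = fun w => dE e f w + dE e g w :=
  dirD_add hf.differentiable hg.differentiable _

lemma dE_exp {f : Θ × (E → ℝ) → ℝ} (hf : Tame f) (e : E) :
    dE e (fun w => Real.exp (f w)) = fun w => Real.exp (f w) * dE e f w :=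
  dirD_exp hf.differentiable _

lemma diffusion_mul {f g : Θ × (E → ℝ) → ℝ} (hf : Tame f) (hg : Tame g) (τ : Θ)
    (R : E → E → ℝ) (w : Θ × (E → ℝ)) :
    diffusion τ R (fun w => f w * g w) w
      = f w * diffusion τ R g w + g w * diffusion τ R f w + carre R f g w := by
  have h2 : ∀ e e', dE e (dE e' (fun w => f w * g w)) w
      = f w * dE e (dE e' g) w + g w * dE e (dE e' f) w
        + (dE e f w * dE e' g w + dE e' f w * dE e g w) := by
    intro e e'
    rw [dE_mul hf hg, dE_add (hf.mul (hg.dE e')) (hg.mul (hf.dE e')), dE_mul hf (hg.dE e'),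
      dE_mul hg (hf.dE e')]
    ring
  simp only [diffusion, carre, h2, mul_add, Finset.sum_add_distrib, Finset.mul_sum]
  rw [dirD_mul hf.differentiable hg.differentiable]
  have e1 : ∀ e e', f w * (1 / 2 * (R e e' * dE e (dE e' g) w))
      = 1 / 2 * (R e e' * (f w * dE e (dE e' g) w)) := fun _ _ => by ring
  have e2 : ∀ e e', g w * (1 / 2 * (R e e' * dE e (dE e' f) w))
      = 1 / 2 * (R e e' * (g w * dE e (dE e' f) w)) := fun _ _ => by ring
  simp only [e1, e2]
  ring

lemma diffusion_exp {f : Θ × (E → ℝ) → ℝ} (hf : Tame f) (hl : LocLin f) (τ : Θ)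
    (R : E → E → ℝ) (w : Θ × (E → ℝ)) :
    diffusion τ R (fun w => Real.exp (f w)) w
      = Real.exp (f w) * (diffusion τ R f w + 1 / 2 * carre R f f w) := by
  have h2 : ∀ e e', dE e (dE e' (fun w => Real.exp (f w))) w
      = Real.exp (f w) * dE e (dE e' f) w + Real.exp (f w) * (dE e f w * dE e' f w) := by
    intro e e'
    rw [dE_exp hf, dE_mul (hf.exp hl) (hf.dE e'), dE_exp hf]
    ring
  rw [carre_self]
  simp only [diffusion, h2, mul_add, Finset.sum_add_distrib, Finset.mul_sum]
  rw [dirD_exp hf.differentiable]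
  have e1 : ∀ e e', Real.exp (f w) * (1 / 2 * (R e e' * dE e (dE e' f) w))
      = 1 / 2 * (R e e' * (Real.exp (f w) * dE e (dE e' f) w)) := fun _ _ => by ring
  have e2 : ∀ e e', Real.exp (f w) * (1 / 2 * (R e e' * (dE e f w * dE e' f w)))
      = 1 / 2 * (R e e' * (Real.exp (f w) * (dE e f w * dE e' f w))) := fun _ _ => by ring
  simp only [e1, e2]
  ring

lemma carre_exp_left {f g : Θ × (E → ℝ) → ℝ} (hf : Tame f) (R : E → E → ℝ)
    (w : Θ × (E → ℝ)) :
    carre R (fun w => Real.exp (f w)) g w = Real.exp (f w) * carre R f g w := by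
  simp only [carre, dE_exp hf, Finset.mul_sum]
  refine Finset.sum_congr rfl fun e _ => Finset.sum_congr rfl fun e' _ => by ring

end Diffusion

/-! ### Averages over Gaussian fields and the heat equation -/

section Heat

variable {Θ E 𝒳 ι : Type*} [NormedAddCommGroup Θ] [NormedSpace ℝ Θ] [Fintype E] [DecidableEq E]
  [NormedAddCommGroup 𝒳] [NormedSpace ℝ 𝒳] [MeasurableSpace 𝒳] [Fintype ι] [DecidableEq ι]

/-- The random field `∑_κ η_κ(θ) ξ_κ`, whose components `ξ_κ` are scaled by standard deviations
`η_κ` that are linear coordinates of the parameter `θ`. -/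
def fieldMap (η : ι → Θ →L[ℝ] ℝ) (ξ : ι → 𝒳 →L[ℝ] (E → ℝ)) : Θ →L[ℝ] 𝒳 →L[ℝ] (E → ℝ) :=
  ∑ κ, (η κ).smulRight (ξ κ)

lemma fieldMap_apply (η : ι → Θ →L[ℝ] ℝ) (ξ : ι → 𝒳 →L[ℝ] (E → ℝ)) (θ : Θ) (x : 𝒳) :
    fieldMap η ξ θ x = ∑ κ, η κ θ • ξ κ x := by
  simp [fieldMap]

/-- The fields `ξ_κ` are independent centred Gaussian fields with covariances `K κ`, expressed by
coordinates: `ξ_κ` is a combination of noise coordinates satisfying Stein's identity, on whose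
directions the other fields vanish. -/
def IsGaussianField (ν : Measure 𝒳) (ξ : ι → 𝒳 →L[ℝ] (E → ℝ)) (K : ι → E → E → ℝ) : Prop :=
  ∀ κ, ∃ (J : Type) (_ : Fintype J) (g : J → 𝒳 →L[ℝ] ℝ) (b : J → 𝒳),
    (∀ j, IsStein ν (g j) (b j)) ∧ (∀ x, ξ κ x = ∑ j, g j x • ξ κ (b j)) ∧
    (∀ j, ∀ κ', κ' ≠ κ → ξ κ' (b j) = 0) ∧
    ∀ e e', K κ e e' = ∑ j, ξ κ (b j) e * ξ κ (b j) e'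

lemma IsGaussianField.symm {ν : Measure 𝒳} {ξ : ι → 𝒳 →L[ℝ] (E → ℝ)} {K : ι → E → E → ℝ}
    (h : IsGaussianField ν ξ K) (κ : ι) (e e' : E) : K κ e e' = K κ e' e := by
  obtain ⟨J, _, g, b, -, -, -, hK⟩ := h κ
  rw [hK, hK]
  exact Finset.sum_congr rfl fun j _ => mul_comm _ _

lemma Tame.expWeight_shift {f : Θ × (E → ℝ) → ℝ} (hf : Tame f)
    (B : Θ →L[ℝ] 𝒳 →L[ℝ] (E → ℝ)) (w : Θ × (E → ℝ)) : ExpWeight (fun x => f (shift B x w)) := by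
  refine ⟨hf.continuous.comp (continuous_shift_noise B w), ?_⟩
  obtain ⟨c, c', hc, hc', h⟩ := hf.locExp.shift_bound B ‖w.1‖ (norm_nonneg _)
  refine ⟨c * (1 + ‖w.2‖) + c', by positivity, fun x => (h w le_rfl x).trans ?_⟩
  rw [← Real.exp_add]
  refine Real.exp_le_exp.2 ?_
  have h1 : 0 ≤ c * (1 + ‖w.2‖) * ‖x‖ := by positivity
  nlinarith

variable [BorelSpace 𝒳] [FiniteDimensional ℝ 𝒳] [FiniteDimensional ℝ Θ]
  {ν : Measure 𝒳} {η : ι → Θ →L[ℝ] ℝ} {ξ : ι → 𝒳 →L[ℝ] (E → ℝ)} {K : ι → E → E → ℝ}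

/-- Gaussian integration by parts for the component `ξ_κ` of the field. -/
lemma IsGaussianField.integral_mul (hν : ExpMoments ν) (hξ : IsGaussianField ν ξ K)
    {f : Θ × (E → ℝ) → ℝ} (hf : Tame f) (w : Θ × (E → ℝ)) (κ : ι) (e : E) :
    ∫ x, ξ κ x e * f (shift (fieldMap η ξ) x w) ∂ν
      = η κ w.1 * ∑ e', K κ e e' * gavg ν (fieldMap η ξ) (dE e' f) w := by
  obtain ⟨J, _, g, b, hS, hx, h0, hK⟩ := hξ κ
  have hF := hf.expWeight_shift (fieldMap η ξ) w
  have hBb : ∀ j, fieldMap η ξ w.1 (b j) = η κ w.1 • ξ κ (b j) := by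
    intro j
    rw [fieldMap_apply]
    refine Finset.sum_eq_single κ (fun κ' _ hκ => by rw [h0 j κ' hκ, smul_zero]) (by simp)
  have hint : ∀ j, Integrable (fun x => g j x * f (shift (fieldMap η ξ) x w)) ν := fun j =>
    ((expWeight_clm (g j)).mul hF).integrable hν
  have hst : ∀ j, ∫ x, g j x * f (shift (fieldMap η ξ) x w) ∂ν
      = η κ w.1 * ∑ e', ξ κ (b j) e' * gavg ν (fieldMap η ξ) (dE e' f) w := by
    intro j
    have hexp : ∀ x, ∑ e', (η κ w.1 * ξ κ (b j) e') * dE e' f (shift (fieldMap η ξ) x w)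
        = fderiv ℝ f (shift (fieldMap η ξ) x w) (0, fieldMap η ξ w.1 (b j)) := by
      intro x
      have : ((0 : Θ), fieldMap η ξ w.1 (b j))
          = ∑ e', (η κ w.1 * ξ κ (b j) e') • ((0 : Θ), (Pi.single e' 1 : E → ℝ)) := by
        refine Prod.ext (by simp [Prod.fst_sum]) ?_
        rw [hBb]
        funext e''
        simp [Prod.snd_sum, Finset.sum_apply, Pi.single_apply]
      rw [this, map_sum]
      exact Finset.sum_congr rfl fun e' _ => by rw [map_smul]; rfl
    have hT : Tame (fun w' => ∑ e', (η κ w.1 * ξ κ (b j) e') * dE e' f w') :=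
      Tame.sum fun e' _ => (hf.dE e').const_mul _
    have h1 := hS j (fun x => f (shift (fieldMap η ξ) x w))
      (fun x => ∑ e', (η κ w.1 * ξ κ (b j) e') * dE e' f (shift (fieldMap η ξ) x w)) hF
      (hT.expWeight_shift (fieldMap η ξ) w) (by
        intro x
        rw [hexp]
        have h2 := (hf.differentiable (shift (fieldMap η ξ) x w)).hasFDerivAt.hasLineDerivAt
          (0, fieldMap η ξ w.1 (b j))
        unfold HasLineDerivAt at h2 ⊢
        convert h2 using 3 with t
        refine Prod.ext (by simp [shift]) ?_
        simp [shift, add_assoc])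
    rw [h1, integral_finsetSum _ fun e' _ => ((hf.dE e').integrable_shift hν w).const_mul _,
      Finset.mul_sum]
    refine Finset.sum_congr rfl fun e' _ => ?_
    rw [integral_const_mul, gavg]; ring
  have e1 : ∀ x, ξ κ x e * f (shift (fieldMap η ξ) x w)
      = ∑ j, ξ κ (b j) e * (g j x * f (shift (fieldMap η ξ) x w)) := by
    intro x
    rw [hx x, Finset.sum_apply, Finset.sum_mul]
    exact Finset.sum_congr rfl fun j _ => by simp; ring
  simp only [e1]
  rw [integral_finsetSum _ fun j _ => (hint j).const_mul _]
  simp only [integral_const_mul, hst, hK, Finset.sum_mul, Finset.mul_sum]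
  rw [Finset.sum_comm]
  exact Finset.sum_congr rfl fun e' _ => Finset.sum_congr rfl fun j _ => by ring

lemma dE_gavg (hν : ExpMoments ν) {B : Θ →L[ℝ] 𝒳 →L[ℝ] (E → ℝ)} {f : Θ × (E → ℝ) → ℝ}
    (hf : Tame f) (e : E) : dE e (gavg ν B f) = gavg ν B (dE e f) :=
  dirD_gavg_field hν hf _

/-- The heat equation. When the parameter `w.1` moves in the direction `τ`, the variance of `ξ_κ`
moves with speed `2 η_κ(τ) η_κ(w.1)`; the operator `diffusion` is carried through the average if its
matrix is increased by the corresponding speed of the covariance. -/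
lemma diffusion_gavg (hν : ExpMoments ν) (hξ : IsGaussianField ν ξ K)
    {f : Θ × (E → ℝ) → ℝ} (hf : Tame f) (τ : Θ) {R R' : E → E → ℝ} (w : Θ × (E → ℝ))
    (hR : ∀ e e', R' e e' = R e e' + ∑ κ, 2 * (η κ τ * η κ w.1) * K κ e e') :
    diffusion τ R (gavg ν (fieldMap η ξ) f) w
      = gavg ν (fieldMap η ξ) (diffusion τ R' f) w := by
  have hI : ∀ {g : Θ × (E → ℝ) → ℝ}, Tame g →
      Integrable (fun x => g (shift (fieldMap η ξ) x w)) ν := fun hg => hg.integrable_shift hν w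
  have h1 : dirD (τ, 0) (gavg ν (fieldMap η ξ) f) w
      = gavg ν (fieldMap η ξ) (dirD (τ, 0) f) w
        + ∑ e, ∑ e', (∑ κ, η κ τ * η κ w.1 * K κ e e')
          * gavg ν (fieldMap η ξ) (dE e (dE e' f)) w := by
    rw [gavg_eq_wavg, (wavg_hasFDerivAt hν (expWeight_const 1) (hf 1) w).2, ← gavg_eq_wavg]
    congr 1
    rw [Finset.sum_comm]
    refine Finset.sum_congr rfl fun e _ => ?_
    have e1 : ∀ x, 1 * fieldMap η ξ τ x e * dirD (0, Pi.single e 1) f (shift (fieldMap η ξ) x w)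
        = ∑ κ, η κ τ * (ξ κ x e * dE e f (shift (fieldMap η ξ) x w)) := by
      intro x
      rw [fieldMap_apply, Finset.sum_apply, one_mul, Finset.sum_mul]
      exact Finset.sum_congr rfl fun κ _ => by simp [dE]; ring
    simp only [wavg, e1]
    rw [integral_finsetSum]
    · simp only [integral_const_mul]
      simp only [hξ.integral_mul hν (hf.dE e), Finset.mul_sum, Finset.sum_mul]
      rw [Finset.sum_comm]
      refine Finset.sum_congr rfl fun e' _ => Finset.sum_congr rfl fun κ _ => ?_
      rw [hξ.symm κ e e']; ring
    · intro κ _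
      refine Integrable.const_mul ?_ _
      exact ((expWeight_clm ((ContinuousLinearMap.proj (R := ℝ) (φ := fun _ : E => ℝ) e).comp
        (ξ κ))).mul ((hf.dE e).expWeight_shift (fieldMap η ξ) w)).integrable hν
  have h2 : gavg ν (fieldMap η ξ) (diffusion τ R' f) w
      = gavg ν (fieldMap η ξ) (dirD (τ, 0) f) w
        + 1 / 2 * ∑ e, ∑ e', R' e e' * gavg ν (fieldMap η ξ) (dE e (dE e' f)) w := by
    have hsum : Tame (fun w => ∑ e, ∑ e', R' e e' * dE e (dE e' f) w) :=
      Tame.sum fun e _ => Tame.sum fun e' _ => ((hf.dE e').dE e).const_mul _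
    simp only [gavg, diffusion]
    rw [integral_add (hI (hf.dirD _)) ((hI hsum).const_mul _), integral_const_mul,
      integral_finsetSum _ fun e _ => hI (Tame.sum fun e' _ => ((hf.dE e').dE e).const_mul _)]
    congr 2
    refine Finset.sum_congr rfl fun e _ => ?_
    rw [integral_finsetSum _ fun e' _ => hI (((hf.dE e').dE e).const_mul _)]
    exact Finset.sum_congr rfl fun e' _ => integral_const_mul _ _
  rw [h2, diffusion, h1, add_assoc]
  congr 1
  simp only [dE_gavg hν hf, dE_gavg hν (hf.dE _), Finset.mul_sum, ← Finset.sum_add_distrib]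
  refine Finset.sum_congr rfl fun e _ => Finset.sum_congr rfl fun e' _ => ?_
  rw [hR]
  simp only [mul_assoc, ← Finset.mul_sum]
  ring

end Heat

/-! ### Log-averages and tilted averages -/

section Tilt

variable {Θ E 𝒳 : Type*} [NormedAddCommGroup Θ] [NormedSpace ℝ Θ] [Fintype E] [DecidableEq E]
  [NormedAddCommGroup 𝒳] [NormedSpace ℝ 𝒳] [MeasurableSpace 𝒳]

/-- The log-average `log E exp U` over a random shift of the field. -/
def logAvg (ν : Measure 𝒳) (B : Θ →L[ℝ] 𝒳 →L[ℝ] (E → ℝ)) (U : Θ × (E → ℝ) → ℝ)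
    (w : Θ × (E → ℝ)) : ℝ := Real.log (gavg ν B (fun w => Real.exp (U w)) w)

/-- The average `E (exp U · f) / E exp U` under the tilted law. -/
def tilt (ν : Measure 𝒳) (B : Θ →L[ℝ] 𝒳 →L[ℝ] (E → ℝ)) (U f : Θ × (E → ℝ) → ℝ)
    (w : Θ × (E → ℝ)) : ℝ :=
  gavg ν B (fun w => Real.exp (U w) * f w) w / gavg ν B (fun w => Real.exp (U w)) w

variable [BorelSpace 𝒳] [FiniteDimensional ℝ 𝒳] [FiniteDimensional ℝ Θ]
  {ν : Measure 𝒳} [IsProbabilityMeasure ν] {B : Θ →L[ℝ] 𝒳 →L[ℝ] (E → ℝ)}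
  {U f g : Θ × (E → ℝ) → ℝ}

lemma gavg_exp_pos (hν : ExpMoments ν) (hU : Tame U) (hl : LocLin U) (w : Θ × (E → ℝ)) :
    0 < gavg ν B (fun w => Real.exp (U w)) w := (hl.log_gavg_exp hν hU.continuous).1 w

lemma exp_logAvg (hν : ExpMoments ν) (hU : Tame U) (hl : LocLin U) (w : Θ × (E → ℝ)) :
    Real.exp (logAvg ν B U w) = gavg ν B (fun w => Real.exp (U w)) w :=
  Real.exp_log (gavg_exp_pos hν hU hl w)

lemma locLin_logAvg (hν : ExpMoments ν) (hU : Tame U) (hl : LocLin U) :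
    LocLin (logAvg ν B U) := (hl.log_gavg_exp hν hU.continuous).2

lemma tame_logAvg (hν : ExpMoments ν) (hU : Tame U) (hl : LocLin U) : Tame (logAvg ν B U) :=
  Tame.log (gavg_exp_pos hν hU hl) (locLin_logAvg hν hU hl) ((hU.exp hl).gavg hν)

lemma tilt_eq (hν : ExpMoments ν) (hU : Tame U) (hl : LocLin U) :
    tilt ν B U f = fun w => Real.exp (-logAvg ν B U w)
      * gavg ν B (fun w => Real.exp (U w) * f w) w := by
  funext w
  rw [Real.exp_neg, exp_logAvg hν hU hl, tilt, div_eq_inv_mul]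

lemma exp_logAvg_mul_tilt (hν : ExpMoments ν) (hU : Tame U) (hl : LocLin U)
    (w : Θ × (E → ℝ)) : Real.exp (logAvg ν B U w) * tilt ν B U f w
      = gavg ν B (fun w => Real.exp (U w) * f w) w := by
  rw [exp_logAvg hν hU hl, tilt, mul_div_cancel₀ _ (gavg_exp_pos hν hU hl w).ne']

lemma Tame.tilt (hν : ExpMoments ν) (hU : Tame U) (hl : LocLin U) (hf : Tame f) :
    Tame (tilt ν B U f) := by
  rw [tilt_eq hν hU hl]
  exact ((tame_logAvg hν hU hl).neg.exp (locLin_logAvg hν hU hl).neg).mul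
    (((hU.exp hl).mul hf).gavg hν)

lemma tilt_const (hν : ExpMoments ν) (hU : Tame U) (hl : LocLin U) (c : ℝ)
    (w : Θ × (E → ℝ)) : tilt ν B U (fun _ => c) w = c := by
  rw [tilt]
  have : gavg ν B (fun w => Real.exp (U w) * c) w
      = gavg ν B (fun w => Real.exp (U w)) w * c := integral_mul_const _ _
  rw [this, mul_comm, mul_div_cancel_right₀ _ (gavg_exp_pos hν hU hl w).ne']

lemma tilt_const_mul (c : ℝ) (w : Θ × (E → ℝ)) :
    tilt ν B U (fun w => c * f w) w = c * tilt ν B U f w := by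
  rw [tilt, tilt, ← mul_div_assoc]
  congr 1
  simp only [gavg]
  rw [← integral_const_mul]
  congr 1; funext x; ring

lemma tilt_sum (hν : ExpMoments ν) (hU : Tame U) (hl : LocLin U) {α : Type*} (s : Finset α)
    {f : α → Θ × (E → ℝ) → ℝ} (hf : ∀ a ∈ s, Tame (f a)) (w : Θ × (E → ℝ)) :
    tilt ν B U (fun w => ∑ a ∈ s, f a w) w = ∑ a ∈ s, tilt ν B U (f a) w := by
  simp only [tilt, ← Finset.sum_div, gavg, Finset.mul_sum]
  rw [integral_finsetSum _ fun a ha => ((hU.exp hl).mul (hf a ha)).integrable_shift hν w]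

lemma tilt_mono (hν : ExpMoments ν) (hU : Tame U) (hl : LocLin U) (hf : Tame f) (hg : Tame g)
    (w : Θ × (E → ℝ)) (h : ∀ v, f (w.1, v) ≤ g (w.1, v)) :
    tilt ν B U f w ≤ tilt ν B U g w := by
  refine div_le_div_of_nonneg_right ?_ (gavg_exp_pos hν hU hl w).le
  refine integral_mono (((hU.exp hl).mul hf).integrable_shift hν w)
    (((hU.exp hl).mul hg).integrable_shift hν w) fun x => ?_
  exact mul_le_mul_of_nonneg_left (h _) (Real.exp_pos _).le

lemma abs_tilt_le (hν : ExpMoments ν) (hU : Tame U) (hl : LocLin U) (hf : Tame f) {c : ℝ}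
    (w : Θ × (E → ℝ)) (h : ∀ v, |f (w.1, v)| ≤ c) : |tilt ν B U f w| ≤ c := by
  rw [abs_le]
  constructor
  · rw [← tilt_const hν hU hl (-c) w]
    exact tilt_mono hν hU hl (tame_const _) hf w fun v => (abs_le.1 (h v)).1
  · rw [← tilt_const hν hU hl c w]
    exact tilt_mono hν hU hl hf (tame_const _) w fun v => (abs_le.1 (h v)).2

/-- Tilted averages do not increase the `ℓ¹`-norm of a family of functions. -/
lemma sum_abs_tilt_le (hν : ExpMoments ν) (hU : Tame U) (hl : LocLin U) {α : Type*} [Fintype α]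
    {f : α → Θ × (E → ℝ) → ℝ} (hf : ∀ a, Tame (f a)) {c : ℝ} (w : Θ × (E → ℝ))
    (h : ∀ v, ∑ a, |f a (w.1, v)| ≤ c) : ∑ a, |tilt ν B U (f a) w| ≤ c := by
  -- test against the signs of the averages
  have h1 : ∑ a, |tilt ν B U (f a) w|
      = tilt ν B U (fun w' => ∑ a, (SignType.sign (tilt ν B U (f a) w) : ℝ) * f a w') w := by
    rw [tilt_sum hν hU hl _ fun a _ => (hf a).const_mul _]
    refine Finset.sum_congr rfl fun a _ => ?_
    rw [tilt_const_mul, sign_mul_self]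
  rw [h1]
  refine (le_abs_self _).trans (abs_tilt_le hν hU hl
    (Tame.sum fun a _ => (hf a).const_mul _) w fun v => ?_)
  refine (Finset.abs_sum_le_sum_abs _ _).trans ((Finset.sum_le_sum fun a _ => ?_).trans (h v))
  rw [abs_mul]
  refine mul_le_of_le_one_left (abs_nonneg _) ?_
  rcases SignType.sign (tilt ν B U (f a) w) <;> simp

lemma dE_logAvg (hν : ExpMoments ν) (hU : Tame U) (hl : LocLin U) (e : E) (w : Θ × (E → ℝ)) :
    dE e (logAvg ν B U) w = tilt ν B U (dE e U) w := by
  have h1 := congrFun (dE_exp (tame_logAvg (B := B) hν hU hl) e) w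
  have h2 : (fun w => Real.exp (logAvg ν B U w)) = gavg ν B (fun w => Real.exp (U w)) :=
    funext (exp_logAvg hν hU hl)
  rw [h2, dE_gavg hν (hU.exp hl), dE_exp hU, ← exp_logAvg_mul_tilt hν hU hl] at h1
  exact (mul_left_cancel₀ (Real.exp_pos _).ne' h1).symm

/-- Differentiating a tilted average in the field also differentiates the weight, which adds a
covariance with respect to the tilted measure. -/
lemma dE_tilt (hν : ExpMoments ν) (hU : Tame U) (hl : LocLin U) (hf : Tame f) (e : E)
    (w : Θ × (E → ℝ)) :
    dE e (tilt ν B U f) w = tilt ν B U (fun w => dE e f w + f w * dE e U w) w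
      - tilt ν B U f w * dE e (logAvg ν B U) w := by
  have hY := tame_logAvg (B := B) hν hU hl
  have hYl := locLin_logAvg (B := B) hν hU hl
  have h1 := congrFun (dE_mul (hY.exp hYl) (Tame.tilt (B := B) hν hU hl hf) e) w
  have h2 : (fun w => Real.exp (logAvg ν B U w) * tilt ν B U f w)
      = gavg ν B (fun w => Real.exp (U w) * f w) := funext (exp_logAvg_mul_tilt hν hU hl)
  have h3 : dE e (fun w => Real.exp (U w) * f w)
      = fun w => Real.exp (U w) * (dE e f w + f w * dE e U w) := by
    rw [dE_mul (hU.exp hl) hf, dE_exp hU]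
    funext w; ring
  rw [h2, dE_gavg hν ((hU.exp hl).mul hf), h3, ← exp_logAvg_mul_tilt hν hU hl, dE_exp hY] at h1
  have h4 : Real.exp (logAvg ν B U w) * tilt ν B U (fun w => dE e f w + f w * dE e U w) w
      = Real.exp (logAvg ν B U w) * (dE e (tilt ν B U f) w
        + tilt ν B U f w * dE e (logAvg ν B U) w) := by rw [h1]; ring
  have h5 := mul_left_cancel₀ (Real.exp_pos _).ne' h4
  linarith

variable {ι : Type*} [Fintype ι] [DecidableEq ι] {η : ι → Θ →L[ℝ] ℝ}
  {ξ : ι → 𝒳 →L[ℝ] (E → ℝ)} {K : ι → E → E → ℝ}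

/-- The nonlinear heat equation of the log-average. -/
lemma diffusion_logAvg (hν : ExpMoments ν) (hξ : IsGaussianField ν ξ K) (hU : Tame U)
    (hl : LocLin U) (τ : Θ) {R R' : E → E → ℝ} (w : Θ × (E → ℝ))
    (hR : ∀ e e', R' e e' = R e e' + ∑ κ, 2 * (η κ τ * η κ w.1) * K κ e e') :
    diffusion τ R (logAvg ν (fieldMap η ξ) U) w
        + 1 / 2 * carre R (logAvg ν (fieldMap η ξ) U) (logAvg ν (fieldMap η ξ) U) w
      = tilt ν (fieldMap η ξ) U (fun w => diffusion τ R' U w + 1 / 2 * carre R' U U w) w := by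
  have h1 := diffusion_exp (tame_logAvg (B := fieldMap η ξ) hν hU hl)
    (locLin_logAvg hν hU hl) τ R w
  have h2 : (fun w => Real.exp (logAvg ν (fieldMap η ξ) U w))
      = gavg ν (fieldMap η ξ) (fun w => Real.exp (U w)) := funext (exp_logAvg hν hU hl)
  rw [h2, diffusion_gavg hν hξ (hU.exp hl) τ w hR, funext (diffusion_exp hU hl τ R'),
    ← exp_logAvg_mul_tilt hν hU hl] at h1
  exact (mul_left_cancel₀ (Real.exp_pos _).ne' h1).symm

/-- The heat equation of a tilted average. -/
lemma diffusion_tilt (hν : ExpMoments ν) (hξ : IsGaussianField ν ξ K) (hU : Tame U)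
    (hl : LocLin U) (hf : Tame f) (τ : Θ) {R R' : E → E → ℝ} (w : Θ × (E → ℝ))
    (hR : ∀ e e', R' e e' = R e e' + ∑ κ, 2 * (η κ τ * η κ w.1) * K κ e e') :
    diffusion τ R (tilt ν (fieldMap η ξ) U f) w
      = tilt ν (fieldMap η ξ) U (fun w => diffusion τ R' f w + carre R' U f w
          + f w * (diffusion τ R' U w + 1 / 2 * carre R' U U w)) w
        - carre R (logAvg ν (fieldMap η ξ) U) (tilt ν (fieldMap η ξ) U f) w
        - tilt ν (fieldMap η ξ) U f w *
          tilt ν (fieldMap η ξ) U (fun w => diffusion τ R' U w + 1 / 2 * carre R' U U w) w := by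
  have hY := tame_logAvg (B := fieldMap η ξ) hν hU hl
  have hYl := locLin_logAvg (B := fieldMap η ξ) hν hU hl
  have h1 := diffusion_mul (hY.exp hYl) (Tame.tilt (B := fieldMap η ξ) hν hU hl hf) τ R w
  have h2 : (fun w => Real.exp (logAvg ν (fieldMap η ξ) U w) * tilt ν (fieldMap η ξ) U f w)
      = gavg ν (fieldMap η ξ) (fun w => Real.exp (U w) * f w) :=
    funext (exp_logAvg_mul_tilt hν hU hl)
  have h3 : diffusion τ R' (fun w => Real.exp (U w) * f w)
      = fun w => Real.exp (U w) * (diffusion τ R' f w + carre R' U f w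
          + f w * (diffusion τ R' U w + 1 / 2 * carre R' U U w)) := by
    funext w
    rw [diffusion_mul (hU.exp hl) hf, diffusion_exp hU hl, carre_exp_left hU]
    ring
  rw [h2, diffusion_gavg hν hξ ((hU.exp hl).mul hf) τ w hR, h3, ← exp_logAvg_mul_tilt hν hU hl,
    diffusion_exp hY hYl, carre_exp_left hY, diffusion_logAvg hν hξ hU hl τ w hR] at h1
  have h4 := mul_left_cancel₀ (Real.exp_pos (logAvg ν (fieldMap η ξ) U w)).ne'
    (h1.trans (show _ = Real.exp (logAvg ν (fieldMap η ξ) U w)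
      * (diffusion τ R (tilt ν (fieldMap η ξ) U f) w
        + carre R (logAvg ν (fieldMap η ξ) U) (tilt ν (fieldMap η ξ) U f) w
        + tilt ν (fieldMap η ξ) U f w *
          tilt ν (fieldMap η ξ) U (fun w => diffusion τ R' U w + 1 / 2 * carre R' U U w) w)
      by ring))
  linarith

end Tilt

/-! ### The Gaussian fields of the bilinear model -/

section Fields

variable {n d l : ℕ}

/-- The standard deviations are indexed by pairs of a level and one of three kinds of noise; `none`
is the index of the matrix noise. -/
abbrev Coord (r : ℕ) : Type := Option (Fin (r + 2) × Fin 3)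

/-- The parameters: standard deviations of the noises, and the exponents `m_k / m_{k-1}`. -/
abbrev Param (r : ℕ) : Type := (Coord r → ℝ) × (Fin (r + 2) → ℝ)

/-- The standard deviation of the noise of kind `κ` at level `k`. -/
def sdev (r k : ℕ) (κ : Fin 3) : Param r →L[ℝ] ℝ :=
  (ContinuousLinearMap.proj (R := ℝ) (φ := fun _ : Coord r => ℝ)
    (some (Fin.ofNat (r + 2) k, κ))).comp (ContinuousLinearMap.fst ℝ _ _)

/-- The standard deviation of the matrix noise. -/
def sdevG (r : ℕ) : Param r →L[ℝ] ℝ :=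
  (ContinuousLinearMap.proj (R := ℝ) (φ := fun _ : Coord r => ℝ) none).comp
    (ContinuousLinearMap.fst ℝ _ _)

/-- The exponent `m_k / m_{k-1}`. -/
def expo (r k : ℕ) : Param r →L[ℝ] ℝ :=
  (ContinuousLinearMap.proj (R := ℝ) (φ := fun _ : Fin (r + 2) => ℝ) (Fin.ofNat (r + 2) k)).comp
    (ContinuousLinearMap.snd ℝ _ _)

/-- The three components of the field generated by the noise of one level. -/
def lvlField (P : BilinearModel n d l) (κ : Fin 3) : Noise d n →L[ℝ] (Fin l × Fin l → ℝ) :=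
  LinearMap.toContinuousLinearMap
    { toFun := fun u e => match κ with
        | 0 => ‖P.x e.1‖ * ‖P.y e.2‖ * u.1
        | 1 => ‖P.x e.1‖ * ∑ i, P.y e.2 i * u.2.1 i
        | 2 => ‖P.y e.2‖ * ∑ j, u.2.2 j * P.x e.1 j
      map_add' := by
        intro u u'
        funext e
        fin_cases κ <;> simp [mul_add, add_mul, Finset.sum_add_distrib]
      map_smul' := by
        intro c u
        funext e
        fin_cases κ <;> simp only [Prod.smul_fst, Prod.smul_snd, Pi.smul_apply, smul_eq_mul,
          RingHom.id_apply, Finset.mul_sum]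
        · ring
        · exact Finset.sum_congr rfl fun i _ => by ring
        · exact Finset.sum_congr rfl fun i _ => by ring }

lemma lvlField_zero (P : BilinearModel n d l) (u : Noise d n) (e : Fin l × Fin l) :
    lvlField P 0 u e = ‖P.x e.1‖ * ‖P.y e.2‖ * u.1 := rfl

lemma lvlField_one (P : BilinearModel n d l) (u : Noise d n) (e : Fin l × Fin l) :
    lvlField P 1 u e = ‖P.x e.1‖ * ∑ i, P.y e.2 i * u.2.1 i := rfl

lemma lvlField_two (P : BilinearModel n d l) (u : Noise d n) (e : Fin l × Fin l) :
    lvlField P 2 u e = ‖P.y e.2‖ * ∑ j, u.2.2 j * P.x e.1 j := rfl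

/-- The field generated by the matrix noise. -/
def matField (P : BilinearModel n d l) :
    (Fin d → Fin n → ℝ) →L[ℝ] (Fin l × Fin l → ℝ) :=
  LinearMap.toContinuousLinearMap
    { toFun := fun G e => ∑ i, ∑ j, P.y e.2 i * G i j * P.x e.1 j
      map_add' := by
        intro G G'
        funext e
        simp [mul_add, add_mul, Finset.sum_add_distrib]
      map_smul' := by
        intro c G
        funext e
        simp only [Pi.smul_apply, smul_eq_mul, RingHom.id_apply, Finset.mul_sum]
        exact Finset.sum_congr rfl fun i _ => Finset.sum_congr rfl fun j _ => by ring }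

lemma matField_apply (P : BilinearModel n d l) (G : Fin d → Fin n → ℝ) (e : Fin l × Fin l) :
    matField P G e = ∑ i, ∑ j, P.y e.2 i * G i j * P.x e.1 j := rfl

/-- The covariances of the components of the field of one level. -/
def lvlCov (P : BilinearModel n d l) (κ : Fin 3) (e e' : Fin l × Fin l) : ℝ :=
  match κ with
  | 0 => ‖P.x e.1‖ * ‖P.x e'.1‖ * (‖P.y e.2‖ * ‖P.y e'.2‖)
  | 1 => ‖P.x e.1‖ * ‖P.x e'.1‖ * inner ℝ (P.y e'.2) (P.y e.2)
  | 2 => ‖P.y e.2‖ * ‖P.y e'.2‖ * inner ℝ (P.x e'.1) (P.x e.1)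

/-- The covariance of the matrix field. -/
def matCov (P : BilinearModel n d l) (e e' : Fin l × Fin l) : ℝ :=
  inner ℝ (P.x e'.1) (P.x e.1) * inner ℝ (P.y e'.2) (P.y e.2)

lemma inner_eq_sum {N : ℕ} (x y : EuclideanSpace ℝ (Fin N)) :
    inner ℝ y x = ∑ i, x i * y i := by
  simp [PiLp.inner_apply]

instance : IsProbabilityMeasure (noiseLaw d n) := by unfold noiseLaw; infer_instance

instance : IsProbabilityMeasure (matrixLaw d n) := by unfold matrixLaw; infer_instance

lemma expMoments_noiseLaw : ExpMoments (noiseLaw d n) :=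
  expMoments_gaussianReal.prod (expMoments_gaussianReal.pi.prod expMoments_gaussianReal.pi)

lemma expMoments_matrixLaw : ExpMoments (matrixLaw d n) := expMoments_gaussianReal.pi.pi

lemma isGaussianField_lvlField (P : BilinearModel n d l) :
    IsGaussianField (noiseLaw d n) (lvlField P) (lvlCov P) := by
  have hπ : ∀ N : ℕ, ExpMoments (Measure.pi fun _ : Fin N => gaussianReal 0 1) :=
    fun N => expMoments_gaussianReal.pi
  intro κ
  fin_cases κ
  · refine ⟨Unit, inferInstance, fun _ => _, fun _ => ((1 : ℝ), 0),
      fun _ => isStein_gaussianReal.prod_fst expMoments_gaussianReal ((hπ d).prod (hπ n)),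
      fun x => ?_, fun _ κ' hκ => ?_, fun e e' => ?_⟩
    · funext e
      simp [lvlField_zero]
      ring
    · fin_cases κ'
      · exact absurd rfl hκ
      · funext e; simp [lvlField_one]
      · funext e; simp [lvlField_two]
    · simp [lvlCov, lvlField_zero]; ring
  · refine ⟨Fin d, inferInstance, fun i => _, fun i => ((0 : ℝ), (Pi.single i (1 : ℝ), 0)),
      fun i => ((isStein_gaussianReal.pi expMoments_gaussianReal i).prod_fst (hπ d)
        (hπ n)).prod_snd expMoments_gaussianReal ((hπ d).prod (hπ n)),
      fun x => ?_, fun _ κ' hκ => ?_, fun e e' => ?_⟩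
    · funext e
      simp [lvlField_one, Finset.sum_apply, Finset.mul_sum, Pi.single_apply]
      exact Finset.sum_congr rfl fun i _ => by ring
    · fin_cases κ'
      · funext e; simp [lvlField_zero]
      · exact absurd rfl hκ
      · funext e; simp [lvlField_two]
    · simp [lvlCov, lvlField_one, Pi.single_apply, inner_eq_sum, Finset.mul_sum]
      exact Finset.sum_congr rfl fun i _ => by ring
  · refine ⟨Fin n, inferInstance, fun i => _, fun i => ((0 : ℝ), (0, Pi.single i (1 : ℝ))),
      fun i => ((isStein_gaussianReal.pi expMoments_gaussianReal i).prod_snd (hπ d)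
        (hπ n)).prod_snd expMoments_gaussianReal ((hπ d).prod (hπ n)),
      fun x => ?_, fun _ κ' hκ => ?_, fun e e' => ?_⟩
    · funext e
      simp [lvlField_two, Finset.sum_apply, Finset.mul_sum, Pi.single_apply]
      exact Finset.sum_congr rfl fun i _ => by ring
    · fin_cases κ'
      · funext e; simp [lvlField_zero]
      · funext e; simp [lvlField_one]
      · exact absurd rfl hκ
    · simp [lvlCov, lvlField_two, Pi.single_apply, inner_eq_sum, Finset.mul_sum]
      exact Finset.sum_congr rfl fun i _ => by ring

lemma isGaussianField_matField (P : BilinearModel n d l) :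
    IsGaussianField (matrixLaw d n) (fun _ : Unit => matField P) (fun _ => matCov P) := by
  intro κ
  refine ⟨Fin d × Fin n, inferInstance, fun ij => _,
    fun ij => Pi.single ij.1 (Pi.single ij.2 (1 : ℝ)),
    fun ij => (isStein_gaussianReal.pi expMoments_gaussianReal ij.2).pi
      (expMoments_gaussianReal.pi) ij.1,
    fun x => ?_, fun _ κ' hκ => absurd rfl hκ, fun e e' => ?_⟩
  all_goals
    have hb : ∀ (ij : Fin d × Fin n) (e : Fin l × Fin l),
        matField P (Pi.single ij.1 (Pi.single ij.2 (1 : ℝ))) e = P.y e.2 ij.1 * P.x e.1 ij.2 := by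
      intro ij e
      rw [matField_apply, Finset.sum_eq_single ij.1, Finset.sum_eq_single ij.2]
      · simp
      · intro j _ hj; simp [hj]
      · simp
      · intro i _ hi; simp [hi]
      · simp
  · funext e
    rw [Finset.sum_apply]
    simp only [Pi.smul_apply, hb, smul_eq_mul]
    rw [matField_apply, Fintype.sum_prod_type]
    refine Finset.sum_congr rfl fun i _ => Finset.sum_congr rfl fun j _ => ?_
    simp
    ring
  · simp only [hb, matCov, inner_eq_sum]
    rw [Fintype.sum_prod_type, Finset.sum_mul_sum, Finset.sum_comm]
    exact Finset.sum_congr rfl fun i _ => Finset.sum_congr rfl fun j _ => by ring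

/-- The random shift of the field by the noise of level `k`. -/
def lvlMap (P : BilinearModel n d l) (r k : ℕ) :
    Param r →L[ℝ] Noise d n →L[ℝ] (Fin l × Fin l → ℝ) :=
  fieldMap (sdev r k) (lvlField P)

/-- The random shift of the field by the matrix noise. -/
def matMap (P : BilinearModel n d l) (r : ℕ) :
    Param r →L[ℝ] (Fin d → Fin n → ℝ) →L[ℝ] (Fin l × Fin l → ℝ) :=
  fieldMap (fun _ : Unit => sdevG r) (fun _ => matField P)

/-- The average over the matrix noise and the noise of level `r + 1`. -/
def outerAvg (P : BilinearModel n d l) (r : ℕ) (f : Param r × (Fin l × Fin l → ℝ) → ℝ) :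
    Param r × (Fin l × Fin l → ℝ) → ℝ :=
  gavg (matrixLaw d n) (matMap P r) (gavg (noiseLaw d n) (lvlMap P r (r + 1)) f)

lemma Tame.outerAvg {P : BilinearModel n d l} {r : ℕ}
    {f : Param r × (Fin l × Fin l → ℝ) → ℝ} (hf : Tame f) : Tame (outerAvg P r f) :=
  (hf.gavg expMoments_noiseLaw).gavg expMoments_matrixLaw

end Fields

/-! ### The partition function and its log-averages -/

section Potential

variable {n d l : ℕ}

section LogSumExp

variable {Θ V α : Type*} [NormedAddCommGroup Θ] [NormedSpace ℝ Θ] [NormedAddCommGroup V]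
  [NormedSpace ℝ V] [Fintype α] [Nonempty α]

lemma sum_exp_pos (g : α → ℝ) : 0 < ∑ a, Real.exp (g a) :=
  Finset.sum_pos (fun _ _ => Real.exp_pos _) Finset.univ_nonempty

lemma locLin_log_sum_exp {g : α → Θ × V → ℝ} (hg : ∀ a, LocLin (g a)) :
    LocLin (fun w => Real.log (∑ a, Real.exp (g a w))) := by
  intro B
  choose c hc h using fun a => hg a B
  have hC : ∀ a, c a ≤ ∑ a, c a := fun a =>
    Finset.single_le_sum (f := c) (fun i _ => hc i) (Finset.mem_univ a)
  have hC0 : 0 ≤ ∑ a, c a := Finset.sum_nonneg fun i _ => hc i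
  have hN : (1 : ℝ) ≤ Fintype.card α := by exact_mod_cast Fintype.card_pos
  have hL : 0 ≤ Real.log (Fintype.card α) := Real.log_nonneg hN
  refine ⟨∑ a, c a + Real.log (Fintype.card α), by positivity, fun w hw => ?_⟩
  have hn : 0 ≤ ‖w.2‖ := norm_nonneg _
  have hb : ∀ a, |g a w| ≤ (∑ a, c a) * (1 + ‖w.2‖) := fun a =>
    (h a w hw).trans (by gcongr; exact hC a)
  have hup : Real.log (∑ a, Real.exp (g a w))
      ≤ Real.log (Fintype.card α) + (∑ a, c a) * (1 + ‖w.2‖) := by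
    rw [Real.log_le_iff_le_exp (sum_exp_pos _), Real.exp_add, Real.exp_log (by linarith)]
    calc ∑ a, Real.exp (g a w) ≤ ∑ _a : α, Real.exp ((∑ a, c a) * (1 + ‖w.2‖)) :=
          Finset.sum_le_sum fun a _ => Real.exp_le_exp.2 ((le_abs_self _).trans (hb a))
      _ = _ := by simp
  have hlo : -((∑ a, c a) * (1 + ‖w.2‖)) ≤ Real.log (∑ a, Real.exp (g a w)) := by
    rw [Real.le_log_iff_exp_le (sum_exp_pos _)]
    obtain ⟨a⟩ := ‹Nonempty α›
    exact (Real.exp_le_exp.2 (abs_le.1 (hb a)).1).trans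
      (Finset.single_le_sum (f := fun a => Real.exp (g a w)) (fun i _ => (Real.exp_pos _).le)
        (Finset.mem_univ a))
  rw [abs_le]
  constructor <;> nlinarith [mul_nonneg hL hn]

lemma tame_log_sum_exp {g : α → Θ × V → ℝ} (hg : ∀ a, LocLin (g a)) (ht : ∀ a, Tame (g a)) :
    Tame (fun w => Real.log (∑ a, Real.exp (g a w))) :=
  Tame.log (fun _ => sum_exp_pos _) (locLin_log_sum_exp hg)
    (Tame.sum fun a _ => (ht a).exp (hg a))

lemma dirD_log_sum_exp {g : α → Θ × V → ℝ} (hg : ∀ a, Differentiable ℝ (g a)) (h w : Θ × V) :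
    dirD h (fun w => Real.log (∑ a, Real.exp (g a w))) w
      = ∑ a, Real.exp (g a w - Real.log (∑ a, Real.exp (g a w))) * dirD h (g a) w := by
  have hd : Differentiable ℝ fun w => ∑ a, Real.exp (g a w) :=
    Differentiable.fun_sum fun a _ => (hg a).exp
  rw [dirD_log hd fun w => (sum_exp_pos _).ne']
  have e1 : dirD h (fun w => ∑ a, Real.exp (g a w)) w
      = ∑ a, Real.exp (g a w) * dirD h (g a) w := by
    simp only [dirD]
    rw [fderiv_fun_sum fun a _ => (hg a).exp w, sum_apply]
    exact Finset.sum_congr rfl fun a _ => congrFun (dirD_exp (hg a) h) w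
  simp only [e1, Finset.mul_sum, Real.exp_sub, Real.exp_log (sum_exp_pos _)]
  exact Finset.sum_congr rfl fun a _ => by rw [div_mul_eq_mul_div, inv_mul_eq_div]

end LogSumExp

variable {r : ℕ}

lemma locLin_coord (c : ℝ) (e : Fin l × Fin l) :
    LocLin (fun w : Param r × (Fin l × Fin l → ℝ) => c * w.2 e) := by
  intro B
  refine ⟨|c|, abs_nonneg c, fun w _ => ?_⟩
  rw [abs_mul]
  have : |w.2 e| ≤ ‖w.2‖ := norm_le_pi_norm w.2 e
  gcongr
  linarith

lemma tame_coord (c : ℝ) (e : Fin l × Fin l) :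
    Tame (fun w : Param r × (Fin l × Fin l → ℝ) => c * w.2 e) :=
  (tame_clm ((ContinuousLinearMap.proj (R := ℝ) (φ := fun _ : Fin l × Fin l => ℝ) e).comp
    (ContinuousLinearMap.snd ℝ (Param r) (Fin l × Fin l → ℝ)))).const_mul c

lemma dirD_coord (c : ℝ) (e : Fin l × Fin l) (h w : Param r × (Fin l × Fin l → ℝ)) :
    dirD h (fun w : Param r × (Fin l × Fin l → ℝ) => c * w.2 e) w = c * h.2 e := by
  have h1 : HasFDerivAt (fun w : Param r × (Fin l × Fin l → ℝ) => c * w.2 e)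
      (c • ((ContinuousLinearMap.proj (R := ℝ) (φ := fun _ : Fin l × Fin l => ℝ) e).comp
        (ContinuousLinearMap.snd ℝ (Param r) (Fin l × Fin l → ℝ)))) w :=
    (ContinuousLinearMap.hasFDerivAt (x := w)
      ((ContinuousLinearMap.proj (R := ℝ) (φ := fun _ : Fin l × Fin l => ℝ) e).comp
        (ContinuousLinearMap.snd ℝ (Param r) (Fin l × Fin l → ℝ)))).const_mul c
  rw [dirD, h1.fderiv]; simp

/-- `log C^{(i₁)}` as a function of the field. -/
def logC (P : BilinearModel n d l) (i : Fin l) (w : Param r × (Fin l × Fin l → ℝ)) : ℝ :=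
  Real.log (∑ j, Real.exp (P.β * w.2 (i, j)))

/-- `log Z` as a function of the field. -/
def logZ (P : BilinearModel n d l) (w : Param r × (Fin l × Fin l → ℝ)) : ℝ :=
  Real.log (∑ i, Real.exp (P.s * logC P i w))

/-- `log ζ_k` as a function of the parameter and of the field that remains after averaging over the
noises of levels `1, …, k`. -/
def pot (P : BilinearModel n d l) (r : ℕ) : ℕ → Param r × (Fin l × Fin l → ℝ) → ℝ
  | 0 => logZ P
  | k + 1 => logAvg (noiseLaw d n) (lvlMap P r (k + 1)) fun w => expo r (k + 1) w.1 * pot P r k w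

/-- The exponent of the tilting density at level `k`. -/
def tiltPot (P : BilinearModel n d l) (r k : ℕ) (w : Param r × (Fin l × Fin l → ℝ)) : ℝ :=
  expo r k w.1 * pot P r (k - 1) w

/-- The operator `Φ_{U_k}` on functions of the parameter and the field. -/
def PhiF (P : BilinearModel n d l) (r k : ℕ) (f : Param r × (Fin l × Fin l → ℝ) → ℝ) :
    Param r × (Fin l × Fin l → ℝ) → ℝ :=
  tilt (noiseLaw d n) (lvlMap P r k) (tiltPot P r k) f

/-- The composition of `j` consecutive operators `PhiF`, of which the one of level `a` acts
first. -/
def chain (P : BilinearModel n d l) (r a : ℕ) :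
    ℕ → (Param r × (Fin l × Fin l → ℝ) → ℝ) → Param r × (Fin l × Fin l → ℝ) → ℝ
  | 0, f => f
  | j + 1, f => PhiF P r (a + j) (chain P r a j f)

/-- `γ₀(i₁,i₂)` as a function of the field. -/
def gibbs (P : BilinearModel n d l) (e : Fin l × Fin l)
    (w : Param r × (Fin l × Fin l → ℝ)) : ℝ :=
  Real.exp (P.s * logC P e.1 w - logZ P w) * Real.exp (P.β * w.2 e - logC P e.1 w)

variable (P : BilinearModel n d l) [NeZero l]

lemma locLin_logC (i : Fin l) : LocLin (logC (r := r) P i) :=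
  locLin_log_sum_exp fun j => locLin_coord P.β (i, j)

lemma tame_logC (i : Fin l) : Tame (logC (r := r) P i) :=
  tame_log_sum_exp (fun j => locLin_coord P.β (i, j)) fun j => tame_coord P.β (i, j)

lemma LocLin.const_mul {Θ V : Type*} [NormedAddCommGroup Θ] [NormedAddCommGroup V]
    {f : Θ × V → ℝ} (hf : LocLin f) (a : ℝ) : LocLin (fun w => a * f w) := by
  intro B
  obtain ⟨c, hc, h⟩ := hf B
  refine ⟨|a| * c, by positivity, fun w hw => ?_⟩
  rw [abs_mul, mul_assoc]
  exact mul_le_mul_of_nonneg_left (h w hw) (abs_nonneg a)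

lemma LocLin.sub {Θ V : Type*} [NormedAddCommGroup Θ] [NormedAddCommGroup V]
    {f g : Θ × V → ℝ} (hf : LocLin f) (hg : LocLin g) : LocLin (fun w => f w - g w) := by
  intro B
  obtain ⟨c, hc, h⟩ := hf B
  obtain ⟨c', hc', h'⟩ := hg B
  refine ⟨c + c', by positivity, fun w hw => (abs_sub _ _).trans ?_⟩
  rw [add_mul]
  exact add_le_add (h w hw) (h' w hw)

lemma locLin_logZ : LocLin (logZ (r := r) P) :=
  locLin_log_sum_exp fun i => (locLin_logC P i).const_mul P.s

lemma tame_logZ : Tame (logZ (r := r) P) :=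
  tame_log_sum_exp (fun i => (locLin_logC P i).const_mul P.s)
    fun i => (tame_logC P i).const_mul P.s

lemma tame_gibbs (e : Fin l × Fin l) : Tame (gibbs (r := r) P e) :=
  ((((tame_logC P e.1).const_mul P.s).sub (tame_logZ P)).exp
    (((locLin_logC P e.1).const_mul P.s).sub (locLin_logZ P))).mul
  (((tame_coord P.β e).sub (tame_logC P e.1)).exp ((locLin_coord P.β e).sub (locLin_logC P e.1)))

lemma pot_tame_locLin (k : ℕ) : Tame (pot P r k) ∧ LocLin (pot P r k) := by
  induction k with
  | zero => exact ⟨tame_logZ P, locLin_logZ P⟩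
  | succ k ih =>
    have h1 := (tame_param (V := Fin l × Fin l → ℝ) (expo r (k + 1))).mul ih.1
    have h2 := ih.2.clm_mul (expo r (k + 1))
    exact ⟨tame_logAvg expMoments_noiseLaw h1 h2, locLin_logAvg expMoments_noiseLaw h1 h2⟩

lemma tame_pot (k : ℕ) : Tame (pot P r k) := (pot_tame_locLin P k).1

lemma tame_tiltPot (k : ℕ) : Tame (tiltPot P r k) := (tame_param (expo r k)).mul (tame_pot P _)

lemma locLin_tiltPot (k : ℕ) : LocLin (tiltPot P r k) :=
  (pot_tame_locLin P _).2.clm_mul (expo r k)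

variable {P} in
lemma Tame.PhiF {k : ℕ} {f : Param r × (Fin l × Fin l → ℝ) → ℝ} (hf : Tame f) :
    Tame (PhiF P r k f) :=
  Tame.tilt expMoments_noiseLaw (tame_tiltPot P k) (locLin_tiltPot P k) hf

variable {P} in
lemma Tame.chain {a j : ℕ} {f : Param r × (Fin l × Fin l → ℝ) → ℝ} (hf : Tame f) :
    Tame (chain P r a j f) := by
  induction j with
  | zero => exact hf
  | succ j ih => exact ih.PhiF

end Potential

/-! ### The lifted quantities as functions of the parameter and the field -/

section Translation

variable {n d l r : ℕ}

/-- The parameter belonging to `(p, q, m, t)`. -/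
def paramPt (p q m : Fin (r + 2) → ℝ) (t : ℝ) : Param r :=
  (fun c => match c with
    | none => √t
    | some (k, 0) => √t * aCoef p q k
    | some (k, 1) => √(1 - t) * incCoef p k
    | some (k, 2) => √(1 - t) * incCoef q k,
   fun k => entry m k / entry m ((k : ℕ) - 1))

lemma val_ofNat {k : ℕ} (hk : k ≤ r + 1) : ((Fin.ofNat (r + 2) k : Fin (r + 2)) : ℕ) = k :=
  Nat.mod_eq_of_lt (by omega)

section

variable (p q m : Fin (r + 2) → ℝ) (t : ℝ)

lemma sdevG_paramPt : sdevG r (paramPt p q m t) = √t := rfl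

lemma sdev_zero_paramPt {k : ℕ} (hk : k ≤ r + 1) :
    sdev r k 0 (paramPt p q m t) = √t * aCoef p q k := by
  change √t * aCoef p q ((Fin.ofNat (r + 2) k : Fin (r + 2)) : ℕ) = _
  rw [val_ofNat hk]

lemma sdev_one_paramPt {k : ℕ} (hk : k ≤ r + 1) :
    sdev r k 1 (paramPt p q m t) = √(1 - t) * incCoef p k := by
  change √(1 - t) * incCoef p ((Fin.ofNat (r + 2) k : Fin (r + 2)) : ℕ) = _
  rw [val_ofNat hk]

lemma sdev_two_paramPt {k : ℕ} (hk : k ≤ r + 1) :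
    sdev r k 2 (paramPt p q m t) = √(1 - t) * incCoef q k := by
  change √(1 - t) * incCoef q ((Fin.ofNat (r + 2) k : Fin (r + 2)) : ℕ) = _
  rw [val_ofNat hk]

lemma expo_paramPt {k : ℕ} (hk : k ≤ r + 1) :
    expo r k (paramPt p q m t) = entry m k / entry m (k - 1) := by
  change entry m ((Fin.ofNat (r + 2) k : Fin (r + 2)) : ℕ)
    / entry m (((Fin.ofNat (r + 2) k : Fin (r + 2)) : ℕ) - 1) = _
  rw [val_ofNat hk]

end

lemma lvlMap_apply (P : BilinearModel n d l) (k : ℕ) (θ : Param r) (u : Noise d n) :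
    lvlMap P r k θ u = sdev r k 0 θ • lvlField P 0 u + sdev r k 1 θ • lvlField P 1 u
      + sdev r k 2 θ • lvlField P 2 u := by
  rw [lvlMap, fieldMap_apply, Fin.sum_univ_three]

lemma matMap_apply (P : BilinearModel n d l) (θ : Param r) (G : Fin d → Fin n → ℝ) :
    matMap P r θ G = sdevG r θ • matField P G := by
  rw [matMap, fieldMap_apply]; simp

/-- The part of the field generated by the matrix and the noises of levels above `k`. -/
def tailField (P : BilinearModel n d l) (θ : Param r) (G : Fin d → Fin n → ℝ)
    (k : ℕ) (ω : ℕ → Noise d n) : Fin l × Fin l → ℝ :=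
  matMap P r θ G + ∑ j ∈ Finset.Icc (k + 1) (r + 1), lvlMap P r j θ (ω j)

variable (P : BilinearModel n d l)

lemma D0_eq_tailField (p q m : Fin (r + 2) → ℝ) (t : ℝ) (G : Fin d → Fin n → ℝ)
    (ω : ℕ → Noise d n) (i₁ i₂ : Fin l) :
    D0 P p q t G ω i₁ i₂ = tailField P (paramPt p q m t) G 0 ω (i₁, i₂) := by
  have h : ∀ j ∈ Finset.Icc (0 + 1) (r + 1), lvlMap P r j (paramPt p q m t) (ω j) (i₁, i₂)
      = √(1 - t) * ‖P.x i₁‖ * (∑ i, P.y i₂ i * (incCoef p j * (ω j).2.1 i))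
        + √t * ‖P.x i₁‖ * ‖P.y i₂‖ * (aCoef p q j * (ω j).1)
        + √(1 - t) * ‖P.y i₂‖ * (∑ i, (incCoef q j * (ω j).2.2 i) * P.x i₁ i) := by
    intro j hj
    have hj' : j ≤ r + 1 := (Finset.mem_Icc.1 hj).2
    rw [lvlMap_apply]
    simp only [Pi.add_apply, Pi.smul_apply, smul_eq_mul, lvlField_zero, lvlField_one,
      lvlField_two, sdev_zero_paramPt _ _ _ _ hj', sdev_one_paramPt _ _ _ _ hj',
      sdev_two_paramPt _ _ _ _ hj']
    have e1 : ∑ i, P.y i₂ i * (incCoef p j * (ω j).2.1 i)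
        = incCoef p j * ∑ i, P.y i₂ i * (ω j).2.1 i := by
      rw [Finset.mul_sum]; exact Finset.sum_congr rfl fun i _ => by ring
    have e2 : ∑ i, (incCoef q j * (ω j).2.2 i) * P.x i₁ i
        = incCoef q j * ∑ i, (ω j).2.2 i * P.x i₁ i := by
      rw [Finset.mul_sum]; exact Finset.sum_congr rfl fun i _ => by ring
    rw [e1, e2]; ring
  rw [tailField, Pi.add_apply, Finset.sum_apply, Finset.sum_congr rfl h, matMap_apply,
    sdevG_paramPt, D0]
  simp only [Pi.smul_apply, smul_eq_mul, matField_apply, Finset.sum_add_distrib,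
    ← Finset.mul_sum]
  have e1 : ∑ i, P.y i₂ i * ∑ k ∈ Finset.Icc 1 (r + 1), incCoef p k * (ω k).2.1 i
      = ∑ k ∈ Finset.Icc (0 + 1) (r + 1), ∑ i, P.y i₂ i * (incCoef p k * (ω k).2.1 i) := by
    rw [Finset.sum_comm]
    exact Finset.sum_congr rfl fun i _ => Finset.mul_sum _ _ _
  have e2 : ∑ j, (∑ k ∈ Finset.Icc 1 (r + 1), incCoef q k * (ω k).2.2 j) * P.x i₁ j
      = ∑ k ∈ Finset.Icc (0 + 1) (r + 1), ∑ j, (incCoef q k * (ω k).2.2 j) * P.x i₁ j := by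
    rw [Finset.sum_comm]
    exact Finset.sum_congr rfl fun i _ => Finset.sum_mul _ _ _
  rw [e1, e2]
  ring

lemma tailField_update_succ (θ : Param r) (G : Fin d → Fin n → ℝ) {k : ℕ} (hk : k + 1 ≤ r + 1)
    (ω : ℕ → Noise d n) (u : Noise d n) :
    tailField P θ G k (Function.update ω (k + 1) u)
      = tailField P θ G (k + 1) ω + lvlMap P r (k + 1) θ u := by
  have h : ∀ j ∈ Finset.Icc (k + 1 + 1) (r + 1), lvlMap P r j θ (Function.update ω (k + 1) u j)
      = lvlMap P r j θ (ω j) := by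
    intro j hj
    rw [Function.update_of_ne]
    have := (Finset.mem_Icc.1 hj).1
    omega
  rw [tailField, tailField, ← Finset.add_sum_Ioc_eq_sum_Icc hk, Function.update_self,
    ← Finset.Icc_add_one_left_eq_Ioc, Finset.sum_congr rfl h]
  abel

lemma tailField_update_self (θ : Param r) (G : Fin d → Fin n → ℝ) (k : ℕ)
    (ω : ℕ → Noise d n) (u : Noise d n) :
    tailField P θ G k (Function.update ω k u) = tailField P θ G k ω := by
  rw [tailField, tailField]
  congr 1
  refine Finset.sum_congr rfl fun j hj => ?_
  rw [Function.update_of_ne]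
  have := (Finset.mem_Icc.1 hj).1
  omega

lemma expLevel_tailField (θ : Param r) (G : Fin d → Fin n → ℝ) {k : ℕ} (hk : k + 1 ≤ r + 1)
    (F : Param r × (Fin l × Fin l → ℝ) → ℝ) (ω : ℕ → Noise d n) :
    expLevel (k + 1) (fun ω => F (θ, tailField P θ G k ω)) ω
      = gavg (noiseLaw d n) (lvlMap P r (k + 1)) F (θ, tailField P θ G (k + 1) ω) := by
  simp only [expLevel, tailField_update_succ P θ G hk]
  rfl

variable [NeZero l] (p q m : Fin (r + 2) → ℝ) (t : ℝ) (G : Fin d → Fin n → ℝ)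

lemma C_eq_exp_logC (ω : ℕ → Noise d n) (i : Fin l) :
    C P p q t G ω i
      = Real.exp (logC P i (paramPt p q m t, tailField P (paramPt p q m t) G 0 ω)) := by
  rw [logC, Real.exp_log (sum_exp_pos _), C]
  exact Finset.sum_congr rfl fun j _ => by rw [A, D0_eq_tailField P p q m]

lemma Z_eq_exp_logZ (ω : ℕ → Noise d n) :
    Z P p q t G ω
      = Real.exp (logZ P (paramPt p q m t, tailField P (paramPt p q m t) G 0 ω)) := by
  rw [logZ, Real.exp_log (sum_exp_pos _), Z]
  refine Finset.sum_congr rfl fun i _ => ?_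
  rw [C_eq_exp_logC P p q m, ← Real.exp_mul, mul_comm]

lemma gamma0_eq_gibbs (i₁ i₂ : Fin l) (ω : ℕ → Noise d n) :
    gamma0 P p q t G i₁ i₂ ω
      = gibbs P (i₁, i₂) (paramPt p q m t, tailField P (paramPt p q m t) G 0 ω) := by
  rw [gamma0, gibbs, C_eq_exp_logC P p q m, Z_eq_exp_logZ P p q m, A, D0_eq_tailField P p q m,
    ← Real.exp_mul, ← Real.exp_sub, ← Real.exp_sub, mul_comm (logC P i₁ _) P.s]

/-- The lifted partition function `ζ_k`, after the substitution of the noises, is a function of the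
parameter and of the field that the noises of the levels above `k` build up. -/
lemma zeta_eq_exp_pot {k : ℕ} (hk : k ≤ r + 1) (ω : ℕ → Noise d n) :
    zeta P p q m t G k ω
      = Real.exp (pot P r k (paramPt p q m t, tailField P (paramPt p q m t) G k ω)) := by
  induction k generalizing ω with
  | zero => exact Z_eq_exp_logZ P p q m t G ω
  | succ k ih =>
    have h1 := tame_tiltPot (r := r) P (k + 1)
    have h2 := locLin_tiltPot (r := r) P (k + 1)
    have h3 : ∀ ω, zeta P p q m t G k ω ^ (entry m (k + 1) / entry m k)
        = Real.exp (tiltPot P r (k + 1)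
          (paramPt p q m t, tailField P (paramPt p q m t) G k ω)) := by
      intro ω
      rw [ih (by omega), ← Real.exp_mul, tiltPot, expo_paramPt _ _ _ _ hk, mul_comm,
        Nat.add_sub_cancel]
    rw [zeta, funext h3]
    rw [expLevel_tailField P (paramPt p q m t) G hk
      (fun w => Real.exp (tiltPot P r (k + 1) w))]
    exact (exp_logAvg expMoments_noiseLaw h1 h2 _).symm

lemma Phi_eq_PhiF {k : ℕ} (hk : k + 1 ≤ r + 1) (F : Param r × (Fin l × Fin l → ℝ) → ℝ)
    (ω : ℕ → Noise d n) :
    Phi P p q m t G (k + 1) (fun ω => F (paramPt p q m t, tailField P (paramPt p q m t) G k ω)) ω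
      = PhiF P r (k + 1) F (paramPt p q m t, tailField P (paramPt p q m t) G (k + 1) ω) := by
  set θ := paramPt p q m t with hθ
  have h1 := tame_tiltPot (r := r) P (k + 1)
  have h2 := locLin_tiltPot (r := r) P (k + 1)
  have h3 : ∀ u, zeta P p q m t G (k + 1 - 1) (Function.update ω (k + 1) u)
        ^ (entry m (k + 1) / entry m (k + 1 - 1)) / zeta P p q m t G (k + 1)
          (Function.update ω (k + 1) u) * F (θ, tailField P θ G k (Function.update ω (k + 1) u))
      = Real.exp (tiltPot P r (k + 1) (θ, tailField P θ G (k + 1) ω + lvlMap P r (k + 1) θ u))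
        * F (θ, tailField P θ G (k + 1) ω + lvlMap P r (k + 1) θ u)
        / Real.exp (pot P r (k + 1) (θ, tailField P θ G (k + 1) ω)) := by
    intro u
    rw [zeta_eq_exp_pot P p q m t G hk, Nat.add_sub_cancel, zeta_eq_exp_pot P p q m t G (by omega),
      ← Real.exp_mul, ← hθ, tailField_update_self, tailField_update_succ P θ G hk, tiltPot,
      expo_paramPt _ _ _ _ hk, mul_comm (pot P r k _), Nat.add_sub_cancel]
    ring
  rw [Phi, expLevel, funext h3, integral_div]
  rw [PhiF, tilt]
  congr 1
  exact exp_logAvg expMoments_noiseLaw h1 h2 _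

lemma PhiComp_eq_chain {a j : ℕ} (h : a + j ≤ r + 1) (F : Param r × (Fin l × Fin l → ℝ) → ℝ)
    (ω : ℕ → Noise d n) :
    PhiComp P p q m t G (a + 1) j
        (fun ω => F (paramPt p q m t, tailField P (paramPt p q m t) G a ω)) ω
      = chain P r (a + 1) j F
        (paramPt p q m t, tailField P (paramPt p q m t) G (a + j) ω) := by
  induction j generalizing ω with
  | zero => rfl
  | succ j ih =>
    rw [PhiComp, funext (ih (by omega)), chain]
    have e : a + 1 + j = a + j + 1 := by omega
    rw [e, Phi_eq_PhiF P p q m t G (by omega)]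
    rfl

/-- The function whose outer average is `gammaMean`. -/
def gammaF (P : BilinearModel n d l) (r k : ℕ) (f : Fin l → Fin l → Fin l → Fin l → ℝ)
    (w : Param r × (Fin l × Fin l → ℝ)) : ℝ :=
  ∑ i₁, ∑ i₂, ∑ p₁, ∑ p₂, chain P r (k + 1) (r - k) (fun w =>
    chain P r 1 k (gibbs P (i₁, i₂)) w * chain P r 1 k (gibbs P (p₁, p₂)) w) w * f i₁ i₂ p₁ p₂

lemma gammaWeight_eq_chain {k : ℕ} (hk : k ≤ r) (i₁ i₂ p₁ p₂ : Fin l) (ω : ℕ → Noise d n) :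
    gammaWeight P p q m t G (k + 1) i₁ i₂ p₁ p₂ ω
      = chain P r (k + 1) (r - k) (fun w =>
        chain P r 1 k (gibbs P (i₁, i₂)) w * chain P r 1 k (gibbs P (p₁, p₂)) w)
        (paramPt p q m t, tailField P (paramPt p q m t) G r ω) := by
  have h1 : ∀ i j ω, PhiComp P p q m t G 1 k (gamma0 P p q t G i j) ω
      = chain P r 1 k (gibbs P (i, j))
        (paramPt p q m t, tailField P (paramPt p q m t) G k ω) := by
    intro i j ω
    rw [show gamma0 P p q t G i j = fun ω => gibbs P (i, j) (paramPt p q m t,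
      tailField P (paramPt p q m t) G 0 ω) from funext fun ω => gamma0_eq_gibbs P p q m t G i j ω]
    have := PhiComp_eq_chain P p q m t G (a := 0) (j := k) (by omega) (gibbs P (i, j)) ω
    simpa using this
  rw [gammaWeight]
  simp only [Nat.add_sub_cancel, h1]
  have := PhiComp_eq_chain P p q m t G (a := k) (j := r - k) (by omega) (fun w =>
        chain P r 1 k (gibbs P (i₁, i₂)) w * chain P r 1 k (gibbs P (p₁, p₂)) w) ω
  rw [show k + (r - k) = r by omega] at this
  rw [show r + 1 - (k + 1) = r - k by omega]
  exact this

omit [NeZero l] in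
lemma expOuter_eq_outerAvg (F : Param r × (Fin l × Fin l → ℝ) → ℝ) :
    expOuter r (fun G ω => F (paramPt p q m t, tailField P (paramPt p q m t) G r ω))
      = outerAvg P r F (paramPt p q m t, 0) := by
  rw [expOuter, outerAvg, gavg]
  congr 1
  funext G
  rw [expLevel_tailField P _ G le_rfl]
  congr 2
  simp [tailField]

lemma gammaMean_eq_outerAvg {k : ℕ} (hk : k ≤ r) (f : Fin l → Fin l → Fin l → Fin l → ℝ) :
    gammaMean P p q m t (k + 1) f = outerAvg P r (gammaF P r k f) (paramPt p q m t, 0) := by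
  rw [← expOuter_eq_outerAvg, gammaMean]
  congr 1
  funext G ω
  simp only [gammaWeight_eq_chain P p q m t G hk, gammaF]

lemma psi_eq_outerAvg :
    psi P p q m t = 1 / (P.β * |P.s| * √(n : ℝ) * entry m r)
      * outerAvg P r (pot P r r) (paramPt p q m t, 0) := by
  rw [← expOuter_eq_outerAvg, psi]
  simp only [zeta_eq_exp_pot P p q m t _ (show r ≤ r + 1 by omega), Real.log_exp]
  simp only [expOuter, expLevel, integral_const_mul]

end Translation

/-! ### Differentiability up to the boundary of the admissible set -/

section Even

variable {n d l r : ℕ}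

/-- The change of sign of one standard deviation. -/
def flipC (c : Coord r) (θ : Param r) : Param r := θ - (2 * θ.1 c) • (Pi.single c 1, 0)

/-- Functions that do not depend on the signs of the standard deviations. -/
def EvenF {V : Type*} (f : Param r × V → ℝ) : Prop := ∀ c θ v, f (flipC c θ, v) = f (θ, v)

lemma flipC_fst_self (c : Coord r) (θ : Param r) : (flipC c θ).1 c = -θ.1 c := by
  simp [flipC]; ring

lemma flipC_fst_of_ne {c c' : Coord r} (h : c' ≠ c) (θ : Param r) :
    (flipC c θ).1 c' = θ.1 c' := by
  simp [flipC, h]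

lemma flipC_snd (c : Coord r) (θ : Param r) : (flipC c θ).2 = θ.2 := by
  simp [flipC]

lemma expo_flipC (k : ℕ) (c : Coord r) (θ : Param r) : expo r k (flipC c θ) = expo r k θ :=
  congrFun (flipC_snd c θ) _

lemma sdev_flipC_of_ne {k : ℕ} {κ : Fin 3} {c : Coord r}
    (h : some (Fin.ofNat (r + 2) k, κ) ≠ c) (θ : Param r) :
    sdev r k κ (flipC c θ) = sdev r k κ θ := flipC_fst_of_ne h θ

lemma sdev_flipC_self (k : ℕ) (κ : Fin 3) (θ : Param r) :
    sdev r k κ (flipC (some (Fin.ofNat (r + 2) k, κ)) θ) = -sdev r k κ θ := flipC_fst_self _ θ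

variable {P : BilinearModel n d l}

/-- A change of sign of a standard deviation is compensated by a reflection of the noise. -/
lemma EvenF.gavg_lvl {f : Param r × (Fin l × Fin l → ℝ) → ℝ} (hf : EvenF f) (k : ℕ) :
    EvenF (gavg (noiseLaw d n) (lvlMap P r k) f) := by
  intro c θ v
  simp only [gavg, shift]
  simp only [hf c θ]
  by_cases hc : ∃ κ, c = some (Fin.ofNat (r + 2) k, κ)
  · obtain ⟨κ, rfl⟩ := hc
    rcases (show κ = 0 ∨ κ = 1 ∨ κ = 2 by fin_cases κ <;> simp) with rfl | rfl | rfl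
    · rw [← integral_flip_scalar]
      congr 1; funext u; congr 3
      have h0 := sdev_flipC_self k (0 : Fin 3) θ
      have h1 := sdev_flipC_of_ne (k := k) (κ := 1) (c := some (Fin.ofNat (r + 2) k, 0)) (by simp) θ
      have h2 := sdev_flipC_of_ne (k := k) (κ := 2) (c := some (Fin.ofNat (r + 2) k, 0)) (by simp) θ
      rw [lvlMap_apply, lvlMap_apply, h0, h1, h2]
      funext e; simp [lvlField_zero, lvlField_one, lvlField_two]
    · rw [← integral_flip_left]
      congr 1; funext u; congr 3
      have h0 := sdev_flipC_of_ne (k := k) (κ := 0) (c := some (Fin.ofNat (r + 2) k, 1)) (by simp) θ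
      have h1 := sdev_flipC_self k (1 : Fin 3) θ
      have h2 := sdev_flipC_of_ne (k := k) (κ := 2) (c := some (Fin.ofNat (r + 2) k, 1)) (by simp) θ
      rw [lvlMap_apply, lvlMap_apply, h0, h1, h2]
      funext e; simp [lvlField_zero, lvlField_one, lvlField_two]
    · rw [← integral_flip_right]
      congr 1; funext u; congr 3
      have h0 := sdev_flipC_of_ne (k := k) (κ := 0) (c := some (Fin.ofNat (r + 2) k, 2)) (by simp) θ
      have h1 := sdev_flipC_of_ne (k := k) (κ := 1) (c := some (Fin.ofNat (r + 2) k, 2)) (by simp) θ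
      have h2 := sdev_flipC_self k (2 : Fin 3) θ
      rw [lvlMap_apply, lvlMap_apply, h0, h1, h2]
      funext e; simp [lvlField_zero, lvlField_one, lvlField_two]
  · push Not at hc
    have hne : ∀ κ', sdev r k κ' (flipC c θ) = sdev r k κ' θ :=
      fun κ' => sdev_flipC_of_ne (hc κ').symm θ
    congr 1; funext u; congr 3
    simp only [lvlMap_apply, hne]

lemma EvenF.gavg_mat {f : Param r × (Fin l × Fin l → ℝ) → ℝ} (hf : EvenF f) :
    EvenF (gavg (matrixLaw d n) (matMap P r) f) := by
  intro c θ v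
  simp only [gavg, shift]
  simp only [hf c θ]
  by_cases hc : c = none
  · subst hc
    have h : sdevG r (flipC none θ) = -sdevG r θ := flipC_fst_self _ θ
    rw [← integral_flip_matrix]
    congr 1; funext G; congr 3
    simp only [matMap_apply, h]
    funext e; simp
  · have h : sdevG r (flipC c θ) = sdevG r θ := flipC_fst_of_ne (Ne.symm hc) θ
    congr 1; funext G; congr 3
    simp only [matMap_apply, h]

lemma EvenF.outerAvg {f : Param r × (Fin l × Fin l → ℝ) → ℝ} (hf : EvenF f) :
    EvenF (outerAvg P r f) := (hf.gavg_lvl (P := P) (r + 1)).gavg_mat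

lemma EvenF.comp₂ {V : Type*} {f g : Param r × V → ℝ} (hf : EvenF f) (hg : EvenF g)
    (φ : ℝ → ℝ → ℝ) : EvenF (fun w => φ (f w) (g w)) := fun c θ v => by
  simp only [hf c θ v, hg c θ v]

lemma evenF_pot (k : ℕ) : EvenF (pot P r k) := by
  induction k with
  | zero => exact fun c θ v => rfl
  | succ k ih =>
    have h : EvenF (fun w : Param r × (Fin l × Fin l → ℝ) =>
        Real.exp (expo r (k + 1) w.1 * pot P r k w)) := fun c θ v => by
      simp only [expo_flipC, ih c θ v]
    exact fun c θ v => congrArg Real.log (h.gavg_lvl (k + 1) c θ v)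

lemma evenF_tiltPot (k : ℕ) : EvenF (tiltPot P r k) := fun c θ v => by
  simp only [tiltPot, expo_flipC, evenF_pot (k - 1) c θ v]

lemma EvenF.PhiF {f : Param r × (Fin l × Fin l → ℝ) → ℝ} (hf : EvenF f) (k : ℕ) :
    EvenF (PhiF P r k f) := by
  have h := evenF_tiltPot (P := P) (r := r) k
  have h1 := (h.comp₂ hf fun a b => Real.exp a * b).gavg_lvl (P := P) k
  have h2 := (h.comp₂ hf fun a _ => Real.exp a).gavg_lvl (P := P) k
  exact h1.comp₂ h2 fun a b => a / b

lemma EvenF.chain {f : Param r × (Fin l × Fin l → ℝ) → ℝ} (hf : EvenF f) (a j : ℕ) :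
    EvenF (chain P r a j f) := by
  induction j with
  | zero => exact hf
  | succ j ih => exact ih.PhiF _

lemma evenF_gibbs (e : Fin l × Fin l) : EvenF (gibbs (r := r) P e) := fun _ _ _ => rfl

lemma evenF_gammaF (k : ℕ) (f : Fin l → Fin l → Fin l → Fin l → ℝ) :
    EvenF (gammaF P r k f) := fun c θ v => by
  have h : ∀ e e', EvenF (FullyLifted.chain P r (k + 1) (r - k) (fun w =>
      FullyLifted.chain P r 1 k (gibbs P e) w * FullyLifted.chain P r 1 k (gibbs P e') w)) :=
    fun e e' => (((evenF_gibbs e).chain 1 k).comp₂ ((evenF_gibbs e').chain 1 k)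
      fun a b => a * b).chain _ _
  simp only [gammaF, h _ _ c θ v]

variable (P) in
lemma tame_gammaF [NeZero l] (k : ℕ) (f : Fin l → Fin l → Fin l → Fin l → ℝ) :
    Tame (gammaF P r k f) := by
  refine Tame.sum fun i₁ _ => Tame.sum fun i₂ _ => Tame.sum fun p₁ _ => Tame.sum fun p₂ _ => ?_
  exact (((tame_gibbs P _).chain.mul (tame_gibbs P _).chain).chain).mul (tame_const _)

end Even

section Within

variable {r : ℕ}

/-- The space of the variables `(p, q, m, t)`. -/
abbrev Vars (r : ℕ) : Type :=
  (Fin (r + 2) → ℝ) × (Fin (r + 2) → ℝ) × (Fin (r + 2) → ℝ) × ℝ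

/-- The domain on which `(p, q, t)` is admissible. -/
def domain (r : ℕ) : Set (Vars r) :=
  {x | x.1 ∈ overlapVectors r ∧ x.2.1 ∈ overlapVectors r ∧ x.2.2.2 ∈ Icc (0 : ℝ) 1}

/-- The parameter with standard deviations replaced by variances. -/
def varPt (x : Vars r) : Param r :=
  (fun c => match c with
    | none => x.2.2.2
    | some (k, 0) => x.2.2.2 * (entry x.1 ((k : ℕ) - 1) * entry x.2.1 ((k : ℕ) - 1)
        - entry x.1 k * entry x.2.1 k)
    | some (k, 1) => (1 - x.2.2.2) * (entry x.1 ((k : ℕ) - 1) - entry x.1 k)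
    | some (k, 2) => (1 - x.2.2.2) * (entry x.2.1 ((k : ℕ) - 1) - entry x.2.1 k),
   fun k => entry x.2.2.1 k / entry x.2.2.1 ((k : ℕ) - 1))

lemma entry_nonneg {p : Fin (r + 2) → ℝ} (hp : p ∈ overlapVectors r) (k : ℕ) :
    0 ≤ entry p k := by
  rw [entry]
  split_ifs with h
  · rw [← hp.2.2]; exact hp.2.1 (Fin.le_last _)
  · exact le_rfl

lemma entry_antitone {p : Fin (r + 2) → ℝ} (hp : p ∈ overlapVectors r) (k : ℕ) :
    entry p k ≤ entry p (k - 1) := by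
  by_cases h : k < r + 2
  · rw [entry, entry, dif_pos h, dif_pos (by omega)]
    exact hp.2.1 (Fin.mk_le_mk.2 (by omega))
  · have h0 : entry p k = 0 := by rw [entry, dif_neg h]
    rw [h0]; exact entry_nonneg hp _

lemma entry_le_one {p : Fin (r + 2) → ℝ} (hp : p ∈ overlapVectors r) (k : ℕ) :
    entry p k ≤ 1 := by
  rw [entry]
  split_ifs with h
  · rw [← hp.1]; exact hp.2.1 (Fin.zero_le _)
  · exact zero_le_one

lemma entry_zero_eq {p : Fin (r + 2) → ℝ} (hp : p ∈ overlapVectors r) : entry p 0 = 1 := hp.1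

lemma entry_last {p : Fin (r + 2) → ℝ} (hp : p ∈ overlapVectors r) : entry p (r + 1) = 0 := by
  rw [entry, dif_pos (by omega)]; exact hp.2.2

lemma entry_mul_antitone {p q : Fin (r + 2) → ℝ} (hp : p ∈ overlapVectors r)
    (hq : q ∈ overlapVectors r) (k : ℕ) :
    entry p k * entry q k ≤ entry p (k - 1) * entry q (k - 1) :=
  mul_le_mul (entry_antitone hp k) (entry_antitone hq k) (entry_nonneg hq k) (entry_nonneg hp _)

lemma lift_entry_ne {m : Fin (r + 2) → ℝ} (hm : m ∈ liftVectors r) {k : ℕ} (hk : k ≤ r) :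
    entry m k ≠ 0 := by
  rw [entry, dif_pos (by omega)]
  refine hm.2.2 _ fun h => ?_
  have := congrArg Fin.val h
  simp at this
  omega

lemma varPt_nonneg {x : Vars r} (hx : x ∈ domain r) (c : Coord r) : 0 ≤ (varPt x).1 c := by
  obtain ⟨hp, hq, ht0, ht1⟩ := hx
  have h1 : 0 ≤ 1 - x.2.2.2 := by linarith
  match c with
  | none => exact ht0
  | some (k, 0) => exact mul_nonneg ht0 (sub_nonneg.2 (entry_mul_antitone hp hq k))
  | some (k, 1) => exact mul_nonneg h1 (sub_nonneg.2 (entry_antitone hp k))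
  | some (k, 2) => exact mul_nonneg h1 (sub_nonneg.2 (entry_antitone hq k))

lemma paramPt_eq_sqrtFst {x : Vars r} (hx : x ∈ domain r) :
    paramPt x.1 x.2.1 x.2.2.1 x.2.2.2 = sqrtFst (varPt x) := by
  obtain ⟨-, -, ht0, ht1⟩ := hx
  have h1 : 0 ≤ 1 - x.2.2.2 := by linarith
  refine Prod.ext (funext fun c => ?_) rfl
  match c with
  | none => rfl
  | some (k, 0) => exact (Real.sqrt_mul ht0 _).symm
  | some (k, 1) => exact (Real.sqrt_mul h1 _).symm
  | some (k, 2) => exact (Real.sqrt_mul h1 _).symm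

lemma differentiable_entry (k : ℕ) : Differentiable ℝ (fun p : Fin (r + 2) → ℝ => entry p k) := by
  unfold entry
  split_ifs
  · fun_prop
  · fun_prop

lemma differentiableAt_entry {f : Vars r → Fin (r + 2) → ℝ} {x : Vars r}
    (hf : DifferentiableAt ℝ f x) (k : ℕ) : DifferentiableAt ℝ (fun x => entry (f x) k) x :=
  DifferentiableAt.comp (g := fun p : Fin (r + 2) → ℝ => entry p k) x
    (differentiable_entry k (f x)) hf

lemma differentiableAt_varPt {x : Vars r} (hm : x.2.2.1 ∈ liftVectors r) :
    DifferentiableAt ℝ (varPt (r := r)) x := by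
  have hp : ∀ k, DifferentiableAt ℝ (fun x : Vars r => entry x.1 k) x := fun k =>
    differentiableAt_entry (by fun_prop) k
  have hq : ∀ k, DifferentiableAt ℝ (fun x : Vars r => entry x.2.1 k) x := fun k =>
    differentiableAt_entry (by fun_prop) k
  have hme : ∀ k, DifferentiableAt ℝ (fun x : Vars r => entry x.2.2.1 k) x := fun k =>
    differentiableAt_entry (by fun_prop) k
  have ht : DifferentiableAt ℝ (fun x : Vars r => x.2.2.2) x := by fun_prop
  refine DifferentiableAt.prodMk ?_ ?_
  · refine differentiableAt_pi.2 fun c => ?_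
    match c with
    | none => exact ht
    | some (k, 0) => exact ht.mul (((hp _).mul (hq _)).sub ((hp _).mul (hq _)))
    | some (k, 1) => exact (ht.const_sub 1).mul ((hp _).sub (hp _))
    | some (k, 2) => exact (ht.const_sub 1).mul ((hq _).sub (hq _))
  · refine differentiableAt_pi.2 fun k => ?_
    exact (hme (k : ℕ)).mul ((hme ((k : ℕ) - 1)).fun_inv (lift_entry_ne hm (by have := k.2; omega)))

/-- A tame function that is even in the standard deviations is, at the parameter `paramPt`,
differentiable in `p`, `q`, `m` and `t` up to the boundary of the admissible set: the variances are
smooth there, although their square roots are not. -/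
lemma differentiableWithinAt_paramPt {V : Type*} [NormedAddCommGroup V] [NormedSpace ℝ V]
    [FiniteDimensional ℝ V] {f : Param r × V → ℝ} (hf : Tame f) (he : EvenF f) {x : Vars r}
    (hx : x ∈ domain r) (hm : x.2.2.1 ∈ liftVectors r) :
    DifferentiableWithinAt ℝ (fun x : Vars r => f (paramPt x.1 x.2.1 x.2.2.1 x.2.2.2, 0))
      (domain r) x := by
  have h1 : ContDiff ℝ 2 fun θ : Param r => f (θ, 0) :=
    (hf 2).contDiff.comp (contDiff_id.prodMk contDiff_const)
  have h2 := differentiableWithinAt_comp_sqrtFst h1 (fun c θ => he c θ 0) (varPt x)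
  have h3 := h2.comp x (differentiableAt_varPt hm).differentiableWithinAt
    (s := domain r) (fun y hy => varPt_nonneg hy)
  exact h3.congr (fun y hy => by simp only [paramPt_eq_sqrtFst hy]; rfl)
    (by simp only [paramPt_eq_sqrtFst hx]; rfl)

variable {n d l : ℕ} [NeZero l] (P : BilinearModel n d l)

lemma differentiableWithinAt_gammaMean {k : ℕ} (hk : k ≤ r)
    (f : Fin l → Fin l → Fin l → Fin l → ℝ) {x : Vars r} (hx : x ∈ domain r)
    (hm : x.2.2.1 ∈ liftVectors r) :
    DifferentiableWithinAt ℝ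
      (fun x : Vars r => gammaMean P x.1 x.2.1 x.2.2.1 x.2.2.2 (k + 1) f) (domain r) x := by
  simp only [gammaMean_eq_outerAvg P _ _ _ _ hk f]
  exact differentiableWithinAt_paramPt (tame_gammaF P k f).outerAvg (evenF_gammaF k f).outerAvg
    hx hm

lemma differentiableWithinAt_psi {x : Vars r} (hx : x ∈ domain r)
    (hm : x.2.2.1 ∈ liftVectors r) (hc : P.β * |P.s| * √(n : ℝ) ≠ 0) :
    DifferentiableWithinAt ℝ
      (fun x : Vars r => psi P x.1 x.2.1 x.2.2.1 x.2.2.2) (domain r) x := by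
  simp only [psi_eq_outerAvg P]
  have h := differentiableWithinAt_paramPt (f := outerAvg P r (pot P r r))
    (tame_pot P r).outerAvg (evenF_pot r).outerAvg hx hm
  refine DifferentiableWithinAt.mul ?_ h
  refine DifferentiableAt.differentiableWithinAt ?_
  simp only [one_div]
  have h := (differentiableAt_entry (x := x) (f := fun x : Vars r => x.2.2.1) (by fun_prop)
    r).const_mul (P.β * |P.s| * √(n : ℝ))
  exact h.fun_inv (mul_ne_zero hc (lift_entry_ne hm le_rfl))

/-- On the admissible set, `ψ₁` without its vanishing summand. -/
lemma psiOne_eq {p q : Fin (r + 2) → ℝ} (hp : p ∈ overlapVectors r)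
    (m : Fin (r + 2) → ℝ) (t : ℝ) : psiOne P p q m t
      = -(Real.sign P.s * P.s * P.β / (2 * √(n : ℝ))) *
      (∑ k ∈ Finset.range (r + 1), entry p k * entry q k
        * (entry m (k + 1) - if k = 0 then 0 else entry m k) * normMean P p q m t (k + 1))
    + psi P p q m t := by
  rw [psiOne]
  congr 2
  have h1 : Finset.Icc 1 (r + 1) = (Finset.range (r + 1)).image (fun k => k + 1) := by
    ext k
    simp only [Finset.mem_Icc, Finset.mem_image, Finset.mem_range]
    constructor
    · rintro ⟨h1, h2⟩; exact ⟨k - 1, by omega, by omega⟩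
    · rintro ⟨a, h1, rfl⟩; omega
  rw [h1, Finset.sum_image (by intro a _ b _ h; simpa using h)]
  simp only [Nat.add_sub_cancel, sub_mul, mul_sub, Finset.sum_sub_distrib]
  have h2 : ∑ k ∈ Finset.range (r + 1),
      entry p (k + 1) * entry q (k + 1) * normMean P p q m t (k + 1 + 1) * entry m (k + 1)
      = ∑ k ∈ Finset.range (r + 1), entry p k * entry q k * (if k = 0 then 0 else entry m k)
        * normMean P p q m t (k + 1) := by
    rw [Finset.sum_range_succ, entry_last hp, Finset.sum_range_succ']
    simp only [Nat.add_eq_zero_iff, one_ne_zero, and_false, if_false, if_true]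
    simp only [zero_mul, mul_zero, add_zero]
    exact Finset.sum_congr rfl fun k _ => by ring
  rw [h2]
  congr 1
  exact Finset.sum_congr rfl fun k _ => by ring

lemma differentiableWithinAt_psiOne {x : Vars r} (hx : x ∈ domain r)
    (hm : x.2.2.1 ∈ liftVectors r) (hc : P.β * |P.s| * √(n : ℝ) ≠ 0) :
    DifferentiableWithinAt ℝ
      (fun x : Vars r => psiOne P x.1 x.2.1 x.2.2.1 x.2.2.2) (domain r) x := by
  refine DifferentiableWithinAt.congr ?_ (fun y hy => psiOne_eq P hy.1 _ _) (psiOne_eq P hx.1 _ _)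
  refine DifferentiableWithinAt.add ?_ (differentiableWithinAt_psi P hx hm hc)
  refine DifferentiableWithinAt.const_mul (DifferentiableWithinAt.fun_sum fun k hk => ?_) _
  refine DifferentiableWithinAt.mul ?_
    (differentiableWithinAt_gammaMean P (by have := Finset.mem_range.1 hk; omega) _ hx hm)
  have hp : ∀ k, DifferentiableAt ℝ (fun x : Vars r => entry x.1 k) x := fun k =>
    differentiableAt_entry (by fun_prop) k
  have hq : ∀ k, DifferentiableAt ℝ (fun x : Vars r => entry x.2.1 k) x := fun k =>
    differentiableAt_entry (by fun_prop) k
  have hme : ∀ k, DifferentiableAt ℝ (fun x : Vars r => entry x.2.2.1 k) x := fun k =>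
    differentiableAt_entry (by fun_prop) k
  refine DifferentiableAt.differentiableWithinAt ?_
  refine ((hp _).mul (hq _)).mul ((hme _).sub ?_)
  split_ifs
  · exact differentiableAt_const _
  · exact hme _

end Within

/-! ### Averages at a fixed parameter -/

section Congr

variable {Θ 𝒳 E : Type*} [NormedAddCommGroup Θ] [NormedSpace ℝ Θ] [NormedAddCommGroup 𝒳]
  [NormedSpace ℝ 𝒳] [MeasurableSpace 𝒳] [Fintype E] [DecidableEq E]

lemma gavg_congr {ν : Measure 𝒳} {B : Θ →L[ℝ] 𝒳 →L[ℝ] (E → ℝ)} {f g : Θ × (E → ℝ) → ℝ}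
    (w : Θ × (E → ℝ)) (h : ∀ v, f (w.1, v) = g (w.1, v)) : gavg ν B f w = gavg ν B g w :=
  integral_congr_ae (Eventually.of_forall fun _ => h _)

lemma tilt_congr {ν : Measure 𝒳} {B : Θ →L[ℝ] 𝒳 →L[ℝ] (E → ℝ)} {U f g : Θ × (E → ℝ) → ℝ}
    (w : Θ × (E → ℝ)) (h : ∀ v, f (w.1, v) = g (w.1, v)) : tilt ν B U f w = tilt ν B U g w := by
  have h1 : gavg ν B (fun w => Real.exp (U w) * f w) w = gavg ν B (fun w => Real.exp (U w) * g w) w :=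
    gavg_congr w fun v => by simp only [h v]
  rw [tilt, tilt, h1]

end Congr

section ChainLinear

variable {n d l r : ℕ} [NeZero l] (P : BilinearModel n d l)
  {f g : Param r × (Fin l × Fin l → ℝ) → ℝ}

lemma PhiF_congr (k : ℕ) (w : Param r × (Fin l × Fin l → ℝ))
    (h : ∀ v, f (w.1, v) = g (w.1, v)) : PhiF P r k f w = PhiF P r k g w := tilt_congr w h

lemma chain_congr (a j : ℕ) (w : Param r × (Fin l × Fin l → ℝ))
    (h : ∀ v, f (w.1, v) = g (w.1, v)) : chain P r a j f w = chain P r a j g w := by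
  induction j generalizing w with
  | zero => exact h w.2
  | succ j ih => exact PhiF_congr P _ w fun v => ih (w.1, v) h

lemma outerAvg_congr (w : Param r × (Fin l × Fin l → ℝ))
    (h : ∀ v, f (w.1, v) = g (w.1, v)) : outerAvg P r f w = outerAvg P r g w :=
  gavg_congr w fun v => gavg_congr (w.1, v) h

lemma chain_const_mul (a j : ℕ) (c : ℝ) :
    chain P r a j (fun w => c * f w) = fun w => c * chain P r a j f w := by
  induction j with
  | zero => rfl
  | succ j ih =>
    rw [chain, ih]
    exact funext fun w => tilt_const_mul c w

lemma chain_const (a j : ℕ) (c : ℝ) :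
    chain P r a j (fun _ => c) = fun _ => c := by
  induction j with
  | zero => rfl
  | succ j ih =>
    rw [chain, ih]
    exact funext fun w => tilt_const expMoments_noiseLaw (tame_tiltPot P _)
      (locLin_tiltPot P _) c w

lemma PhiF_sum {α : Type*} (s : Finset α) {F : α → Param r × (Fin l × Fin l → ℝ) → ℝ}
    (hF : ∀ b, Tame (F b)) (k : ℕ) (w : Param r × (Fin l × Fin l → ℝ)) :
    PhiF P r k (fun w => ∑ b ∈ s, F b w) w = ∑ b ∈ s, PhiF P r k (F b) w :=
  tilt_sum expMoments_noiseLaw (tame_tiltPot P _) (locLin_tiltPot P _) s (fun b _ => hF b) w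

lemma chain_sum {α : Type*} (s : Finset α) {F : α → Param r × (Fin l × Fin l → ℝ) → ℝ}
    (hF : ∀ b, Tame (F b)) (a j : ℕ) :
    chain P r a j (fun w => ∑ b ∈ s, F b w) = fun w => ∑ b ∈ s, chain P r a j (F b) w := by
  induction j with
  | zero => rfl
  | succ j ih =>
    rw [chain, ih]
    exact funext fun w => PhiF_sum P s (fun b => (hF b).chain) _ w

lemma chain_mono (hf : Tame f) (hg : Tame g) (a j : ℕ) (w : Param r × (Fin l × Fin l → ℝ))
    (h : ∀ v, f (w.1, v) ≤ g (w.1, v)) : chain P r a j f w ≤ chain P r a j g w := by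
  induction j generalizing w with
  | zero => exact h w.2
  | succ j ih =>
    exact tilt_mono expMoments_noiseLaw (tame_tiltPot P _) (locLin_tiltPot P _) hf.chain hg.chain w
      fun v => ih (w.1, v) h

lemma outerAvg_const_mul (c : ℝ) (w : Param r × (Fin l × Fin l → ℝ)) :
    outerAvg P r (fun w => c * f w) w = c * outerAvg P r f w := by
  simp only [outerAvg, gavg, integral_const_mul]

lemma outerAvg_const (c : ℝ) (w : Param r × (Fin l × Fin l → ℝ)) :
    outerAvg P r (fun _ => c) w = c := by
  simp [outerAvg, gavg]

lemma outerAvg_sum {α : Type*} (s : Finset α) {F : α → Param r × (Fin l × Fin l → ℝ) → ℝ}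
    (hF : ∀ b, Tame (F b)) (w : Param r × (Fin l × Fin l → ℝ)) :
    outerAvg P r (fun w => ∑ b ∈ s, F b w) w = ∑ b ∈ s, outerAvg P r (F b) w := by
  have h1 : gavg (noiseLaw d n) (lvlMap P r (r + 1)) (fun w => ∑ b ∈ s, F b w)
      = fun w => ∑ b ∈ s, gavg (noiseLaw d n) (lvlMap P r (r + 1)) (F b) w :=
    funext fun w => integral_finsetSum _ fun b _ =>
      (hF b).integrable_shift expMoments_noiseLaw w
  rw [outerAvg, h1]
  exact integral_finsetSum _ fun b _ =>
    ((hF b).gavg expMoments_noiseLaw).integrable_shift expMoments_matrixLaw w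

lemma outerAvg_mono (hf : Tame f) (hg : Tame g) (w : Param r × (Fin l × Fin l → ℝ))
    (h : ∀ v, f (w.1, v) ≤ g (w.1, v)) : outerAvg P r f w ≤ outerAvg P r g w := by
  refine integral_mono
    ((hf.gavg expMoments_noiseLaw).integrable_shift expMoments_matrixLaw w)
    ((hg.gavg expMoments_noiseLaw).integrable_shift expMoments_matrixLaw w) fun x => ?_
  exact integral_mono (hf.integrable_shift expMoments_noiseLaw _)
    (hg.integrable_shift expMoments_noiseLaw _) fun u => h _

/-- A quenched mean over two replicas, as one chain of tilted averages. -/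
lemma gammaF_eq_chain (k : ℕ) (F : Fin l → Fin l → Fin l → Fin l → ℝ)
    (w : Param r × (Fin l × Fin l → ℝ)) :
    gammaF P r k F w = chain P r (k + 1) (r - k) (fun w => ∑ e : Fin l × Fin l,
      ∑ e' : Fin l × Fin l, F e.1 e.2 e'.1 e'.2
        * (chain P r 1 k (gibbs P e) w * chain P r 1 k (gibbs P e') w)) w := by
  have hg : ∀ e e' : Fin l × Fin l, Tame (fun w : Param r × (Fin l × Fin l → ℝ) =>
      F e.1 e.2 e'.1 e'.2 * (chain P r 1 k (gibbs P e) w * chain P r 1 k (gibbs P e') w)) :=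
    fun e e' => ((tame_gibbs P e).chain.mul (tame_gibbs P e').chain).const_mul _
  rw [chain_sum P _ fun e => Tame.sum fun e' _ => hg e e']
  have h1 : ∀ e : Fin l × Fin l, chain P r (k + 1) (r - k) (fun w => ∑ e' : Fin l × Fin l,
      F e.1 e.2 e'.1 e'.2 * (chain P r 1 k (gibbs P e) w * chain P r 1 k (gibbs P e') w))
      = fun w => ∑ e' : Fin l × Fin l, F e.1 e.2 e'.1 e'.2 * chain P r (k + 1) (r - k) (fun w =>
        chain P r 1 k (gibbs P e) w * chain P r 1 k (gibbs P e') w) w := by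
    intro e
    rw [chain_sum P _ (hg e)]
    simp only [chain_const_mul]
  beta_reduce
  rw [Finset.sum_congr rfl fun e _ => congrFun (h1 e) w]
  simp only [Fintype.sum_prod_type, gammaF]
  simp only [mul_comm]

end ChainLinear

/-! ### Functions of a single row of the field -/

section Row

variable {l r : ℕ}

/-- Functions of the field `w.2` that depend only on its row `i`, and not on the parameter. -/
def IsRowFn (i : Fin l) (f : Param r × (Fin l × Fin l → ℝ) → ℝ) : Prop :=
  ∀ w w', (∀ j, w.2 (i, j) = w'.2 (i, j)) → f w = f w'

lemma IsRowFn.dirD_eq_zero {i : Fin l} {f : Param r × (Fin l × Fin l → ℝ) → ℝ}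
    (hr : IsRowFn i f) (hf : Tame f) {h : Param r × (Fin l × Fin l → ℝ)}
    (hh : ∀ j, h.2 (i, j) = 0) (w : Param r × (Fin l × Fin l → ℝ)) : dirD h f w = 0 := by
  rw [dirD, ← (hf.differentiable w).lineDeriv_eq_fderiv, lineDeriv]
  have : (fun t : ℝ => f (w + t • h)) = fun _ => f w :=
    funext fun t => hr _ _ fun j => by simp [hh j]
  rw [this, deriv_const]

lemma IsRowFn.dirD {i : Fin l} {f : Param r × (Fin l × Fin l → ℝ) → ℝ}
    (hr : IsRowFn i f) (hf : Tame f) (h : Param r × (Fin l × Fin l → ℝ)) :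
    IsRowFn i (dirD h f) := by
  intro w w' hw
  rw [FullyLifted.dirD, FullyLifted.dirD, ← (hf.differentiable w).lineDeriv_eq_fderiv,
    ← (hf.differentiable w').lineDeriv_eq_fderiv, lineDeriv, lineDeriv]
  congr 1
  exact funext fun t => hr _ _ fun j => by simp [hw j]

/-- The operator `diffusion` annihilates functions of one row if its matrix vanishes there. -/
lemma IsRowFn.diffusion_eq_zero {i : Fin l} {f : Param r × (Fin l × Fin l → ℝ) → ℝ}
    (hr : IsRowFn i f) (hf : Tame f) (τ : Param r) {R : Fin l × Fin l → Fin l × Fin l → ℝ}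
    (hR : ∀ e e', e.1 = e'.1 → R e e' = 0) (w : Param r × (Fin l × Fin l → ℝ)) :
    diffusion τ R f w = 0 := by
  have hne : ∀ e : Fin l × Fin l, e.1 ≠ i → ∀ j, (Pi.single e (1 : ℝ) : Fin l × Fin l → ℝ) (i, j)
      = 0 := fun e he j => Pi.single_eq_of_ne (fun h => he (by rw [← h])) _
  rw [diffusion, hr.dirD_eq_zero hf (fun _ => rfl), zero_add, Finset.sum_eq_zero, mul_zero]
  refine fun e _ => Finset.sum_eq_zero fun e' _ => ?_
  by_cases he : e.1 = i
  · by_cases he' : e'.1 = i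
    · rw [hR e e' (he.trans he'.symm), zero_mul]
    · have : dE e' f = fun _ => 0 := funext fun w =>
        hr.dirD_eq_zero (h := (0, Pi.single e' 1)) hf (hne e' he') w
      rw [this, dE, dirD_const, mul_zero]
  · have : dE e (dE e' f) w = 0 := (hr.dirD hf (0, Pi.single e' 1)).dirD_eq_zero
      (h := (0, Pi.single e 1)) (hf.dE e') (hne e he) w
    rw [this, mul_zero]

end Row

/-! ### The derivative of the interpolation in time -/

section Time

variable {n d l r : ℕ}

/-- The velocity of `paramPt` in time. -/
def velPt (p q : Fin (r + 2) → ℝ) (t : ℝ) : Param r :=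
  (fun c => match c with
    | none => 1 / (2 * √t)
    | some (k, 0) => 1 / (2 * √t) * aCoef p q k
    | some (k, 1) => -1 / (2 * √(1 - t)) * incCoef p k
    | some (k, 2) => -1 / (2 * √(1 - t)) * incCoef q k, 0)

lemma hasDerivAt_paramPt (p q m : Fin (r + 2) → ℝ) {t : ℝ} (ht : t ∈ Ioo (0 : ℝ) 1) :
    HasDerivAt (fun t => paramPt p q m t) (velPt p q t) t := by
  have h0 : HasDerivAt (fun t : ℝ => √t) (1 / (2 * √t)) t := Real.hasDerivAt_sqrt ht.1.ne'
  have h1 : HasDerivAt (fun t : ℝ => √(1 - t)) (-1 / (2 * √(1 - t))) t :=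
    ((hasDerivAt_id t).const_sub 1).sqrt (by have := ht.2; simp; linarith)
  refine HasDerivAt.prodMk (hasDerivAt_pi.2 fun c => ?_) (hasDerivAt_const _ _)
  match c with
  | none => exact h0
  | some (k, 0) => exact h0.mul_const _
  | some (k, 1) => exact h1.mul_const _
  | some (k, 2) => exact h1.mul_const _

lemma hasDerivAt_comp_paramPt {V : Type*} [NormedAddCommGroup V] [NormedSpace ℝ V]
    (p q m : Fin (r + 2) → ℝ) {t : ℝ} (ht : t ∈ Ioo (0 : ℝ) 1)
    {F : Param r × V → ℝ} (hF : Differentiable ℝ F) :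
    HasDerivAt (fun t => F (paramPt p q m t, 0))
      (dirD (velPt p q t, 0) F (paramPt p q m t, 0)) t := by
  have h1 : HasDerivAt (fun t => (paramPt p q m t, (0 : V))) (velPt p q t, 0) t :=
    (hasDerivAt_paramPt p q m ht).prodMk (hasDerivAt_const _ _)
  have h2 : HasFDerivAt F (fderiv ℝ F (paramPt p q m t, 0)) (paramPt p q m t, 0) :=
    (hF _).hasFDerivAt
  exact h2.comp_hasDerivAt t h1

lemma dirD_param {Θ V : Type*} [NormedAddCommGroup Θ] [NormedSpace ℝ Θ] [NormedAddCommGroup V]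
    [NormedSpace ℝ V] (η : Θ →L[ℝ] ℝ) (h w : Θ × V) :
    dirD h (fun w : Θ × V => η w.1) w = η h.1 := by
  have h1 : HasFDerivAt (fun w : Θ × V => η w.1) (η.comp (ContinuousLinearMap.fst ℝ Θ V)) w :=
    ContinuousLinearMap.hasFDerivAt (η.comp (ContinuousLinearMap.fst ℝ Θ V)) (x := w)
  rw [dirD, h1.fderiv]; rfl

lemma expo_velPt (p q : Fin (r + 2) → ℝ) (t : ℝ) (k : ℕ) : expo r k (velPt p q t) = 0 := rfl

/-- The product of the deviations of the two overlaps at level `k`. -/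
def devCov (P : BilinearModel n d l) (p q : Fin (r + 2) → ℝ) (k : ℕ)
    (e e' : Fin l × Fin l) : ℝ :=
  xDev P (entry p k) e.1 e'.1 * yDev P (entry q k) e.2 e'.2

variable (P : BilinearModel n d l) {p q : Fin (r + 2) → ℝ}

/-- The matrices `devCov` absorb the speeds of the covariances: from one level to the next they
differ by the time derivative of the covariance of the noise of that level. -/
lemma devCov_step (hp : p ∈ overlapVectors r) (hq : q ∈ overlapVectors r)
    (m : Fin (r + 2) → ℝ) {t : ℝ} (ht : t ∈ Ioo (0 : ℝ) 1) {k : ℕ} (hk : k + 1 ≤ r + 1)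
    (e e' : Fin l × Fin l) :
    devCov P p q k e e' = devCov P p q (k + 1) e e'
      + ∑ κ, 2 * (sdev r (k + 1) κ (velPt p q t) * sdev r (k + 1) κ (paramPt p q m t))
        * lvlCov P κ e e' := by
  have hv := val_ofNat (r := r) hk
  have e0 : sdev r (k + 1) 0 (velPt p q t) = 1 / (2 * √t) * aCoef p q (k + 1) := by
    change _ * aCoef p q ((Fin.ofNat (r + 2) (k + 1) : Fin (r + 2)) : ℕ) = _; rw [hv]
  have e1 : sdev r (k + 1) 1 (velPt p q t) = -1 / (2 * √(1 - t)) * incCoef p (k + 1) := by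
    change _ * incCoef p ((Fin.ofNat (r + 2) (k + 1) : Fin (r + 2)) : ℕ) = _; rw [hv]
  have e2 : sdev r (k + 1) 2 (velPt p q t) = -1 / (2 * √(1 - t)) * incCoef q (k + 1) := by
    change _ * incCoef q ((Fin.ofNat (r + 2) (k + 1) : Fin (r + 2)) : ℕ) = _; rw [hv]
  have ha : aCoef p q (k + 1) ^ 2
      = entry p k * entry q k - entry p (k + 1) * entry q (k + 1) :=
    Real.sq_sqrt (sub_nonneg.2 (entry_mul_antitone hp hq (k + 1)))
  have hb : incCoef p (k + 1) ^ 2 = entry p k - entry p (k + 1) :=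
    Real.sq_sqrt (sub_nonneg.2 (entry_antitone hp (k + 1)))
  have hc : incCoef q (k + 1) ^ 2 = entry q k - entry q (k + 1) :=
    Real.sq_sqrt (sub_nonneg.2 (entry_antitone hq (k + 1)))
  have hs0 : √t ≠ 0 := (Real.sqrt_pos.2 ht.1).ne'
  have hs1 : √(1 - t) ≠ 0 := (Real.sqrt_pos.2 (by have := ht.2; linarith)).ne'
  rw [Fin.sum_univ_three, e0, e1, e2, sdev_zero_paramPt _ _ _ _ hk, sdev_one_paramPt _ _ _ _ hk,
    sdev_two_paramPt _ _ _ _ hk]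
  have f0 : 2 * (1 / (2 * √t) * aCoef p q (k + 1) * (√t * aCoef p q (k + 1)))
      = aCoef p q (k + 1) ^ 2 := by field_simp
  have f1 : ∀ z : ℝ, 2 * (-1 / (2 * √(1 - t)) * z * (√(1 - t) * z)) = -z ^ 2 := by
    intro z; field_simp
  rw [f0, f1, f1, ha, hb, hc]
  simp only [devCov, xDev, yDev, lvlCov]
  ring

lemma devCov_last (hp : p ∈ overlapVectors r) (hq : q ∈ overlapVectors r)
    (m : Fin (r + 2) → ℝ) {t : ℝ} (ht : t ∈ Ioo (0 : ℝ) 1) (e e' : Fin l × Fin l) :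
    devCov P p q (r + 1) e e' = 0
      + ∑ _κ : Unit, 2 * (sdevG r (velPt p q t) * sdevG r (paramPt p q m t)) * matCov P e e' := by
  have hs0 : √t ≠ 0 := (Real.sqrt_pos.2 ht.1).ne'
  have e0 : sdevG r (velPt p q t) = 1 / (2 * √t) := rfl
  have f0 : 2 * (1 / (2 * √t) * √t) = 1 := by field_simp
  rw [Finset.univ_unique, Finset.sum_singleton, e0, sdevG_paramPt, f0]
  simp only [devCov, xDev, yDev, entry_last hp, entry_last hq, matCov]
  ring

lemma devCov_zero (hp : p ∈ overlapVectors r) (e e' : Fin l × Fin l) (h : e.1 = e'.1) :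
    devCov P p q 0 e e' = 0 := by
  rw [devCov, xDev, entry_zero_eq hp, h, real_inner_self_eq_norm_mul_norm]; ring

/-- The time derivative of an average over the noises that survive the inner averages. -/
lemma hasDerivAt_outerAvg (hp : p ∈ overlapVectors r) (hq : q ∈ overlapVectors r)
    (m : Fin (r + 2) → ℝ) {t : ℝ} (ht : t ∈ Ioo (0 : ℝ) 1)
    {f : Param r × (Fin l × Fin l → ℝ) → ℝ} (hf : Tame f) :
    HasDerivAt (fun t => outerAvg P r f (paramPt p q m t, 0))
      (outerAvg P r (diffusion (velPt p q t) (devCov P p q r) f) (paramPt p q m t, 0)) t := by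
  refine (hasDerivAt_comp_paramPt p q m ht (hf.outerAvg (P := P)).differentiable).congr_deriv ?_
  have h3 : dirD (velPt p q t, 0) (outerAvg P r f) (paramPt p q m t, 0)
      = diffusion (velPt p q t) (fun _ _ => 0) (outerAvg P r f) (paramPt p q m t, 0) := by
    simp [diffusion]
  have h4 := diffusion_gavg expMoments_matrixLaw (isGaussianField_matField P)
    (hf.gavg (B := lvlMap P r (r + 1)) expMoments_noiseLaw) (velPt p q t) (R := fun _ _ => 0)
    (η := fun _ => sdevG r)
    (R' := devCov P p q (r + 1)) (paramPt p q m t, 0) (fun e e' => devCov_last P hp hq m ht e e')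
  have h5 : ∀ v, diffusion (velPt p q t) (devCov P p q (r + 1))
      (gavg (noiseLaw d n) (lvlMap P r (r + 1)) f) (paramPt p q m t, v)
      = gavg (noiseLaw d n) (lvlMap P r (r + 1))
        (diffusion (velPt p q t) (devCov P p q r) f) (paramPt p q m t, v) := fun v =>
    diffusion_gavg expMoments_noiseLaw (isGaussianField_lvlField P) hf _ _
      fun e e' => devCov_step P hp hq m ht le_rfl e e'
  exact h3.trans (h4.trans (gavg_congr _ h5))

/-! #### The field derivatives of the log-averages -/

variable [NeZero l]

lemma dE_param_mul {f : Param r × (Fin l × Fin l → ℝ) → ℝ} (hf : Tame f) (k : ℕ)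
    (e : Fin l × Fin l) (w : Param r × (Fin l × Fin l → ℝ)) :
    dE e (fun w => expo r k w.1 * f w) w = expo r k w.1 * dE e f w := by
  rw [dE_mul (tame_param (expo r k)) hf]
  have : dE e (fun w : Param r × (Fin l × Fin l → ℝ) => expo r k w.1) w = 0 :=
    (dirD_param (expo r k) _ w).trans (map_zero _)
  simp [this]

lemma carre_param_mul {f : Param r × (Fin l × Fin l → ℝ) → ℝ} (hf : Tame f)
    (R : Fin l × Fin l → Fin l × Fin l → ℝ) (g : Param r × (Fin l × Fin l → ℝ) → ℝ) (k : ℕ)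
    (w : Param r × (Fin l × Fin l → ℝ)) :
    carre R (fun w => expo r k w.1 * f w) g w = expo r k w.1 * carre R f g w := by
  simp only [carre, dE_param_mul hf, Finset.mul_sum]
  exact Finset.sum_congr rfl fun e _ => Finset.sum_congr rfl fun e' _ => by ring

lemma carre_comm {Θ E : Type*} [NormedAddCommGroup Θ] [NormedSpace ℝ Θ] [Fintype E]
    [DecidableEq E] (R : E → E → ℝ) (f g : Θ × (E → ℝ) → ℝ) (w : Θ × (E → ℝ)) :
    carre R f g w = carre R g f w := by
  simp only [carre]
  congr 1
  exact Finset.sum_congr rfl fun e _ => Finset.sum_congr rfl fun e' _ => by ring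

lemma diffusion_param_mul {f : Param r × (Fin l × Fin l → ℝ) → ℝ} (hf : Tame f) {τ : Param r}
    {k : ℕ} (hτ : expo r k τ = 0) (R : Fin l × Fin l → Fin l × Fin l → ℝ)
    (w : Param r × (Fin l × Fin l → ℝ)) :
    diffusion τ R (fun w => expo r k w.1 * f w) w = expo r k w.1 * diffusion τ R f w := by
  have h1 : ∀ e, dE e (fun w => expo r k w.1 * f w) = fun w => expo r k w.1 * dE e f w :=
    fun e => funext fun w => dE_param_mul hf k e w
  have h2 : dirD (τ, 0) (fun w : Param r × (Fin l × Fin l → ℝ) => expo r k w.1) w = 0 :=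
    (dirD_param (expo r k) _ w).trans hτ
  rw [diffusion, dirD_mul (tame_param (expo r k)).differentiable hf.differentiable]
  beta_reduce
  rw [h2]
  simp only [h1, dE_param_mul (hf.dE _), diffusion, Finset.mul_sum, mul_add]
  congr 1
  · ring
  · exact Finset.sum_congr rfl fun e _ => Finset.sum_congr rfl fun e' _ => by ring

lemma dE_logC (i : Fin l) (e : Fin l × Fin l) (w : Param r × (Fin l × Fin l → ℝ)) :
    dE e (logC P i) w
      = if i = e.1 then P.β * Real.exp (P.β * w.2 e - logC P i w) else 0 := by
  rw [dE]
  unfold logC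
  rw [dirD_log_sum_exp fun j => (tame_coord P.β (i, j)).differentiable]
  simp only [dirD_coord]
  split_ifs with h
  · subst h
    rw [Finset.sum_eq_single e.2]
    · simp; ring
    · intro j _ hj
      rw [Pi.single_eq_of_ne (fun h => hj (by rw [← h]))]; ring
    · simp
  · refine Finset.sum_eq_zero fun j _ => ?_
    rw [Pi.single_eq_of_ne (fun h' => h (by rw [← h']))]; ring

lemma dirD_const_mul {V : Type*} [NormedAddCommGroup V] [NormedSpace ℝ V]
    {f : Param r × V → ℝ} (hf : Differentiable ℝ f) (c : ℝ)
    (h w : Param r × V) : dirD h (fun w => c * f w) w = c * dirD h f w := by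
  rw [dirD, fderiv_const_mul (hf w)]; rfl

lemma dE_logZ (e : Fin l × Fin l) (w : Param r × (Fin l × Fin l → ℝ)) :
    dE e (logZ P) w = P.s * P.β * gibbs P e w := by
  have h1 : ∀ i, dE e (fun w : Param r × (Fin l × Fin l → ℝ) => P.s * logC P i w) w
      = P.s * dE e (logC P i) w := fun i => dirD_const_mul (tame_logC P i).differentiable _ _ _
  rw [dE]
  unfold logZ
  rw [dirD_log_sum_exp fun i => ((tame_logC P i).const_mul P.s).differentiable]
  change ∑ i, _ * dE e _ w = _
  simp only [h1, dE_logC]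
  rw [Finset.sum_eq_single e.1]
  · simp only [if_true, gibbs, logZ]; ring
  · intro i _ hi; simp [hi]
  · simp

/-- The field derivatives of `log ζ_k` are the averaged Gibbs weights. -/
lemma dE_pot (p q : Fin (r + 2) → ℝ) {m : Fin (r + 2) → ℝ} (hm : m ∈ liftVectors r) (t : ℝ)
    {k : ℕ} (hk : k ≤ r + 1) (e : Fin l × Fin l) (v : Fin l × Fin l → ℝ) :
    dE e (pot P r k) (paramPt p q m t, v)
      = entry m k * (P.s * P.β) * chain P r 1 k (gibbs P e) (paramPt p q m t, v) := by
  induction k generalizing v with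
  | zero =>
    have : entry m 0 = 1 := hm.1
    rw [this, one_mul]
    exact dE_logZ P e _
  | succ k ih =>
    have h1 := dE_logAvg (B := lvlMap P r (k + 1)) expMoments_noiseLaw
      (tame_tiltPot (r := r) P (k + 1)) (locLin_tiltPot P (k + 1)) e (paramPt p q m t, v)
    have h2 : ∀ v, dE e (tiltPot P r (k + 1)) (paramPt p q m t, v)
        = entry m (k + 1) * (P.s * P.β) * chain P r 1 k (gibbs P e) (paramPt p q m t, v) := by
      intro v
      have h3 := dE_param_mul (tame_pot (r := r) P k) (k + 1) e (paramPt p q m t, v)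
      rw [ih (by omega)] at h3
      refine h3.trans ?_
      rw [expo_paramPt _ _ _ _ hk, Nat.add_sub_cancel]
      have := lift_entry_ne hm (k := k) (by omega)
      field_simp
    rw [tilt_congr (g := fun w => entry m (k + 1) * (P.s * P.β) * chain P r 1 k (gibbs P e) w)
      _ h2, tilt_const_mul] at h1
    rw [chain, add_comm 1 k]
    exact h1

lemma dE_tiltPot (p q : Fin (r + 2) → ℝ) {m : Fin (r + 2) → ℝ} (hm : m ∈ liftVectors r) (t : ℝ)
    {k : ℕ} (hk : k + 1 ≤ r + 1) (e : Fin l × Fin l) (v : Fin l × Fin l → ℝ) :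
    dE e (tiltPot P r (k + 1)) (paramPt p q m t, v)
      = entry m (k + 1) * (P.s * P.β) * chain P r 1 k (gibbs P e) (paramPt p q m t, v) := by
  have h3 := dE_param_mul (tame_pot (r := r) P k) (k + 1) e (paramPt p q m t, v)
  rw [dE_pot P p q hm t (by omega)] at h3
  refine h3.trans ?_
  rw [expo_paramPt _ _ _ _ hk, Nat.add_sub_cancel]
  have := lift_entry_ne hm (k := k) (by omega)
  field_simp

/-- The Gaussian generator applied to `ζ_k`, relative to `ζ_k`. -/
def potRate (P : BilinearModel n d l) (p q : Fin (r + 2) → ℝ) (t : ℝ) (k : ℕ)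
    (w : Param r × (Fin l × Fin l → ℝ)) : ℝ :=
  diffusion (velPt p q t) (devCov P p q k) (pot P r k) w
    + 1 / 2 * carre (devCov P p q k) (pot P r k) (pot P r k) w

/-- The mean of `devCov` under two replicas of the weights averaged over `k` levels. -/
def devMean (P : BilinearModel n d l) (p q : Fin (r + 2) → ℝ) (k : ℕ)
    (w : Param r × (Fin l × Fin l → ℝ)) : ℝ :=
  ∑ e, ∑ e', devCov P p q k e e' * (chain P r 1 k (gibbs P e) w * chain P r 1 k (gibbs P e') w)

lemma tame_devMean (k : ℕ) : Tame (devMean P p q k) :=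
  Tame.sum fun e _ => Tame.sum fun e' _ =>
    ((tame_gibbs P e).chain.mul (tame_gibbs P e').chain).const_mul _

lemma carre_pot {m : Fin (r + 2) → ℝ} (hm : m ∈ liftVectors r) (t : ℝ)
    {k : ℕ} (hk : k ≤ r + 1) (v : Fin l × Fin l → ℝ) :
    carre (devCov P p q k) (pot P r k) (pot P r k) (paramPt p q m t, v)
      = (entry m k * (P.s * P.β)) ^ 2 * devMean P p q k (paramPt p q m t, v) := by
  rw [carre_self, devMean, Finset.mul_sum]
  simp only [dE_pot P p q hm t hk, Finset.mul_sum]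
  exact Finset.sum_congr rfl fun e _ => Finset.sum_congr rfl fun e' _ => by ring

lemma isRowFn_logC (i : Fin l) : IsRowFn (r := r) i (logC P i) := fun w w' h => by
  simp only [logC, h]

lemma diffusion_sum {Θ E α : Type*} [NormedAddCommGroup Θ] [NormedSpace ℝ Θ] [Fintype E]
    [DecidableEq E] (s : Finset α) {F : α → Θ × (E → ℝ) → ℝ} (hF : ∀ a, Tame (F a)) (τ : Θ)
    (R : E → E → ℝ) (w : Θ × (E → ℝ)) :
    diffusion τ R (fun w => ∑ a ∈ s, F a w) w = ∑ a ∈ s, diffusion τ R (F a) w := by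
  have hd : ∀ {G : α → Θ × (E → ℝ) → ℝ}, (∀ a, Tame (G a)) → ∀ h,
      dirD h (fun w => ∑ a ∈ s, G a w) = fun w => ∑ a ∈ s, dirD h (G a) w := by
    intro G hG h
    funext w
    simp only [dirD]
    rw [fderiv_fun_sum fun a _ => (hG a).differentiable w, sum_apply]
  simp only [diffusion, dE, hd hF, hd fun a => (hF a).dirD _, Finset.sum_add_distrib,
    ← Finset.mul_sum]
  congr 2
  simp only [Finset.mul_sum]
  symm
  rw [Finset.sum_comm]
  refine Finset.sum_congr rfl fun e _ => ?_
  rw [Finset.sum_comm]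

/-- `exp (log Z)` is a sum of functions of single rows, so it is annihilated by the generator of
level `0`, whose matrix vanishes on pairs of indices in the same row. -/
lemma potRate_zero (hp : p ∈ overlapVectors r) (t : ℝ) (w : Param r × (Fin l × Fin l → ℝ)) :
    potRate P p q t 0 w = 0 := by
  have h1 := diffusion_exp (tame_logZ (r := r) P) (locLin_logZ P) (velPt p q t)
    (devCov P p q 0) w
  have h2 : (fun w : Param r × (Fin l × Fin l → ℝ) => Real.exp (logZ P w))
      = fun w => ∑ i, Real.exp (P.s * logC P i w) :=
    funext fun w => Real.exp_log (sum_exp_pos _)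
  have ht : ∀ i, Tame fun w : Param r × (Fin l × Fin l → ℝ) => Real.exp (P.s * logC P i w) :=
    fun i => ((tame_logC P i).const_mul P.s).exp ((locLin_logC P i).const_mul P.s)
  rw [h2, diffusion_sum _ ht, Finset.sum_eq_zero fun i _ => ?_] at h1
  · exact ((mul_eq_zero.1 h1.symm).resolve_left (Real.exp_pos _).ne')
  · exact IsRowFn.diffusion_eq_zero (i := i) (fun w w' h => by
      simp only [isRowFn_logC P i w w' h]) (ht i) _ (devCov_zero P hp) w

lemma PhiF_index {k k' : ℕ} (h : k = k') (f : Param r × (Fin l × Fin l → ℝ) → ℝ) :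
    PhiF P r k f = PhiF P r k' f := by rw [h]

lemma chain_succ_sub {j k : ℕ} (h : j ≤ k) (f : Param r × (Fin l × Fin l → ℝ) → ℝ) :
    chain P r (j + 1) (k + 1 - j) f = PhiF P r (k + 1) (chain P r (j + 1) (k - j) f) := by
  have h1 : k + 1 - j = (k - j) + 1 := by omega
  rw [h1, chain]
  exact PhiF_index P (by omega) _

/-- The Gaussian generator applied to the tilting density of level `k + 1`, relative to that
density. -/
def tiltRate (P : BilinearModel n d l) (p q : Fin (r + 2) → ℝ) (t : ℝ) (k : ℕ)
    (w : Param r × (Fin l × Fin l → ℝ)) : ℝ :=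
  diffusion (velPt p q t) (devCov P p q k) (tiltPot P r (k + 1)) w
    + 1 / 2 * carre (devCov P p q k) (tiltPot P r (k + 1)) (tiltPot P r (k + 1)) w

lemma tiltRate_eq_of_potRate {m : Fin (r + 2) → ℝ} (hm : m ∈ liftVectors r) {t : ℝ}
    {k : ℕ} (hk : k + 1 ≤ r + 1) (v : Fin l × Fin l → ℝ)
    (h : potRate P p q t k (paramPt p q m t, v)
      = -(1 / 2 * entry m k * (P.s * P.β) ^ 2) * ∑ j ∈ Finset.range k,
        (entry m j - entry m (j + 1))
          * chain P r (j + 1) (k - j) (devMean P p q j) (paramPt p q m t, v)) :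
    tiltRate P p q t k (paramPt p q m t, v)
      = -(1 / 2 * entry m (k + 1) * (P.s * P.β) ^ 2) * ∑ j ∈ Finset.range (k + 1),
        (entry m j - entry m (j + 1))
          * chain P r (j + 1) (k - j) (devMean P p q j) (paramPt p q m t, v) := by
  have hmk := lift_entry_ne hm (k := k) (by omega)
  have e1 := diffusion_param_mul (tame_pot (r := r) P k) (expo_velPt p q t (k + 1))
    (devCov P p q k) (paramPt p q m t, v)
  have e2 := carre_param_mul (tame_pot (r := r) P k) (devCov P p q k)
    (tiltPot P r (k + 1)) (k + 1) (paramPt p q m t, v)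
  have e3 := carre_param_mul (tame_pot (r := r) P k) (devCov P p q k)
    (pot P r k) (k + 1) (paramPt p q m t, v)
  rw [carre_comm] at e2
  have e4 : carre (devCov P p q k) (tiltPot P r (k + 1)) (tiltPot P r (k + 1))
      (paramPt p q m t, v) = expo r (k + 1) (paramPt p q m t) ^ 2
        * carre (devCov P p q k) (pot P r k) (pot P r k) (paramPt p q m t, v) := by
    rw [carre_comm] at e2
    refine e2.trans ?_
    rw [carre_comm]
    refine (congrArg _ e3).trans ?_
    ring
  rw [potRate, carre_pot P hm t (by omega)] at h
  rw [carre_pot P hm t (by omega), expo_paramPt _ _ _ _ hk, Nat.add_sub_cancel] at e4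
  rw [tiltRate, e4]
  change diffusion _ _ (fun w => expo r (k + 1) w.1 * pot P r k w) _ + _ = _
  rw [e1, eq_sub_of_add_eq h, expo_paramPt _ _ _ _ hk, Nat.add_sub_cancel,
    Finset.sum_range_succ, Nat.sub_self, chain]
  field_simp
  ring

lemma potRate_eq (hp : p ∈ overlapVectors r) (hq : q ∈ overlapVectors r)
    {m : Fin (r + 2) → ℝ} (hm : m ∈ liftVectors r) {t : ℝ} (ht : t ∈ Ioo (0 : ℝ) 1)
    {k : ℕ} (hk : k ≤ r + 1) (v : Fin l × Fin l → ℝ) :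
    potRate P p q t k (paramPt p q m t, v)
      = -(1 / 2 * entry m k * (P.s * P.β) ^ 2) * ∑ j ∈ Finset.range k,
        (entry m j - entry m (j + 1))
          * chain P r (j + 1) (k - j) (devMean P p q j) (paramPt p q m t, v) := by
  induction k generalizing v with
  | zero => rw [potRate_zero P hp]; simp
  | succ k ih =>
    have h1 := diffusion_logAvg (R := devCov P p q (k + 1)) (R' := devCov P p q k)
      expMoments_noiseLaw (isGaussianField_lvlField P)
      (tame_tiltPot (r := r) P (k + 1)) (locLin_tiltPot P (k + 1)) (velPt p q t)
      (paramPt p q m t, v) (fun e e' => devCov_step P hp hq m ht hk e e')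
    have h2 := fun v => tiltRate_eq_of_potRate P hm hk v (ih (by omega) v)
    have hT : ∀ j : ℕ, Tame (fun w : Param r × (Fin l × Fin l → ℝ) =>
        (entry m j - entry m (j + 1)) * chain P r (j + 1) (k - j) (devMean P p q j) w) :=
      fun j => ((tame_devMean P j).chain).const_mul _
    change _ = tilt _ _ _ (tiltRate P p q t k) _ at h1
    rw [tilt_congr (g := fun w => -(1 / 2 * entry m (k + 1) * (P.s * P.β) ^ 2) *
      ∑ j ∈ Finset.range (k + 1), (entry m j - entry m (j + 1))
        * chain P r (j + 1) (k - j) (devMean P p q j) w) _ h2, tilt_const_mul,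
      tilt_sum expMoments_noiseLaw
      (tame_tiltPot (r := r) P (k + 1)) (locLin_tiltPot P (k + 1)) _ fun j _ => hT j] at h1
    refine h1.trans ?_
    congr 1
    refine Finset.sum_congr rfl fun j hj => ?_
    rw [tilt_const_mul, chain_succ_sub P (by have := Finset.mem_range.1 hj; omega)]
    rfl

/-- The time derivative of `ψ` is a combination of the `φ_k`. -/
lemma hasDerivAt_psi (hp : p ∈ overlapVectors r) (hq : q ∈ overlapVectors r)
    {m : Fin (r + 2) → ℝ} (hm : m ∈ liftVectors r) {t : ℝ} (ht : t ∈ Ioo (0 : ℝ) 1)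
    (hβ : 0 < P.β) (hs : P.s ≠ 0) :
    HasDerivAt (fun t => psi P p q m t)
      (Real.sign P.s * P.β / (2 * √(n : ℝ)) *
        ∑ k ∈ Finset.range (r + 1), phi P p q m t (k + 1)) t := by
  simp only [psi_eq_outerAvg P p q m]
  have h1 := (hasDerivAt_outerAvg P hp hq m ht (tame_pot P r)).const_mul
    (1 / (P.β * |P.s| * √(n : ℝ) * entry m r))
  refine h1.congr_deriv ?_
  have hmr := lift_entry_ne hm (k := r) le_rfl
  have hml : entry m (r + 1) = 0 := by rw [entry, dif_pos (by omega)]; exact hm.2.1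
  have h2 : ∀ v, diffusion (velPt p q t) (devCov P p q r) (pot P r r) (paramPt p q m t, v)
      = -(1 / 2 * entry m r * (P.s * P.β) ^ 2) * ∑ j ∈ Finset.range (r + 1),
        (entry m j - entry m (j + 1))
          * chain P r (j + 1) (r - j) (devMean P p q j) (paramPt p q m t, v) := by
    intro v
    have e5 := potRate_eq P hp hq hm ht (show r ≤ r + 1 by omega) v
    rw [potRate, carre_pot P hm t (by omega)] at e5
    rw [eq_sub_of_add_eq e5, Finset.sum_range_succ, Nat.sub_self, chain, hml]
    ring
  have hT : ∀ j : ℕ, Tame (fun w : Param r × (Fin l × Fin l → ℝ) =>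
        (entry m j - entry m (j + 1)) * chain P r (j + 1) (r - j) (devMean P p q j) w) :=
      fun j => ((tame_devMean P j).chain).const_mul _
  rw [outerAvg_congr (g := fun w => -(1 / 2 * entry m r * (P.s * P.β) ^ 2) *
      ∑ j ∈ Finset.range (r + 1), (entry m j - entry m (j + 1))
        * chain P r (j + 1) (r - j) (devMean P p q j) w) P _ h2, outerAvg_const_mul, outerAvg_sum P _ hT, Finset.mul_sum,
    Finset.mul_sum, Finset.mul_sum]
  refine Finset.sum_congr rfl fun j hj => ?_
  have hj' : j ≤ r := by have := Finset.mem_range.1 hj; omega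
  rw [outerAvg_const_mul, phi, Nat.add_sub_cancel, gammaMean_eq_outerAvg P p q m t hj']
  have h3 : outerAvg P r (gammaF P r j fun i₁ i₂ p₁ p₂ =>
        xDev P (entry p j) i₁ p₁ * yDev P (entry q j) i₂ p₂) (paramPt p q m t, 0)
      = outerAvg P r (chain P r (j + 1) (r - j) (devMean P p q j)) (paramPt p q m t, 0) :=
    outerAvg_congr P _ fun v => gammaF_eq_chain P j _ _
  rw [h3]
  set X := outerAvg P r (chain P r (j + 1) (r - j) (devMean P p q j)) (paramPt p q m t, 0)
  have hss : Real.sign P.s * P.s = |P.s| := by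
    rcases lt_or_gt_of_ne hs with h | h
    · rw [Real.sign_of_neg h, abs_of_neg h]; ring
    · rw [Real.sign_of_pos h, abs_of_pos h]; ring
  have habs : |P.s| ≠ 0 := abs_ne_zero.2 hs
  have hsq : P.s ^ 2 = |P.s| ^ 2 := (sq_abs _).symm
  have hβ' := hβ.ne'
  have e1 : Real.sign P.s * P.β / (2 * √(n : ℝ)) * (-P.s * (entry m j - entry m (j + 1)) * X)
      = -(|P.s| * P.β / (2 * √(n : ℝ)) * ((entry m j - entry m (j + 1)) * X)) := by
    rw [← hss]; ring
  rw [e1, mul_pow, hsq]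
  rcases eq_or_ne (√(n : ℝ)) 0 with h0 | h0
  · simp [h0]
  · field_simp

end Time

/-! ### Bounds for the means of two replicas -/

section Means

variable {n d l r : ℕ} [NeZero l] (P : BilinearModel n d l)

lemma gibbs_pos (e : Fin l × Fin l) (w : Param r × (Fin l × Fin l → ℝ)) : 0 < gibbs P e w :=
  mul_pos (Real.exp_pos _) (Real.exp_pos _)

lemma sum_exp_sub_log {α : Type*} [Fintype α] [Nonempty α] (g : α → ℝ) :
    ∑ a, Real.exp (g a - Real.log (∑ a, Real.exp (g a))) = 1 := by
  simp only [Real.exp_sub, Real.exp_log (sum_exp_pos g), ← Finset.sum_div]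
  exact div_self (sum_exp_pos g).ne'

lemma sum_gibbs (w : Param r × (Fin l × Fin l → ℝ)) : ∑ e, gibbs P e w = 1 := by
  rw [Fintype.sum_prod_type]
  simp only [gibbs, ← Finset.mul_sum]
  have h1 : ∀ i, ∑ j, Real.exp (P.β * w.2 (i, j) - logC P i w) = 1 := fun i =>
    sum_exp_sub_log fun j => P.β * w.2 (i, j)
  simp only [h1, mul_one]
  exact sum_exp_sub_log fun i => P.s * logC P i w

lemma chain_gibbs_nonneg (a j : ℕ) (e : Fin l × Fin l) (w : Param r × (Fin l × Fin l → ℝ)) :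
    0 ≤ chain P r a j (gibbs P e) w := by
  have h := chain_mono P (tame_const 0) (tame_gibbs P e) a j w fun v => (gibbs_pos P e _).le
  rwa [chain_const] at h

lemma sum_chain_gibbs (a j : ℕ) (w : Param r × (Fin l × Fin l → ℝ)) :
    ∑ e, chain P r a j (gibbs P e) w = 1 := by
  have h := congrFun (chain_sum (r := r) P Finset.univ (tame_gibbs P) a j) w
  rw [← h]
  simp only [sum_gibbs, chain_const]

lemma gammaF_mono (k : ℕ) {F F' : Fin l → Fin l → Fin l → Fin l → ℝ}
    (h : ∀ i j i' j', F i j i' j' ≤ F' i j i' j') (w : Param r × (Fin l × Fin l → ℝ)) :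
    gammaF P r k F w ≤ gammaF P r k F' w := by
  refine Finset.sum_le_sum fun i _ => Finset.sum_le_sum fun j _ => Finset.sum_le_sum fun i' _ =>
    Finset.sum_le_sum fun j' _ => mul_le_mul_of_nonneg_left (h i j i' j') ?_
  have h1 := chain_mono P (tame_const 0)
    ((tame_gibbs P (i, j)).chain.mul (tame_gibbs P (i', j')).chain) (k + 1) (r - k) w fun v =>
      mul_nonneg (chain_gibbs_nonneg P 1 k _ _) (chain_gibbs_nonneg P 1 k _ _)
  rwa [chain_const] at h1

lemma gammaF_const (k : ℕ) (c : ℝ) (w : Param r × (Fin l × Fin l → ℝ)) :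
    gammaF P r k (fun _ _ _ _ => c) w = c := by
  rw [gammaF_eq_chain]
  have h : (fun w : Param r × (Fin l × Fin l → ℝ) => ∑ e : Fin l × Fin l,
      ∑ e' : Fin l × Fin l, c * (chain P r 1 k (gibbs P e) w * chain P r 1 k (gibbs P e') w))
      = fun _ => c := by
    funext w
    simp only [← Finset.mul_sum, sum_chain_gibbs, mul_one]
  rw [h, chain_const]

variable (p q m : Fin (r + 2) → ℝ) (t : ℝ)

lemma gammaMean_mono {k : ℕ} (hk : k ≤ r) {F F' : Fin l → Fin l → Fin l → Fin l → ℝ}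
    (h : ∀ i j i' j', F i j i' j' ≤ F' i j i' j') :
    gammaMean P p q m t (k + 1) F ≤ gammaMean P p q m t (k + 1) F' := by
  rw [gammaMean_eq_outerAvg P _ _ _ _ hk, gammaMean_eq_outerAvg P _ _ _ _ hk]
  exact outerAvg_mono P (tame_gammaF P k F) (tame_gammaF P k F') _ fun v => gammaF_mono P k h _

lemma gammaMean_const {k : ℕ} (hk : k ≤ r) (c : ℝ) :
    gammaMean P p q m t (k + 1) (fun _ _ _ _ => c) = c := by
  rw [gammaMean_eq_outerAvg P _ _ _ _ hk]
  exact (outerAvg_congr P _ fun v => gammaF_const P k c _).trans (outerAvg_const P c _)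

lemma abs_gammaMean_le {k : ℕ} (hk : k ≤ r) {F : Fin l → Fin l → Fin l → Fin l → ℝ} {c : ℝ}
    (h : ∀ i j i' j', |F i j i' j'| ≤ c) : |gammaMean P p q m t (k + 1) F| ≤ c := by
  rw [abs_le, ← gammaMean_const P p q m t hk c, ← gammaMean_const P p q m t hk (-_)]
  simp only [gammaMean_const P p q m t hk c]
  exact ⟨gammaMean_mono P p q m t hk fun i j i' j' => (abs_le.1 (h i j i' j')).1,
    (gammaMean_mono P p q m t hk fun i j i' j' => (abs_le.1 (h i j i' j')).2).trans_eq
      (gammaMean_const P p q m t hk c)⟩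

lemma gammaMean_add {k : ℕ} (hk : k ≤ r) (F F' : Fin l → Fin l → Fin l → Fin l → ℝ) :
    gammaMean P p q m t (k + 1) (fun i j i' j' => F i j i' j' + F' i j i' j')
      = gammaMean P p q m t (k + 1) F + gammaMean P p q m t (k + 1) F' := by
  simp only [gammaMean_eq_outerAvg P _ _ _ _ hk]
  have h := outerAvg_sum P Finset.univ (F := fun b : Bool => gammaF P r k (if b then F else F'))
    (fun b => tame_gammaF P k _) (paramPt p q m t, 0)
  simp only [Fintype.univ_bool, Finset.mem_singleton, Bool.true_eq_false, not_false_eq_true,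
    Finset.sum_insert, Finset.sum_singleton, if_true, Bool.false_eq_true, if_false] at h
  rw [← h]
  congr 1
  funext w
  simp only [gammaF, mul_add, Finset.sum_add_distrib]

lemma gammaMean_const_mul {k : ℕ} (hk : k ≤ r) (c : ℝ)
    (F : Fin l → Fin l → Fin l → Fin l → ℝ) :
    gammaMean P p q m t (k + 1) (fun i j i' j' => c * F i j i' j')
      = c * gammaMean P p q m t (k + 1) F := by
  simp only [gammaMean_eq_outerAvg P _ _ _ _ hk]
  rw [← outerAvg_const_mul]
  congr 1
  funext w
  simp only [gammaF, Finset.mul_sum]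
  refine Finset.sum_congr rfl fun i _ => Finset.sum_congr rfl fun j _ =>
    Finset.sum_congr rfl fun i' _ => Finset.sum_congr rfl fun j' _ => by ring

/-- The mean of a product of deviations is controlled by the overlap variances. -/
lemma abs_gammaMean_dev_le {k : ℕ} (hk : k ≤ r) :
    |gammaMean P p q m t (k + 1) fun i₁ i₂ p₁ p₂ =>
        xDev P (entry p k) i₁ p₁ * yDev P (entry q k) i₂ p₂|
      ≤ 1 / 2 * (xOverlapVar P p q m t k + yOverlapVar P p q m t k) := by
  have h1 : 1 / 2 * (xOverlapVar P p q m t k + yOverlapVar P p q m t k)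
      = gammaMean P p q m t (k + 1) fun i₁ i₂ p₁ p₂ =>
        1 / 2 * (xDev P (entry p k) i₁ p₁ ^ 2 + yDev P (entry q k) i₂ p₂ ^ 2) := by
    rw [gammaMean_const_mul P p q m t hk, gammaMean_add P p q m t hk]; rfl
  have h2 : -(1 / 2 * (xOverlapVar P p q m t k + yOverlapVar P p q m t k))
      = gammaMean P p q m t (k + 1) fun i₁ i₂ p₁ p₂ =>
        -1 * (1 / 2 * (xDev P (entry p k) i₁ p₁ ^ 2 + yDev P (entry q k) i₂ p₂ ^ 2)) := by
    rw [gammaMean_const_mul P p q m t hk, ← h1]; ring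
  rw [abs_le]
  refine ⟨h2.trans_le (gammaMean_mono P p q m t hk fun i j i' j' => ?_),
    (gammaMean_mono P p q m t hk fun i j i' j' => ?_).trans_eq h1.symm⟩
  · nlinarith [sq_nonneg (xDev P (entry p k) i i' + yDev P (entry q k) j j')]
  · nlinarith [sq_nonneg (xDev P (entry p k) i i' - yDev P (entry q k) j j')]

end Means

/-! ### A bound for the time derivative of the mean norms -/

section Rate

variable {n d l r : ℕ}

lemma abs_carre_le {Θ E : Type*} [NormedAddCommGroup Θ] [NormedSpace ℝ Θ] [Fintype E]
    [DecidableEq E] {R : E → E → ℝ} {f g : Θ × (E → ℝ) → ℝ} {w : Θ × (E → ℝ)} {D a b : ℝ}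
    (hD : 0 ≤ D) (hR : ∀ e e', |R e e'| ≤ D) (ha : ∑ e, |dE e f w| ≤ a)
    (hb : ∑ e, |dE e g w| ≤ b) : |carre R f g w| ≤ D * (a * b) := by
  have h1 : ∀ e e', |R e e' * (dE e f w * dE e' g w + dE e' f w * dE e g w)|
      ≤ D * (|dE e f w| * |dE e' g w| + |dE e' f w| * |dE e g w|) := by
    intro e e'
    rw [← abs_mul (dE e f w), ← abs_mul (dE e' f w), abs_mul (R e e')]
    exact mul_le_mul (hR e e') (abs_add_le _ _) (abs_nonneg _) hD
  have h2 : ∑ e, ∑ e', (|dE e f w| * |dE e' g w| + |dE e' f w| * |dE e g w|)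
      = 2 * ((∑ e, |dE e f w|) * ∑ e, |dE e g w|) := by
    simp only [Finset.sum_add_distrib, ← Finset.mul_sum, ← Finset.sum_mul]
    ring
  have h3 : |∑ e, ∑ e', R e e' * (dE e f w * dE e' g w + dE e' f w * dE e g w)|
      ≤ D * (2 * ((∑ e, |dE e f w|) * ∑ e, |dE e g w|)) := by
    rw [← h2, Finset.mul_sum]
    refine (Finset.abs_sum_le_sum_abs _ _).trans (Finset.sum_le_sum fun e _ => ?_)
    rw [Finset.mul_sum]
    exact (Finset.abs_sum_le_sum_abs _ _).trans (Finset.sum_le_sum fun e' _ => h1 e e')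
  have h4 : (∑ e, |dE e f w|) * ∑ e, |dE e g w| ≤ a * b :=
    mul_le_mul ha hb (Finset.sum_nonneg fun _ _ => abs_nonneg _)
      ((Finset.sum_nonneg fun _ _ => abs_nonneg _).trans ha)
  rw [carre, abs_mul, abs_of_pos (by norm_num : (0 : ℝ) < 1 / 2)]
  nlinarith [mul_le_mul_of_nonneg_left h4 hD]

/-- At the parameter of time `t`, the function `f`, its gradient in the `ℓ¹`-norm and its image
under the generator of level `k` are bounded by `c`. -/
def RateBdd (P : BilinearModel n d l) (p q m : Fin (r + 2) → ℝ) (t : ℝ) (k : ℕ)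
    (f : Param r × (Fin l × Fin l → ℝ) → ℝ) (c : ℝ) : Prop :=
  Tame f ∧ ∀ v, |f (paramPt p q m t, v)| ≤ c ∧ ∑ e, |dE e f (paramPt p q m t, v)| ≤ c ∧
    |diffusion (velPt p q t) (devCov P p q k) f (paramPt p q m t, v)| ≤ c

variable {P : BilinearModel n d l} {p q m : Fin (r + 2) → ℝ} {t : ℝ} {k : ℕ}
  {f : Param r × (Fin l × Fin l → ℝ) → ℝ} {c D u a : ℝ}

lemma RateBdd.sq (hf : RateBdd P p q m t k f c) (hD0 : 0 ≤ D)
    (hD : ∀ e e', |devCov P p q k e e'| ≤ D) :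
    RateBdd P p q m t k (fun w => f w * f w) ((2 + D) * c ^ 2) := by
  refine ⟨hf.1.mul hf.1, fun v => ?_⟩
  obtain ⟨h1, h2, h3⟩ := hf.2 v
  have hc : 0 ≤ c := (abs_nonneg _).trans h1
  have hDc : 0 ≤ D * c ^ 2 := by positivity
  refine ⟨?_, ?_, ?_⟩
  · rw [abs_mul]
    nlinarith [mul_le_mul h1 h1 (abs_nonneg _) hc]
  · simp only [dE_mul hf.1 hf.1]
    have : ∀ e, |f (paramPt p q m t, v) * dE e f (paramPt p q m t, v)
        + f (paramPt p q m t, v) * dE e f (paramPt p q m t, v)|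
        ≤ 2 * c * |dE e f (paramPt p q m t, v)| := by
      intro e
      rw [← two_mul, abs_mul, abs_mul, abs_two]
      nlinarith [mul_le_mul_of_nonneg_right h1 (abs_nonneg (dE e f (paramPt p q m t, v)))]
    refine (Finset.sum_le_sum fun e _ => this e).trans ?_
    rw [← Finset.mul_sum]
    nlinarith [mul_le_mul_of_nonneg_left h2 hc]
  · rw [diffusion_mul hf.1 hf.1]
    have h4 := abs_carre_le hD0 hD h2 h2
    have h5 : |f (paramPt p q m t, v)
        * diffusion (velPt p q t) (devCov P p q k) f (paramPt p q m t, v)| ≤ c * c := by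
      rw [abs_mul]; exact mul_le_mul h1 h3 (abs_nonneg _) hc
    refine (abs_add_le _ _).trans ?_
    have h6 := abs_add_le (f (paramPt p q m t, v)
        * diffusion (velPt p q t) (devCov P p q k) f (paramPt p q m t, v)) (f (paramPt p q m t, v)
        * diffusion (velPt p q t) (devCov P p q k) f (paramPt p q m t, v))
    nlinarith

/-- The factor by which one average enlarges the constant in `RateBdd`, in terms of bounds `D` for
the covariance deviations, `u` for the gradient of the tilting potential and `a` for its rate. -/
def rateStep (D u a : ℝ) : ℝ := 1 + 2 * u + 2 * a + D * u + D * (u * (1 + 2 * u))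

variable [NeZero l]

lemma RateBdd.PhiF (hp : p ∈ overlapVectors r) (hq : q ∈ overlapVectors r)
    (ht : t ∈ Ioo (0 : ℝ) 1) (hk : k + 1 ≤ r + 1) (hf : RateBdd P p q m t k f c) (hD0 : 0 ≤ D)
    (hD : ∀ k e e', |devCov P p q k e e'| ≤ D)
    (hu : ∀ v, ∑ e, |dE e (tiltPot P r (k + 1)) (paramPt p q m t, v)| ≤ u)
    (ha : ∀ v, |tiltRate P p q t k (paramPt p q m t, v)| ≤ a) :
    RateBdd P p q m t (k + 1) (PhiF P r (k + 1) f) (rateStep D u a * c) := by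
  have hU := tame_tiltPot (r := r) P (k + 1)
  have hl := locLin_tiltPot (r := r) P (k + 1)
  have hν := expMoments_noiseLaw (d := d) (n := n)
  have hc : 0 ≤ c := (abs_nonneg _).trans (hf.2 0).1
  have hu0 : 0 ≤ u := (Finset.sum_nonneg fun _ _ => abs_nonneg _).trans (hu 0)
  have ha0 : 0 ≤ a := (abs_nonneg _).trans (ha 0)
  have hT : Tame (FullyLifted.PhiF P r (k + 1) f) := hf.1.PhiF
  refine ⟨hT, fun v => ?_⟩
  have hDu : 0 ≤ D * u := mul_nonneg hD0 hu0
  have hDuu : 0 ≤ D * (u * (1 + 2 * u)) := by positivity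
  -- the value
  have b0 : |FullyLifted.PhiF P r (k + 1) f (paramPt p q m t, v)| ≤ c :=
    abs_tilt_le hν hU hl hf.1 _ fun v => (hf.2 v).1
  -- the gradient of the log-average
  have bL : ∑ e, |dE e (logAvg (noiseLaw d n) (lvlMap P r (k + 1)) (tiltPot P r (k + 1)))
      (paramPt p q m t, v)| ≤ u := by
    simp only [dE_logAvg hν hU hl]
    exact sum_abs_tilt_le hν hU hl (fun e => hU.dE e) _ hu
  -- the gradient
  have b1 : ∑ e, |dE e (FullyLifted.PhiF P r (k + 1) f) (paramPt p q m t, v)|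
      ≤ c * (1 + 2 * u) := by
    have h1 : ∀ e, |dE e (FullyLifted.PhiF P r (k + 1) f) (paramPt p q m t, v)|
        ≤ |tilt (noiseLaw d n) (lvlMap P r (k + 1)) (tiltPot P r (k + 1))
            (fun w => dE e f w + f w * dE e (tiltPot P r (k + 1)) w) (paramPt p q m t, v)|
          + c * |dE e (logAvg (noiseLaw d n) (lvlMap P r (k + 1)) (tiltPot P r (k + 1)))
            (paramPt p q m t, v)| := by
      intro e
      have h := dE_tilt (B := lvlMap P r (k + 1)) hν hU hl hf.1 e (paramPt p q m t, v)
      rw [FullyLifted.PhiF, h]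
      refine (abs_sub _ _).trans ?_
      rw [abs_mul]
      exact add_le_add le_rfl (mul_le_mul_of_nonneg_right b0 (abs_nonneg _))
    refine (Finset.sum_le_sum fun e _ => h1 e).trans ?_
    rw [Finset.sum_add_distrib, ← Finset.mul_sum]
    have h2 := sum_abs_tilt_le (B := lvlMap P r (k + 1)) hν hU hl
      (f := fun e w => dE e f w + f w * dE e (tiltPot P r (k + 1)) w) (c := c + c * u)
      (fun e => (hf.1.dE e).add (hf.1.mul (hU.dE e))) (paramPt p q m t, v) fun v => by
        refine (Finset.sum_le_sum fun e _ => (abs_add_le _ _).trans (add_le_add le_rfl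
          ((abs_mul _ _).trans_le (mul_le_mul_of_nonneg_right (hf.2 v).1 (abs_nonneg _))))).trans ?_
        rw [Finset.sum_add_distrib, ← Finset.mul_sum]
        exact add_le_add (hf.2 v).2.1 (mul_le_mul_of_nonneg_left (hu v) hc)
    nlinarith [mul_le_mul_of_nonneg_left bL hc]
  -- the generator
  have b2 : |diffusion (velPt p q t) (devCov P p q (k + 1)) (FullyLifted.PhiF P r (k + 1) f)
      (paramPt p q m t, v)| ≤ (c + D * (u * c) + c * a) + D * (u * (c * (1 + 2 * u))) + c * a := by
    have h := diffusion_tilt (R := devCov P p q (k + 1)) (R' := devCov P p q k)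
      hν (isGaussianField_lvlField P) hU hl hf.1 (velPt p q t)
      (paramPt p q m t, v) (fun e e' => devCov_step P hp hq m ht hk e e')
    have h1 : |tilt (noiseLaw d n) (lvlMap P r (k + 1)) (tiltPot P r (k + 1))
        (fun w => diffusion (velPt p q t) (devCov P p q k) f w
          + carre (devCov P p q k) (tiltPot P r (k + 1)) f w + f w * tiltRate P p q t k w)
        (paramPt p q m t, v)| ≤ c + D * (u * c) + c * a := by
      have hTr : Tame (tiltRate P p q t k) :=
        (hU.diffusion _ _).add ((hU.carre hU _).const_mul _)
      refine abs_tilt_le hν hU hl (((hf.1.diffusion _ _).add (hU.carre hf.1 _)).add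
        (hf.1.mul hTr)) _ fun v => ?_
      refine (abs_add_le _ _).trans (add_le_add ((abs_add_le _ _).trans
        (add_le_add (hf.2 v).2.2 (abs_carre_le hD0 (hD k) (hu v) (hf.2 v).2.1))) ?_)
      rw [abs_mul]
      exact mul_le_mul (hf.2 v).1 (ha v) (abs_nonneg _) hc
    have h2 := abs_carre_le hD0 (hD (k + 1)) bL b1
    have h3 : |tilt (noiseLaw d n) (lvlMap P r (k + 1)) (tiltPot P r (k + 1)) f
          (paramPt p q m t, v)
        * tilt (noiseLaw d n) (lvlMap P r (k + 1)) (tiltPot P r (k + 1)) (tiltRate P p q t k)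
          (paramPt p q m t, v)| ≤ c * a := by
      have hTr : Tame (tiltRate P p q t k) :=
        (hU.diffusion _ _).add ((hU.carre hU _).const_mul _)
      rw [abs_mul]
      exact mul_le_mul b0 (abs_tilt_le hν hU hl hTr _ ha) (abs_nonneg _) hc
    have h4 : diffusion (velPt p q t) (devCov P p q (k + 1)) (FullyLifted.PhiF P r (k + 1) f)
      (paramPt p q m t, v) = _ := h
    rw [h4]
    exact (abs_sub _ _).trans (add_le_add ((abs_sub _ _).trans (add_le_add h1 h2)) h3)
  rw [rateStep]
  refine ⟨b0.trans ?_, b1.trans ?_, b2.trans ?_⟩ <;>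
    nlinarith [mul_nonneg hc hu0, mul_nonneg hc ha0, mul_nonneg hc hDu, mul_nonneg hc hDuu]

end Rate

section NormMean

variable {n d l r : ℕ} [NeZero l] (P : BilinearModel n d l)

lemma abs_chain_le {f : Param r × (Fin l × Fin l → ℝ) → ℝ} (hf : Tame f) (a j : ℕ) {c : ℝ}
    (w : Param r × (Fin l × Fin l → ℝ)) (h : ∀ v, |f (w.1, v)| ≤ c) :
    |chain P r a j f w| ≤ c := by
  have h1 := chain_mono P (tame_const (-c)) hf a j w fun v => (abs_le.1 (h v)).1
  have h2 := chain_mono P hf (tame_const c) a j w fun v => (abs_le.1 (h v)).2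
  rw [chain_const] at h1 h2
  exact abs_le.2 ⟨h1, h2⟩

lemma abs_outerAvg_le {f : Param r × (Fin l × Fin l → ℝ) → ℝ} (hf : Tame f) {c : ℝ}
    (w : Param r × (Fin l × Fin l → ℝ)) (h : ∀ v, |f (w.1, v)| ≤ c) :
    |outerAvg P r f w| ≤ c := by
  have h1 := outerAvg_mono P (tame_const (-c)) hf w fun v => (abs_le.1 (h v)).1
  have h2 := outerAvg_mono P hf (tame_const c) w fun v => (abs_le.1 (h v)).2
  rw [outerAvg_const] at h1 h2
  exact abs_le.2 ⟨h1, h2⟩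

variable {p q m : Fin (r + 2) → ℝ}

lemma abs_devMean_le {D : ℝ} {k : ℕ} (hD : ∀ e e', |devCov P p q k e e'| ≤ D)
    (w : Param r × (Fin l × Fin l → ℝ)) : |devMean P p q k w| ≤ D := by
  have h1 : ∀ e e', |devCov P p q k e e'
      * (chain P r 1 k (gibbs P e) w * chain P r 1 k (gibbs P e') w)|
      ≤ D * (chain P r 1 k (gibbs P e) w * chain P r 1 k (gibbs P e') w) := by
    intro e e'
    have h0 := mul_nonneg (chain_gibbs_nonneg P 1 k e w) (chain_gibbs_nonneg P 1 k e' w)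
    rw [abs_mul, abs_of_nonneg h0]
    exact mul_le_mul_of_nonneg_right (hD e e') h0
  have h2 : ∑ e, ∑ e', D * (chain P r 1 k (gibbs P e) w * chain P r 1 k (gibbs P e') w) = D := by
    simp only [← Finset.mul_sum, sum_chain_gibbs, mul_one]
  rw [← h2]
  exact (Finset.abs_sum_le_sum_abs _ _).trans (Finset.sum_le_sum fun e _ =>
    (Finset.abs_sum_le_sum_abs _ _).trans (Finset.sum_le_sum fun e' _ => h1 e e'))

lemma sum_abs_dE_tiltPot_le (hm : m ∈ liftVectors r) (t : ℝ) {M : ℝ}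
    (hM : ∀ k, |entry m k| ≤ M) {k : ℕ} (hk : k + 1 ≤ r + 1) (v : Fin l × Fin l → ℝ) :
    ∑ e, |dE e (tiltPot P r (k + 1)) (paramPt p q m t, v)| ≤ M * |P.s * P.β| := by
  simp only [dE_tiltPot P p q hm t hk, abs_mul (entry m (k + 1) * (P.s * P.β)),
    abs_of_nonneg (chain_gibbs_nonneg P 1 k _ _), ← Finset.mul_sum, sum_chain_gibbs, mul_one]
  rw [abs_mul]
  exact mul_le_mul_of_nonneg_right (hM _) (abs_nonneg _)

lemma abs_tiltRate_le (hp : p ∈ overlapVectors r) (hq : q ∈ overlapVectors r)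
    (hm : m ∈ liftVectors r) {t : ℝ} (ht : t ∈ Ioo (0 : ℝ) 1) {M D : ℝ}
    (hM : ∀ k, |entry m k| ≤ M) (hD : ∀ k e e', |devCov P p q k e e'| ≤ D)
    {k : ℕ} (hk : k + 1 ≤ r + 1) (v : Fin l × Fin l → ℝ) :
    |tiltRate P p q t k (paramPt p q m t, v)|
      ≤ 1 / 2 * M * (P.s * P.β) ^ 2 * ((r + 1) * (2 * M * D)) := by
  rw [tiltRate_eq_of_potRate P hm hk v (potRate_eq P hp hq hm ht (by omega) v)]
  have hM0 : 0 ≤ M := (abs_nonneg _).trans (hM 0)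
  have hD0 : 0 ≤ D := (abs_nonneg _).trans (hD 0 0 0)
  have h1 : |∑ j ∈ Finset.range (k + 1), (entry m j - entry m (j + 1))
      * chain P r (j + 1) (k - j) (devMean P p q j) (paramPt p q m t, v)|
      ≤ (r + 1) * (2 * M * D) := by
    refine (Finset.abs_sum_le_sum_abs _ _).trans ?_
    have h2 : ∀ j ∈ Finset.range (k + 1), |(entry m j - entry m (j + 1))
        * chain P r (j + 1) (k - j) (devMean P p q j) (paramPt p q m t, v)| ≤ 2 * M * D := by
      intro j _
      rw [abs_mul]
      refine mul_le_mul ((abs_sub _ _).trans ?_) (abs_chain_le P (tame_devMean P j) _ _ _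
        fun v => abs_devMean_le P (hD j) _) (abs_nonneg _) (by positivity)
      linarith [hM j, hM (j + 1)]
    refine (Finset.sum_le_card_nsmul _ _ _ h2).trans ?_
    rw [Finset.card_range, nsmul_eq_mul]
    refine mul_le_mul_of_nonneg_right ?_ (by positivity)
    exact_mod_cast hk
  rw [abs_mul, abs_neg, abs_mul, abs_mul, abs_of_pos (by norm_num : (0 : ℝ) < 1 / 2),
    abs_of_nonneg (sq_nonneg (P.s * P.β))]
  have h3 := hM (k + 1)
  gcongr

/-! #### The mean norm under the Gibbs weights -/

/-- The mean of `‖x‖ ‖y‖` under the Gibbs weights. -/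
def normAvg (P : BilinearModel n d l) (w : Param r × (Fin l × Fin l → ℝ)) : ℝ :=
  ∑ e : Fin l × Fin l, ‖P.x e.1‖ * ‖P.y e.2‖ * gibbs P e w

lemma tame_normAvg : Tame (normAvg (r := r) P) :=
  Tame.sum fun e _ => (tame_gibbs P e).const_mul _

lemma abs_normAvg_le {H : ℝ} (hH : ∀ e : Fin l × Fin l, ‖P.x e.1‖ * ‖P.y e.2‖ ≤ H)
    (w : Param r × (Fin l × Fin l → ℝ)) : |normAvg P w| ≤ H := by
  rw [normAvg, abs_of_nonneg (Finset.sum_nonneg fun e _ => mul_nonneg (by positivity)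
    (gibbs_pos P e w).le)]
  have h := Finset.sum_le_sum fun e (_ : e ∈ Finset.univ) =>
    mul_le_mul_of_nonneg_right (hH e) (gibbs_pos P e w).le
  rwa [← Finset.mul_sum, sum_gibbs, mul_one] at h

lemma sum_abs_dE_logC (i : Fin l) (w : Param r × (Fin l × Fin l → ℝ)) :
    ∑ e, |dE e (logC P i) w| = |P.β| := by
  simp only [dE_logC, Fintype.sum_prod_type]
  rw [Finset.sum_eq_single i]
  · simp only [if_true, abs_mul, Real.abs_exp, ← Finset.mul_sum]
    have h1 : ∑ j, Real.exp (P.β * w.2 (i, j) - logC P i w) = 1 :=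
      sum_exp_sub_log fun j => P.β * w.2 (i, j)
    rw [h1, mul_one]
  · intro a _ ha
    simp [Ne.symm ha]
  · simp

lemma sum_abs_dE_logZ (w : Param r × (Fin l × Fin l → ℝ)) :
    ∑ e, |dE e (logZ P) w| = |P.s| * |P.β| := by
  simp only [dE_logZ, abs_mul, abs_of_pos (gibbs_pos P _ w), ← Finset.mul_sum, sum_gibbs, mul_one]

lemma dirD_sub {Θ V : Type*} [NormedAddCommGroup Θ] [NormedSpace ℝ Θ] [NormedAddCommGroup V]
    [NormedSpace ℝ V] {f g : Θ × V → ℝ} (hf : Differentiable ℝ f) (hg : Differentiable ℝ g)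
    (h w : Θ × V) : dirD h (fun w => f w - g w) w = dirD h f w - dirD h g w := by
  rw [dirD, fderiv_fun_sub (hf w) (hg w)]; rfl

lemma sum_abs_dE_gibbs_le (e' : Fin l × Fin l) (w : Param r × (Fin l × Fin l → ℝ)) :
    ∑ e, |dE e (gibbs P e') w| ≤ gibbs P e' w * (2 * |P.β| * (|P.s| + 1)) := by
  have t1 := (tame_logC (r := r) P e'.1).const_mul P.s
  have t2 := tame_logZ (r := r) P
  have t3 := tame_coord (r := r) P.β e'
  have t4 := tame_logC (r := r) P e'.1
  have h1 : ∀ e, dE e (gibbs P e') w = gibbs P e' w * ((P.s * dE e (logC P e'.1) w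
      - dE e (logZ P) w) + (P.β * (Pi.single e (1 : ℝ) : Fin l × Fin l → ℝ) e'
        - dE e (logC P e'.1) w)) := by
    intro e
    have h2 : gibbs (r := r) P e' = fun w =>
        Real.exp ((P.s * logC P e'.1 w - logZ P w) + (P.β * w.2 e' - logC P e'.1 w)) := by
      funext w; rw [Real.exp_add]; rfl
    have h3 := congrFun (dE_exp ((t1.sub t2).add (t3.sub t4)) e) w
    rw [← h2] at h3
    rw [h3]
    rw [dE_add (t1.sub t2) (t3.sub t4)]
    have h4 := dirD_sub t1.differentiable t2.differentiable (0, Pi.single e 1) w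
    have h5 := dirD_sub t3.differentiable t4.differentiable (0, Pi.single e 1) w
    rw [dirD_const_mul (tame_logC P e'.1).differentiable] at h4
    rw [dirD_coord] at h5
    simp only [dE]
    rw [h4, h5, congrFun h2 w]
  have h6 : ∀ e, |dE e (gibbs P e') w| ≤ gibbs P e' w * (|P.s| * |dE e (logC P e'.1) w|
      + |dE e (logZ P) w| + (|P.β| * (Pi.single e' (1 : ℝ) : Fin l × Fin l → ℝ) e
        + |dE e (logC P e'.1) w|)) := by
    intro e
    rw [h1, abs_mul, abs_of_pos (gibbs_pos P e' w)]
    refine mul_le_mul_of_nonneg_left ?_ (gibbs_pos P e' w).le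
    refine (abs_add_le _ _).trans (add_le_add ((abs_sub _ _).trans (by rw [abs_mul]))
      ((abs_sub _ _).trans (add_le_add ?_ le_rfl)))
    rw [abs_mul, Pi.single_apply, Pi.single_apply]
    by_cases h : e = e' <;> simp [h, Ne.symm]
  refine (Finset.sum_le_sum fun e _ => h6 e).trans (le_of_eq ?_)
  rw [← Finset.mul_sum]
  simp only [Finset.sum_add_distrib, ← Finset.mul_sum, sum_abs_dE_logC, sum_abs_dE_logZ]
  rw [Finset.sum_pi_single']
  simp only [Finset.mem_univ, if_true]
  ring

lemma sum_abs_dE_normAvg_le {H : ℝ} (hH : ∀ e : Fin l × Fin l, ‖P.x e.1‖ * ‖P.y e.2‖ ≤ H)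
    (w : Param r × (Fin l × Fin l → ℝ)) :
    ∑ e, |dE e (normAvg P) w| ≤ H * (2 * |P.β| * (|P.s| + 1)) := by
  have h1 : ∀ e, |dE e (normAvg P) w| ≤ ∑ e' : Fin l × Fin l, H * |dE e (gibbs P e') w| := by
    intro e
    have h2 : dE e (normAvg P) w
        = ∑ e' : Fin l × Fin l, ‖P.x e'.1‖ * ‖P.y e'.2‖ * dE e (gibbs P e') w := by
      have : normAvg (r := r) P = fun w => ∑ e' : Fin l × Fin l,
        ‖P.x e'.1‖ * ‖P.y e'.2‖ * gibbs P e' w := rfl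
      rw [this, dE, dirD, fderiv_fun_sum fun e' _ =>
        ((tame_gibbs P e').const_mul _).differentiable w, sum_apply]
      exact Finset.sum_congr rfl fun e' _ => dirD_const_mul (tame_gibbs P e').differentiable _ _ _
    rw [h2]
    refine (Finset.abs_sum_le_sum_abs _ _).trans (Finset.sum_le_sum fun e' _ => ?_)
    rw [abs_mul, abs_of_nonneg (mul_nonneg (norm_nonneg (P.x e'.1)) (norm_nonneg (P.y e'.2)))]
    exact mul_le_mul_of_nonneg_right (hH e') (abs_nonneg _)
  have hH0 : 0 ≤ H := le_trans (by positivity) (hH 0)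
  refine (Finset.sum_le_sum fun e _ => h1 e).trans ?_
  rw [Finset.sum_comm]
  simp only [← Finset.mul_sum]
  refine mul_le_mul_of_nonneg_left ?_ hH0
  refine (Finset.sum_le_sum fun e' _ => sum_abs_dE_gibbs_le P e' w).trans ?_
  rw [← Finset.sum_mul, sum_gibbs, one_mul]

/-- The generator of level `0` acts on the mean norm through the first-order term alone: both the
partition function and its product with the mean norm are sums of functions of single rows. -/
lemma diffusion_normAvg (hp : p ∈ overlapVectors r) (t : ℝ)
    (w : Param r × (Fin l × Fin l → ℝ)) :
    diffusion (velPt p q t) (devCov P p q 0) (normAvg P) w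
      = -carre (devCov P p q 0) (logZ P) (normAvg P) w := by
  have hZ := (tame_logZ (r := r) P).exp (locLin_logZ P)
  have h1 := diffusion_mul hZ (tame_normAvg (r := r) P) (velPt p q t) (devCov P p q 0) w
  have h2 : diffusion (velPt p q t) (devCov P p q 0)
      (fun w : Param r × (Fin l × Fin l → ℝ) => Real.exp (logZ P w)) w = 0 := by
    rw [diffusion_exp (tame_logZ (r := r) P) (locLin_logZ P)]
    exact mul_eq_zero_of_right _ (potRate_zero P hp t w)
  have h3 : diffusion (velPt p q t) (devCov P p q 0)
      (fun w : Param r × (Fin l × Fin l → ℝ) => Real.exp (logZ P w) * normAvg P w) w = 0 := by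
    have e1 : (fun w : Param r × (Fin l × Fin l → ℝ) => Real.exp (logZ P w) * normAvg P w)
        = fun w => ∑ e : Fin l × Fin l, ‖P.x e.1‖ * ‖P.y e.2‖ *
          (Real.exp (P.s * logC P e.1 w) * Real.exp (P.β * w.2 e - logC P e.1 w)) := by
      funext w
      rw [normAvg, Finset.mul_sum]
      refine Finset.sum_congr rfl fun e _ => ?_
      rw [gibbs, Real.exp_sub (P.s * logC P e.1 w)]
      have := (Real.exp_pos (logZ P w)).ne'
      field_simp
    have ht : ∀ e : Fin l × Fin l, Tame fun w : Param r × (Fin l × Fin l → ℝ) =>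
        ‖P.x e.1‖ * ‖P.y e.2‖ *
          (Real.exp (P.s * logC P e.1 w) * Real.exp (P.β * w.2 e - logC P e.1 w)) := fun e =>
      ((((tame_logC P e.1).const_mul P.s).exp ((locLin_logC P e.1).const_mul P.s)).mul
        (((tame_coord P.β e).sub (tame_logC P e.1)).exp
          ((locLin_coord P.β e).sub (locLin_logC P e.1)))).const_mul _
    rw [e1, diffusion_sum _ ht]
    refine Finset.sum_eq_zero fun e _ => IsRowFn.diffusion_eq_zero (i := e.1)
      (fun w w' h => ?_) (ht e) _ (devCov_zero P hp) w
    have h4 := h e.2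
    simp only [isRowFn_logC P e.1 w w' h, show w.2 e = w'.2 e from h4]
  rw [h3, h2, carre_exp_left (tame_logZ P), mul_zero, add_zero, ← mul_add] at h1
  have := (mul_eq_zero.1 h1.symm).resolve_left (Real.exp_pos _).ne'
  linarith

lemma rateBdd_normAvg (hp : p ∈ overlapVectors r) (t : ℝ) {H D : ℝ}
    (hH : ∀ e : Fin l × Fin l, ‖P.x e.1‖ * ‖P.y e.2‖ ≤ H)
    (hD : ∀ e e', |devCov P p q 0 e e'| ≤ D) :
    RateBdd P p q m t 0 (normAvg P)
      (H * (1 + 2 * |P.β| * (|P.s| + 1)) * (1 + D * (|P.s| * |P.β|))) := by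
  have hH0 : 0 ≤ H := le_trans (by positivity) (hH 0)
  have hD0 : 0 ≤ D := (abs_nonneg _).trans (hD 0 0)
  refine ⟨tame_normAvg P, fun v => ?_⟩
  have h1 := abs_normAvg_le P hH (paramPt p q m t, v)
  have h2 := sum_abs_dE_normAvg_le P hH (paramPt p q m t, v)
  have h3 := abs_carre_le hD0 hD (sum_abs_dE_logZ P (paramPt p q m t, v)).le h2
  set g := 2 * |P.β| * (|P.s| + 1) with hg
  have hg0 : 0 ≤ g := by positivity
  set z := D * (|P.s| * |P.β|) with hz
  have hz0 : 0 ≤ z := by positivity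
  have a1 : 0 ≤ H * g := by positivity
  have a2 : 0 ≤ H * z := by positivity
  have a3 : 0 ≤ H * g * z := by positivity
  refine ⟨by nlinarith, by nlinarith, ?_⟩
  rw [diffusion_normAvg P hp, abs_neg]
  refine h3.trans ?_
  have : D * (|P.s| * |P.β| * (H * g)) = H * g * z := by rw [hz]; ring
  nlinarith

lemma abs_devCov_le (hp : p ∈ overlapVectors r) (hq : q ∈ overlapVectors r) {R : ℝ}
    (hR : ∀ i, ‖P.x i‖ ≤ R ∧ ‖P.y i‖ ≤ R) (k : ℕ) (e e' : Fin l × Fin l) :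
    |devCov P p q k e e'| ≤ 2 * R ^ 2 * (2 * R ^ 2) := by
  have hR0 : 0 ≤ R := (norm_nonneg _).trans (hR 0).1
  have key : ∀ {N : ℕ} (a b : EuclideanSpace ℝ (Fin N)) (c : ℝ), 0 ≤ c → c ≤ 1 → ‖a‖ ≤ R →
      ‖b‖ ≤ R → |c * ‖a‖ * ‖b‖ - inner ℝ b a| ≤ 2 * R ^ 2 := by
    intro N a b c hc0 hc1 ha hb
    have h1 : ‖a‖ * ‖b‖ ≤ R * R := mul_le_mul ha hb (norm_nonneg _) hR0
    have h0 : 0 ≤ ‖a‖ * ‖b‖ := by positivity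
    have h2 := abs_real_inner_le_norm b a
    refine (abs_sub _ _).trans ?_
    rw [mul_assoc, abs_of_nonneg (mul_nonneg hc0 h0)]
    nlinarith
  rw [devCov, abs_mul]
  exact mul_le_mul (key _ _ _ (entry_nonneg hp k) (entry_le_one hp k) (hR _).1 (hR _).1)
    (key _ _ _ (entry_nonneg hq k) (entry_le_one hq k) (hR _).2 (hR _).2) (abs_nonneg _)
    (by positivity)

lemma RateBdd.chain {P : BilinearModel n d l} {t : ℝ} {k : ℕ}
    {f : Param r × (Fin l × Fin l → ℝ) → ℝ} {c D u a : ℝ}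
    (hp : p ∈ overlapVectors r) (hq : q ∈ overlapVectors r)
    (ht : t ∈ Ioo (0 : ℝ) 1) (hf : RateBdd P p q m t k f c) (hD0 : 0 ≤ D)
    (hD : ∀ k e e', |devCov P p q k e e'| ≤ D)
    (hu : ∀ k, k + 1 ≤ r + 1 → ∀ v,
      ∑ e, |dE e (tiltPot P r (k + 1)) (paramPt p q m t, v)| ≤ u)
    (ha : ∀ k, k + 1 ≤ r + 1 → ∀ v, |tiltRate P p q t k (paramPt p q m t, v)| ≤ a)
    {j : ℕ} (hj : k + j ≤ r) :
    RateBdd P p q m t (k + j) (chain P r (k + 1) j f) (rateStep D u a ^ j * c) := by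
  induction j with
  | zero => simpa [FullyLifted.chain] using hf
  | succ j ih =>
    have h := (ih (by omega)).PhiF hp hq ht (by omega) hD0 hD (hu _ (by omega)) (ha _ (by omega))
    rw [← mul_assoc, ← pow_succ'] at h
    rw [FullyLifted.chain, PhiF_index P (show k + 1 + j = k + j + 1 by omega)]
    exact h

lemma normMean_eq_outerAvg (p q m : Fin (r + 2) → ℝ) (t : ℝ) {k : ℕ} (hk : k ≤ r) :
    normMean P p q m t (k + 1) = outerAvg P r (chain P r (k + 1) (r - k) fun w =>
      chain P r 1 k (normAvg P) w * chain P r 1 k (normAvg P) w) (paramPt p q m t, 0) := by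
  rw [normMean, gammaMean_eq_outerAvg P p q m t hk]
  refine outerAvg_congr P _ fun v => ?_
  rw [gammaF_eq_chain]
  refine chain_congr P _ _ _ fun v => ?_
  have h1 : chain P r 1 k (normAvg P) = fun w => ∑ e : Fin l × Fin l,
      ‖P.x e.1‖ * ‖P.y e.2‖ * chain P r 1 k (gibbs P e) w := by
    have : normAvg (r := r) P = fun w => ∑ e' : Fin l × Fin l,
        ‖P.x e'.1‖ * ‖P.y e'.2‖ * gibbs P e' w := rfl
    rw [this, chain_sum P _ fun e => (tame_gibbs P e).const_mul _]
    simp only [chain_const_mul]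
  rw [h1]
  beta_reduce
  rw [Finset.sum_mul_sum]
  exact Finset.sum_congr rfl fun e _ => Finset.sum_congr rfl fun e' _ => by ring

/-- The mean norms move in time with a speed that is bounded in terms of bounds for the norms, the
exponents and `β`, independently of the dimensions and of the number of vectors. -/
lemma exists_normMean_speed_bound (r k : ℕ) (R S B M : ℝ) : ∃ K : ℝ, 0 ≤ K ∧
    ∀ (n d l : ℕ) (_ : NeZero l) (P : BilinearModel n d l) (p q m : Fin (r + 2) → ℝ) (t : ℝ),
      k ≤ r → p ∈ overlapVectors r → q ∈ overlapVectors r → m ∈ liftVectors r →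
      (∀ i, ‖P.x i‖ ≤ R ∧ ‖P.y i‖ ≤ R) → |P.s| ≤ S → |P.β| ≤ B → (∀ k, |entry m k| ≤ M) →
      t ∈ Ioo (0 : ℝ) 1 →
      ∃ v, |v| ≤ K ∧ HasDerivAt (fun t => normMean P p q m t (k + 1)) v t := by
  -- `D` bounds the matrices `devCov`, `u` the gradients and `a` the rates of the tilting potentials,
  -- `c` the Gibbs mean of the norms at level `0`
  set D := 2 * R ^ 2 * (2 * R ^ 2)
  set u := M * (S * B)
  set a := 1 / 2 * M * (S * B) ^ 2 * ((r + 1) * (2 * M * D))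
  set c := R * R * (1 + 2 * B * (S + 1)) * (1 + D * (S * B))
  set K := rateStep D u a ^ (r - k) * ((2 + D) * (rateStep D u a ^ k * c) ^ 2)
  refine ⟨|K|, abs_nonneg _, ?_⟩
  intro n d l _ P p q m t hk hp hq hm hR hS hB hM ht
  have hR0 : 0 ≤ R := (norm_nonneg _).trans (hR 0).1
  have hM0 : 0 ≤ M := (abs_nonneg _).trans (hM 0)
  have hD0 : 0 ≤ D := by positivity
  have hD : ∀ k e e', |devCov P p q k e e'| ≤ D := abs_devCov_le P hp hq hR
  have hS0 : 0 ≤ S := (abs_nonneg _).trans hS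
  have hB0 : 0 ≤ B := (abs_nonneg _).trans hB
  have hSB : |P.s * P.β| ≤ S * B := by
    rw [abs_mul]; exact mul_le_mul hS hB (abs_nonneg _) hS0
  have hSB2 : (P.s * P.β) ^ 2 ≤ (S * B) ^ 2 := by
    rw [← sq_abs (P.s * P.β)]; exact pow_le_pow_left₀ (abs_nonneg _) hSB 2
  have hu : ∀ k, k + 1 ≤ r + 1 → ∀ v,
      ∑ e, |dE e (tiltPot P r (k + 1)) (paramPt p q m t, v)| ≤ u := fun k hk v =>
    (sum_abs_dE_tiltPot_le P hm t hM hk v).trans (mul_le_mul_of_nonneg_left hSB hM0)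
  have ha : ∀ k, k + 1 ≤ r + 1 → ∀ v, |tiltRate P p q t k (paramPt p q m t, v)| ≤ a :=
    fun k hk v => (abs_tiltRate_le P hp hq hm ht hM hD hk v).trans
      (by simp only [a]; gcongr)
  have h0 : RateBdd P p q m t 0 (normAvg P) c := by
    obtain ⟨h1, h2⟩ := rateBdd_normAvg (m := m) P hp t (H := R * R)
      (fun e => mul_le_mul (hR _).1 (hR _).2 (norm_nonneg _) hR0) (hD 0)
    have hc : R * R * (1 + 2 * |P.β| * (|P.s| + 1)) * (1 + D * (|P.s| * |P.β|)) ≤ c := by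
      simp only [c]; gcongr
    exact ⟨h1, fun v => ⟨(h2 v).1.trans hc, (h2 v).2.1.trans hc, (h2 v).2.2.trans hc⟩⟩
  -- up to level `k` for one replica, then to level `r` for the product over two replicas
  have h1 := h0.chain hp hq ht hD0 hD hu ha (j := k) (by omega)
  rw [zero_add, zero_add] at h1
  have h2 := (h1.sq hD0 (hD k)).chain hp hq ht hD0 hD hu ha (j := r - k) (by omega)
  rw [show k + (r - k) = r by omega] at h2
  refine ⟨outerAvg P r (diffusion (velPt p q t) (devCov P p q r)
    (chain P r (k + 1) (r - k) fun w => chain P r 1 k (normAvg P) w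
      * chain P r 1 k (normAvg P) w)) (paramPt p q m t, 0), ?_, ?_⟩
  rotate_left
  · simp only [normMean_eq_outerAvg P p q m _ hk]
    exact hasDerivAt_outerAvg P hp hq m ht h2.1
  · exact (abs_outerAvg_le P (h2.1.diffusion _ _) _ fun v => (h2.2 v).2.2).trans (le_abs_self _)

end NormMean

/-! ### Derivatives on the closed unit interval -/

section UnitInterval

/-- A derivative on the open interval that extends continuously is the derivative on the closed
interval. -/
lemma hasDerivWithinAt_Icc_of_Ioo {f g : ℝ → ℝ} (hf : ContinuousOn f (Icc 0 1))
    (hd : ∀ t ∈ Ioo (0 : ℝ) 1, HasDerivAt f (g t) t) (hg : ContinuousOn g (Icc 0 1))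
    {t : ℝ} (ht : t ∈ Icc (0 : ℝ) 1) : HasDerivWithinAt f (g t) (Icc 0 1) t := by
  have hdiff : DifferentiableOn ℝ f (Ioo 0 1) := fun x hx =>
    (hd x hx).differentiableAt.differentiableWithinAt
  rcases eq_or_lt_of_le ht.1 with h0 | h0
  · subst h0
    have hm : Ioo (0 : ℝ) 1 ∈ 𝓝[>] (0 : ℝ) := Ioo_mem_nhdsGT one_pos
    refine (hasDerivWithinAt_Ici_of_tendsto_deriv hdiff ((hf 0 ht).mono Ioo_subset_Icc_self) hm
      ?_).mono Icc_subset_Ici_self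
    refine Tendsto.congr' (f₁ := g) (eventually_of_mem hm fun x hx => (hd x hx).deriv.symm) ?_
    exact (hg 0 ht).mono_left (nhdsWithin_le_of_mem (mem_of_superset hm Ioo_subset_Icc_self))
  · rcases eq_or_lt_of_le ht.2 with h1 | h1
    · subst h1
      have hm : Ioo (0 : ℝ) 1 ∈ 𝓝[<] (1 : ℝ) := Ioo_mem_nhdsLT one_pos
      refine (hasDerivWithinAt_Iic_of_tendsto_deriv hdiff ((hf 1 ht).mono Ioo_subset_Icc_self) hm
        ?_).mono Icc_subset_Iic_self
      refine Tendsto.congr' (f₁ := g) (eventually_of_mem hm fun x hx => (hd x hx).deriv.symm) ?_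
      exact (hg 1 ht).mono_left (nhdsWithin_le_of_mem (mem_of_superset hm Ioo_subset_Icc_self))
    · exact (hd t ⟨h0, h1⟩).hasDerivWithinAt

/-- A bound for the derivative on the open interval holds up to the endpoints. -/
lemma abs_le_of_hasDerivWithinAt_Icc {f : ℝ → ℝ} {K v : ℝ} (hf : ContinuousOn f (Icc 0 1))
    (hd : ∀ t ∈ Ioo (0 : ℝ) 1, ∃ v, |v| ≤ K ∧ HasDerivAt f v t) {t : ℝ}
    (ht : t ∈ Icc (0 : ℝ) 1) (hv : HasDerivWithinAt f v (Icc 0 1) t) : |v| ≤ K := by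
  have hlip : ∀ x ∈ Icc (0 : ℝ) 1, ∀ y ∈ Icc (0 : ℝ) 1, x < y → |slope f x y| ≤ K := by
    intro x hx y hy hxy
    have hsub : Icc x y ⊆ Icc (0 : ℝ) 1 := Icc_subset_Icc hx.1 hy.2
    have hin : ∀ z ∈ Ioo x y, z ∈ Ioo (0 : ℝ) 1 := fun z hz =>
      ⟨hx.1.trans_lt hz.1, hz.2.trans_le hy.2⟩
    obtain ⟨c, hc, hc'⟩ := exists_deriv_eq_slope f hxy (hf.mono hsub) fun z hz =>
      (hd z (hin z hz)).choose_spec.2.differentiableAt.differentiableWithinAt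
    obtain ⟨w, hw, hw'⟩ := hd c (hin c hc)
    rw [slope_def_field, ← hc', hw'.deriv]
    exact hw
  have h1 := hasDerivWithinAt_iff_tendsto_slope.1 hv
  have hne : (𝓝[Icc (0 : ℝ) 1 \ {t}] t).NeBot := by
    have := (uniqueDiffOn_Icc_zero_one t ht).accPt
    rw [accPt_principal_iff_nhdsWithin] at this
    exact this
  refine le_of_tendsto h1.abs (eventually_of_mem self_mem_nhdsWithin fun y hy => ?_)
  rcases lt_or_gt_of_ne (show y ≠ t from hy.2) with h | h
  · rw [slope_comm]; exact hlip y hy.1 t ht h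
  · exact hlip t ht y hy.1 h

/-- Functions on the unit interval whose derivatives are uniformly bounded and tend to zero
pointwise have asymptotically vanishing increments. -/
lemma tendsto_sub_of_tendsto_derivWithin {g : ℕ → ℝ → ℝ} {K : ℝ}
    (hd : ∀ᶠ n in atTop, DifferentiableOn ℝ (g n) (Icc 0 1))
    (hb : ∀ᶠ n in atTop, ∀ t ∈ Icc (0 : ℝ) 1, |derivWithin (g n) (Icc 0 1) t| ≤ K)
    (hl : ∀ t ∈ Icc (0 : ℝ) 1, Tendsto (fun n => derivWithin (g n) (Icc 0 1) t) atTop (𝓝 0))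
    {a b : ℝ} (ha : 0 ≤ a) (hab : a ≤ b) (hb1 : b ≤ 1) :
    Tendsto (fun n => g n b - g n a) atTop (𝓝 0) := by
  -- outside the open interval, where `deriv` is not the one-sided derivative, use zero
  set f : ℕ → ℝ → ℝ := fun n => (Ioo (0 : ℝ) 1).indicator (deriv (g n)) with hf
  have hmeas : ∀ n, Measurable (f n) := fun n => (measurable_deriv (g n)).indicator measurableSet_Ioo
  have hin : ∀ n, ∀ x ∈ Ioo (0 : ℝ) 1, f n x = derivWithin (g n) (Icc 0 1) x := fun n x hx => by
    rw [hf]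
    simp only [indicator_of_mem hx]
    exact (derivWithin_of_mem_nhds (Icc_mem_nhds hx.1 hx.2)).symm
  have hout : ∀ n, ∀ x ∉ Ioo (0 : ℝ) 1, f n x = 0 := fun n x hx => by
    rw [hf]; simp only [indicator_of_notMem hx]
  have hfb : ∀ᶠ n in atTop, ∀ x, ‖f n x‖ ≤ K := by
    filter_upwards [hb] with n hn x
    by_cases hx : x ∈ Ioo (0 : ℝ) 1
    · rw [hin n x hx]; exact hn x (Ioo_subset_Icc_self hx)
    · rw [hout n x hx, norm_zero]; exact (abs_nonneg _).trans (hn 0 ⟨le_rfl, zero_le_one⟩)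
  have hFTC : ∀ᶠ n in atTop, ∫ x in a..b, f n x = g n b - g n a := by
    filter_upwards [hd, hfb] with n hn hfn
    have hsub : Icc a b ⊆ Icc (0 : ℝ) 1 := Icc_subset_Icc ha hb1
    refine intervalIntegral.integral_eq_sub_of_hasDerivAt_of_le hab (hn.continuousOn.mono hsub)
      (fun x hx => ?_) ?_
    · have hx' : x ∈ Ioo (0 : ℝ) 1 := ⟨ha.trans_lt hx.1, hx.2.trans_le hb1⟩
      rw [hin n x hx']
      exact ((hn x (Ioo_subset_Icc_self hx')).hasDerivWithinAt).hasDerivAt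
        (Icc_mem_nhds hx'.1 hx'.2)
    · exact (intervalIntegrable_const (c := K)).mono_fun (hmeas n).aestronglyMeasurable
        (Eventually.of_forall fun x => (hfn x).trans (le_abs_self K))
  have hint : Tendsto (fun n => ∫ x in a..b, f n x) atTop (𝓝 (∫ _x in a..b, (0 : ℝ))) := by
    refine intervalIntegral.tendsto_integral_filter_of_dominated_convergence (fun _ => K)
      (Eventually.of_forall fun n => (hmeas n).aestronglyMeasurable)
      (hfb.mono fun n hn => Eventually.of_forall fun x _ => hn x) intervalIntegrable_const
      (Eventually.of_forall fun x _ => ?_)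
    by_cases hx : x ∈ Ioo (0 : ℝ) 1
    · simp only [fun n => hin n x hx]; exact hl x (Ioo_subset_Icc_self hx)
    · simp only [fun n => hout n x hx]; exact tendsto_const_nhds
  rw [intervalIntegral.integral_zero] at hint
  exact hint.congr' hFTC

end UnitInterval

/-! ### The total derivative along a stationary path -/

section Path

variable {n d l r : ℕ} [NeZero l] {P : BilinearModel n d l}

lemma domain_mk {p q : Fin (r + 2) → ℝ} (hp : p ∈ overlapVectors r) (hq : q ∈ overlapVectors r)
    (m : Fin (r + 2) → ℝ) {t : ℝ} (ht : t ∈ Icc (0 : ℝ) 1) :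
    ((p, q, m, t) : Vars r) ∈ domain r := ⟨hp, hq, ht⟩

lemma differentiableOn_gammaMean {p q m : Fin (r + 2) → ℝ} (hp : p ∈ overlapVectors r)
    (hq : q ∈ overlapVectors r) (hm : m ∈ liftVectors r) {k : ℕ} (hk : k ≤ r)
    (F : Fin l → Fin l → Fin l → Fin l → ℝ) :
    DifferentiableOn ℝ (fun t => gammaMean P p q m t (k + 1) F) (Icc 0 1) := fun t ht =>
  (differentiableWithinAt_gammaMean P hk F (domain_mk hp hq m ht) hm).comp t
    (f := fun t => ((p, q, m, t) : Vars r)) (by fun_prop) fun t ht => domain_mk hp hq m ht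

lemma hasDerivWithinAt_psi {p q m : Fin (r + 2) → ℝ} (hp : p ∈ overlapVectors r)
    (hq : q ∈ overlapVectors r) (hm : m ∈ liftVectors r) (hn : 0 < n) (hβ : 0 < P.β)
    (hs : P.s ≠ 0) {t : ℝ} (ht : t ∈ Icc (0 : ℝ) 1) :
    HasDerivWithinAt (fun t => psi P p q m t) (Real.sign P.s * P.β / (2 * √(n : ℝ)) *
      ∑ k ∈ Finset.range (r + 1), phi P p q m t (k + 1)) (Icc 0 1) t := by
  have hc : P.β * |P.s| * √(n : ℝ) ≠ 0 := by positivity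
  refine hasDerivWithinAt_Icc_of_Ioo (g := fun t => Real.sign P.s * P.β / (2 * √(n : ℝ)) *
      ∑ k ∈ Finset.range (r + 1), phi P p q m t (k + 1)) (fun t ht => ?_)
      (fun t ht => hasDerivAt_psi P hp hq hm ht hβ hs) ?_ ht
  · exact ((differentiableWithinAt_psi P (domain_mk hp hq m ht) hm hc).comp t
      (f := fun t => ((p, q, m, t) : Vars r)) (t := domain r) (s := Icc 0 1) (by fun_prop)
        fun t ht => domain_mk hp hq m ht).continuousWithinAt
  · refine continuousOn_const.mul (continuousOn_finsetSum _ fun k hk => continuousOn_const.mul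
      (differentiableOn_gammaMean hp hq hm (by have := Finset.mem_range.1 hk; omega)
        _).continuousOn)

/-- The time derivative of `ψ₁`, in terms of the derivatives of the mean norms. -/
lemma hasDerivWithinAt_psiOne {p q m : Fin (r + 2) → ℝ} (hp : p ∈ overlapVectors r)
    (hq : q ∈ overlapVectors r) (hm : m ∈ liftVectors r) (hn : 0 < n) (hβ : 0 < P.β)
    (hs : P.s ≠ 0) {t : ℝ} (ht : t ∈ Icc (0 : ℝ) 1) :
    HasDerivWithinAt (fun t => psiOne P p q m t)
      (-(Real.sign P.s * P.s * P.β / (2 * √(n : ℝ))) *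
        (∑ k ∈ Finset.range (r + 1), entry p k * entry q k
          * (entry m (k + 1) - if k = 0 then 0 else entry m k)
          * derivWithin (fun t => normMean P p q m t (k + 1)) (Icc 0 1) t)
      + Real.sign P.s * P.β / (2 * √(n : ℝ)) *
        ∑ k ∈ Finset.range (r + 1), phi P p q m t (k + 1)) (Icc 0 1) t := by
  have h1 : (fun t => psiOne P p q m t) = _ := funext fun t => psiOne_eq P hp m t
  rw [h1]
  refine HasDerivWithinAt.add ?_ (hasDerivWithinAt_psi hp hq hm hn hβ hs ht)
  refine HasDerivWithinAt.const_mul _ (HasDerivWithinAt.fun_sum fun k hk => ?_)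
  exact ((differentiableOn_gammaMean hp hq hm (by have := Finset.mem_range.1 hk; omega) _
    t ht).hasDerivWithinAt).const_mul _

variable {p q m : ℝ → Fin (r + 2) → ℝ}

/-- Along a path of stationary points only the explicit dependence on time contributes to the
total derivative of `ψ₁`. -/
lemma hasDerivWithinAt_psiOne_path
    (hp : ∀ t ∈ Icc (0 : ℝ) 1, p t ∈ overlapVectors r)
    (hq : ∀ t ∈ Icc (0 : ℝ) 1, q t ∈ overlapVectors r)
    (hm : ∀ t ∈ Icc (0 : ℝ) 1, m t ∈ liftVectors r)
    (hpd : DifferentiableOn ℝ p (Icc 0 1)) (hqd : DifferentiableOn ℝ q (Icc 0 1))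
    (hmd : DifferentiableOn ℝ m (Icc 0 1))
    (hn : 0 < n) (hβ : 0 < P.β) (hs : P.s ≠ 0) {t : ℝ} (ht : t ∈ Icc (0 : ℝ) 1)
    (hstat : IsStationary P (p t) (q t) (m t) t) {v : ℝ}
    (hv : HasDerivWithinAt (fun t' => psiOne P (p t) (q t) (m t) t') v (Icc 0 1) t) :
    HasDerivWithinAt (fun t' => psiOne P (p t') (q t') (m t') t') v (Icc 0 1) t := by
  have hc : P.β * |P.s| * √(n : ℝ) ≠ 0 := by positivity
  have hu := uniqueDiffOn_Icc_zero_one t ht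
  set F : Vars r → ℝ := fun x => psiOne P x.1 x.2.1 x.2.2.1 x.2.2.2 with hF
  have hΛ := (differentiableWithinAt_psiOne P (domain_mk (hp t ht) (hq t ht) (m t) ht)
    (hm t ht) hc).hasFDerivWithinAt
  set Λ := fderivWithin ℝ F (domain r) (p t, q t, m t, t)
  have hp' := (hpd t ht).hasDerivWithinAt
  have hq' := (hqd t ht).hasDerivWithinAt
  have hm' := (hmd t ht).hasDerivWithinAt
  set p' := derivWithin p (Icc 0 1) t
  set q' := derivWithin q (Icc 0 1) t
  set m' := derivWithin m (Icc 0 1) t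
  have hid : HasDerivWithinAt (fun t' : ℝ => t') 1 (Icc 0 1) t := hasDerivWithinAt_id _ _
  have hk : ∀ {W : Type} [NormedAddCommGroup W] [NormedSpace ℝ W] (w : W),
      HasDerivWithinAt (fun _ : ℝ => w) 0 (Icc 0 1) t := fun w => hasDerivWithinAt_const _ _ _
  -- the part of the derivative due to `p`
  have e1 : Λ (p', 0, 0, 0) = 0 := by
    have h1 : HasDerivWithinAt (fun t' => F (p t', q t, m t, t)) (Λ (p', 0, 0, 0)) (Icc 0 1) t :=
      hΛ.comp_hasDerivWithinAt (f := fun t' => ((p t', q t, m t, t) : Vars r)) t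
        (hp'.prodMk ((hk _).prodMk ((hk _).prodMk (hk _))))
        fun t' ht' => domain_mk (hp t' ht') (hq t ht) _ ht
    have h2 : HasDerivWithinAt (fun t' => F (p t', q t, m t, t)) _ (Icc 0 1) t :=
      hstat.1.comp_hasDerivWithinAt t hp' hp
    exact hu.eq_deriv _ h1 h2
  -- the part due to `q`
  have e2 : Λ (0, q', 0, 0) = 0 := by
    have h1 : HasDerivWithinAt (fun t' => F (p t, q t', m t, t)) (Λ (0, q', 0, 0)) (Icc 0 1) t :=
      hΛ.comp_hasDerivWithinAt (f := fun t' => ((p t, q t', m t, t) : Vars r)) t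
        ((hk _).prodMk (hq'.prodMk ((hk _).prodMk (hk _))))
        fun t' ht' => domain_mk (hp t ht) (hq t' ht') _ ht
    have h2 : HasDerivWithinAt (fun t' => F (p t, q t', m t, t)) _ (Icc 0 1) t :=
      hstat.2.1.comp_hasDerivWithinAt t hq' hq
    exact hu.eq_deriv _ h1 h2
  -- the part due to the free entries of `m`
  have e3 : ∀ k : Fin (r + 2), k ≠ 0 → k ≠ Fin.last (r + 1) →
      Λ (0, 0, Pi.single k 1, 0) = 0 := by
    intro k hk0 hkl
    have h0 : HasDerivAt (fun v : ℝ => ((p t, q t, Function.update (m t) k v, t) : Vars r))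
        (0, 0, Pi.single k 1, 0) (m t k) :=
      (hasDerivAt_const _ _).prodMk ((hasDerivAt_const _ _).prodMk
        ((hasDerivAt_update (m t) k (m t k)).prodMk (hasDerivAt_const _ _)))
    have hΛ' : HasFDerivWithinAt F Λ (domain r)
        (p t, q t, Function.update (m t) k (m t k), t) := by
      rw [Function.update_eq_self]; exact hΛ
    have h1 : HasDerivWithinAt (fun v => F (p t, q t, Function.update (m t) k v, t))
        (Λ (0, 0, Pi.single k 1, 0)) univ (m t k) :=
      hΛ'.comp_hasDerivWithinAt
        (f := fun v : ℝ => ((p t, q t, Function.update (m t) k v, t) : Vars r)) (m t k)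
        h0.hasDerivWithinAt fun v _ => domain_mk (hp t ht) (hq t ht) _ ht
    exact (hasDerivWithinAt_univ.1 h1).unique (hstat.2.2 k hk0 hkl)
  -- the other entries of `m` are constant
  have hm0 : m' 0 = 0 := by
    have h1 := hasDerivWithinAt_pi.1 hm' 0
    exact hu.eq_deriv _ h1 ((hk (1 : ℝ)).congr (fun t' ht' => (hm t' ht').1) (hm t ht).1)
  have hml : m' (Fin.last (r + 1)) = 0 := by
    have h1 := hasDerivWithinAt_pi.1 hm' (Fin.last (r + 1))
    exact hu.eq_deriv _ h1 ((hk (0 : ℝ)).congr (fun t' ht' => (hm t' ht').2.1) (hm t ht).2.1)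
  have e4 : Λ (0, 0, m', 0) = 0 := by
    have h1 : ((0, 0, m', 0) : Vars r)
        = ∑ k, m' k • ((0, 0, Pi.single k 1, 0) : Vars r) := by
      refine Prod.ext ?_ (Prod.ext ?_ (Prod.ext ?_ ?_)) <;>
        simp only [Prod.fst_sum, Prod.snd_sum, Prod.smul_fst, Prod.smul_snd, smul_zero,
          Finset.sum_const_zero]
      funext j
      simp [Finset.sum_apply, Pi.single_apply]
    rw [h1, map_sum]
    refine Finset.sum_eq_zero fun k _ => ?_
    rw [map_smul]
    by_cases hk0 : k = 0
    · rw [hk0, hm0, zero_smul]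
    · by_cases hkl : k = Fin.last (r + 1)
      · rw [hkl, hml, zero_smul]
      · rw [e3 k hk0 hkl, smul_zero]
  -- the explicit dependence on time
  have e5 : Λ (0, 0, 0, 1) = v := by
    have h1 : HasDerivWithinAt (fun t' => F (p t, q t, m t, t')) (Λ (0, 0, 0, 1)) (Icc 0 1) t :=
      hΛ.comp_hasDerivWithinAt (f := fun t' => ((p t, q t, m t, t') : Vars r)) t
        ((hk _).prodMk ((hk _).prodMk ((hk _).prodMk hid)))
        fun t' ht' => domain_mk (hp t ht) (hq t ht) _ ht'
    exact hu.eq_deriv _ h1 hv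
  have h1 : HasDerivWithinAt (fun t' => F (p t', q t', m t', t')) (Λ (p', q', m', 1))
      (Icc 0 1) t :=
    hΛ.comp_hasDerivWithinAt (f := fun t' => ((p t', q t', m t', t') : Vars r)) t
      (hp'.prodMk (hq'.prodMk (hm'.prodMk hid)))
      fun t' ht' => domain_mk (hp t' ht') (hq t' ht') _ ht'
  have h2 : ((p', q', m', 1) : Vars r)
      = (p', 0, 0, 0) + (0, q', 0, 0) + (0, 0, m', 0) + (0, 0, 0, 1) := by
    simp
  rw [h2, map_add, map_add, map_add, e1, e2, e4, e5] at h1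
  simpa using h1

end Path

/-! ### Bounds for the total derivative -/

section Total

variable {n d l r : ℕ} [NeZero l] {P : BilinearModel n d l} {p q m : Fin (r + 2) → ℝ}

lemma normMean_of_common_norms
    (h : ∀ i j, ‖P.x i‖ = ‖P.x j‖ ∧ ‖P.y i‖ = ‖P.y j‖) (p q m : Fin (r + 2) → ℝ) (t : ℝ) {k : ℕ}
    (hk : k ≤ r) :
    normMean P p q m t (k + 1) = ‖P.x 0‖ * ‖P.x 0‖ * ‖P.y 0‖ * ‖P.y 0‖ := by
  rw [normMean]
  simp only [fun i => (h i 0).1, fun i => (h i 0).2]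
  exact gammaMean_const P p q m t hk _

lemma abs_phi_le (hp : p ∈ overlapVectors r) (hq : q ∈ overlapVectors r) {R : ℝ}
    (hR : ∀ i, ‖P.x i‖ ≤ R ∧ ‖P.y i‖ ≤ R) (m : Fin (r + 2) → ℝ) (t : ℝ) {k : ℕ} (hk : k ≤ r) :
    |phi P p q m t (k + 1)|
      ≤ |P.s| * |entry m k - entry m (k + 1)| * (2 * R ^ 2 * (2 * R ^ 2)) := by
  rw [phi, Nat.add_sub_cancel, abs_mul, abs_mul, abs_neg]
  refine mul_le_mul_of_nonneg_left ?_ (by positivity)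
  exact abs_gammaMean_le P p q m t hk fun i j i' j' => abs_devCov_le P hp hq hR k (i, j) (i', j')

lemma abs_phi_le_overlapVar (p q m : Fin (r + 2) → ℝ) (t : ℝ) {k : ℕ} (hk : k ≤ r) :
    |phi P p q m t (k + 1)| ≤ |P.s| * |entry m k - entry m (k + 1)|
      * (1 / 2 * (xOverlapVar P p q m t k + yOverlapVar P p q m t k)) := by
  rw [phi, Nat.add_sub_cancel, abs_mul, abs_mul, abs_neg]
  exact mul_le_mul_of_nonneg_left (abs_gammaMean_dev_le P p q m t hk) (by positivity)

/-- The derivative of `ψ₁` in its explicit argument `t`, which along a stationary path is its total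
derivative. -/
def totalRate (P : BilinearModel n d l) (p q m : Fin (r + 2) → ℝ) (t : ℝ) : ℝ :=
  -(Real.sign P.s * P.s * P.β / (2 * √(n : ℝ))) *
      (∑ k ∈ Finset.range (r + 1), entry p k * entry q k
        * (entry m (k + 1) - if k = 0 then 0 else entry m k)
        * derivWithin (fun t => normMean P p q m t (k + 1)) (Icc 0 1) t)
    + Real.sign P.s * P.β / (2 * √(n : ℝ)) *
      ∑ k ∈ Finset.range (r + 1), phi P p q m t (k + 1)

lemma totalRate_of_common_norms
    (h : ∀ i j, ‖P.x i‖ = ‖P.x j‖ ∧ ‖P.y i‖ = ‖P.y j‖) (p q m : Fin (r + 2) → ℝ) (t : ℝ) :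
    totalRate P p q m t = Real.sign P.s * P.β / (2 * √(n : ℝ)) *
      ∑ k ∈ Finset.range (r + 1), phi P p q m t (k + 1) := by
  rw [totalRate, Finset.sum_eq_zero, mul_zero, zero_add]
  intro k hk
  have hk' : k ≤ r := by have := Finset.mem_range.1 hk; omega
  simp only [fun t => normMean_of_common_norms h p q m t hk']
  simp

lemma abs_sign_of_ne {s : ℝ} (hs : s ≠ 0) : |Real.sign s| = 1 := by
  rcases lt_or_gt_of_ne hs with h | h
  · rw [Real.sign_of_neg h]; simp
  · rw [Real.sign_of_pos h]; simp

lemma abs_phiTerm_le (hs : P.s ≠ 0) (hβ : 0 < P.β) {B : ℝ} (hB : P.β ≤ B * √(n : ℝ))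
    (hn : 0 < n) (p q m : Fin (r + 2) → ℝ) (t : ℝ) :
    |Real.sign P.s * P.β / (2 * √(n : ℝ)) * ∑ k ∈ Finset.range (r + 1), phi P p q m t (k + 1)|
      ≤ B / 2 * ∑ k ∈ Finset.range (r + 1), |phi P p q m t (k + 1)| := by
  have hsq : 0 < √(n : ℝ) := Real.sqrt_pos.2 (by exact_mod_cast hn)
  have hB0 : 0 ≤ B := by
    by_contra h
    have := mul_neg_of_neg_of_pos (not_le.1 h) hsq
    linarith
  rw [abs_mul, abs_div, abs_mul, abs_sign_of_ne hs, one_mul, abs_of_pos hβ,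
    abs_of_pos (by positivity : 0 < 2 * √(n : ℝ))]
  refine mul_le_mul ?_ (Finset.abs_sum_le_sum_abs _ _) (abs_nonneg _) (by positivity)
  rw [div_le_div_iff₀ (by positivity) two_pos]
  linarith

/-- For bounded `β`, the part of the derivative that comes from the mean norms is of order
`1 / √n`. -/
lemma abs_totalRate_le (hp : p ∈ overlapVectors r) (hq : q ∈ overlapVectors r)
    (hs : P.s ≠ 0) (hβ : 0 < P.β) {B M K : ℝ} (hB : P.β ≤ B) (hn : 0 < n)
    (hM : ∀ k, |entry m k| ≤ M) {t : ℝ}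
    (hK : ∀ k ≤ r, |derivWithin (fun t => normMean P p q m t (k + 1)) (Icc 0 1) t| ≤ K) :
    |totalRate P p q m t| ≤ |P.s| * B / 2 * ((r + 1) * (2 * M * K)) / √(n : ℝ)
      + B / 2 * ∑ k ∈ Finset.range (r + 1), |phi P p q m t (k + 1)| := by
  have hsq : 1 ≤ √(n : ℝ) := Real.one_le_sqrt.2 (by exact_mod_cast hn)
  have hB0 : 0 ≤ B := hβ.le.trans hB
  have hM0 : 0 ≤ M := (abs_nonneg _).trans (hM 0)
  have hK0 : 0 ≤ K := (abs_nonneg _).trans (hK 0 (Nat.zero_le r))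
  refine (abs_add_le _ _).trans (add_le_add ?_ (abs_phiTerm_le hs hβ
    (hB.trans (le_mul_of_one_le_right hB0 hsq)) hn p q m t))
  have h1 : |∑ k ∈ Finset.range (r + 1), entry p k * entry q k
        * (entry m (k + 1) - if k = 0 then 0 else entry m k)
        * derivWithin (fun t => normMean P p q m t (k + 1)) (Icc 0 1) t|
      ≤ (r + 1) * (2 * M * K) := by
    refine (Finset.abs_sum_le_sum_abs _ _).trans ?_
    have h2 : ∀ k ∈ Finset.range (r + 1), |entry p k * entry q k
        * (entry m (k + 1) - if k = 0 then 0 else entry m k)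
        * derivWithin (fun t => normMean P p q m t (k + 1)) (Icc 0 1) t| ≤ 2 * M * K := by
      intro k hk
      rw [abs_mul, abs_mul, abs_mul]
      refine mul_le_mul ?_ (hK k (by have := Finset.mem_range.1 hk; omega)) (abs_nonneg _)
        (by positivity)
      have a1 : |entry p k| ≤ 1 := by
        rw [abs_of_nonneg (entry_nonneg hp k)]; exact entry_le_one hp k
      have a2 : |entry q k| ≤ 1 := by
        rw [abs_of_nonneg (entry_nonneg hq k)]; exact entry_le_one hq k
      have a3 : |entry m (k + 1) - if k = 0 then 0 else entry m k| ≤ 2 * M := by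
        refine (abs_sub _ _).trans ?_
        have := hM (k + 1)
        have := hM k
        split_ifs
        · rw [abs_zero]; linarith
        · linarith
      calc |entry p k| * |entry q k| * _ ≤ 1 * 1 * (2 * M) := by gcongr
        _ = 2 * M := by ring
    refine (Finset.sum_le_card_nsmul _ _ _ h2).trans_eq ?_
    rw [Finset.card_range, nsmul_eq_mul]
    push_cast
    rfl
  rw [abs_mul, abs_neg, abs_div, abs_mul, abs_mul, abs_sign_of_ne hs, one_mul, abs_of_pos hβ,
    abs_of_pos (by positivity : 0 < 2 * √(n : ℝ))]
  have h3 : |P.s| * P.β / (2 * √(n : ℝ)) * ((r + 1) * (2 * M * K))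
      ≤ |P.s| * B / 2 * ((r + 1) * (2 * M * K)) / √(n : ℝ) := by
    rw [div_mul_eq_mul_div, div_mul_eq_mul_div, div_div]
    gcongr
  exact (mul_le_mul_of_nonneg_left h1 (by positivity)).trans h3

lemma entry_one (hr : 1 ≤ r) (m : Fin (r + 2) → ℝ) : entry m 1 = m 1 := by
  rw [entry, dif_pos (by omega)]
  congr 1

lemma abs_entry_le {M : ℝ} (hM : ∀ k, |m k| ≤ M) (k : ℕ) : |entry m k| ≤ M := by
  rw [entry]
  split_ifs
  · exact hM _
  · rw [abs_zero]; exact (abs_nonneg _).trans (hM 0)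

end Total

end FullyLifted

end

theorem mainTheorem3 (r : ℕ) (hr : 1 ≤ r) (s : ℝ) (hs : s ≠ 0)
    (d l : ℕ → ℕ) (hl : ∀ n, 0 < n → 0 < l n)
    (P : ∀ n, BilinearModel n (d n) (l n))
    (hPs : ∀ n, 0 < n → (P n).s = s)
    (hPβ : ∀ n, 0 < n → 0 < (P n).β)
    -- the norms are bounded uniformly in the dimension
    (hnorm : ∃ R : ℝ, ∀ n, 0 < n → ∀ i, ‖(P n).x i‖ ≤ R ∧ ‖(P n).y i‖ ≤ R)
    -- either `β` stays bounded (for example, is fixed), or it grows at most like `√n` and, for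
    -- each `n`, the `x`'s have one common norm and the `y`'s have one common norm
    (hscale : (∃ B : ℝ, ∀ n, 0 < n → (P n).β ≤ B) ∨
      ((∃ B : ℝ, ∀ n : ℕ, 0 < n → (P n).β ≤ B * √(n : ℝ)) ∧
        ∀ n, 0 < n → ∀ i j, ‖(P n).x i‖ = ‖(P n).x j‖ ∧ ‖(P n).y i‖ = ‖(P n).y j‖))
    -- the parameter paths
    (p q m : ℕ → ℝ → Fin (r + 2) → ℝ)
    (hp : ∀ n, 0 < n → ∀ t ∈ Icc (0 : ℝ) 1, p n t ∈ overlapVectors r)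
    (hq : ∀ n, 0 < n → ∀ t ∈ Icc (0 : ℝ) 1, q n t ∈ overlapVectors r)
    (hm : ∀ n, 0 < n → ∀ t ∈ Icc (0 : ℝ) 1, m n t ∈ liftVectors r)
    (hmb : ∃ M : ℝ, ∀ n, 0 < n → ∀ t ∈ Icc (0 : ℝ) 1, ∀ k, |m n t k| ≤ M)
    (hpd : ∀ n, 0 < n → DifferentiableOn ℝ (p n) (Icc 0 1))
    (hqd : ∀ n, 0 < n → DifferentiableOn ℝ (q n) (Icc 0 1))
    (hmd : ∀ n, 0 < n → DifferentiableOn ℝ (m n) (Icc 0 1))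
    -- they solve the stationarity system
    (hstat : ∀ n, 0 < n → ∀ t ∈ Icc (0 : ℝ) 1, IsStationary (P n) (p n t) (q n t) (m n t) t)
    -- `m₁ → m₀ = 1`
    (hm1 : ∀ t ∈ Icc (0 : ℝ) 1, Tendsto (fun n => m n t 1) atTop (𝓝 1))
    -- the scaled overlaps concentrate at `p_k` and `q_k`, or `φ_{k+1} = 0`
    (hconc : ∀ t ∈ Icc (0 : ℝ) 1, ∀ k ∈ Finset.Icc 1 r,
      (Tendsto (fun n => xOverlapVar (P n) (p n t) (q n t) (m n t) t k) atTop (𝓝 0) ∧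
        Tendsto (fun n => yOverlapVar (P n) (p n t) (q n t) (m n t) t k) atTop (𝓝 0)) ∨
      ∀ᶠ n in atTop, phi (P n) (p n t) (q n t) (m n t) t (k + 1) = 0) :
    -- the total derivative of `ψ₁` along the path exists and tends to zero
    (∀ n, 0 < n →
      DifferentiableOn ℝ (fun t => psiOne (P n) (p n t) (q n t) (m n t) t) (Icc 0 1)) ∧
    (∀ t ∈ Icc (0 : ℝ) 1,
      Tendsto (fun n => derivWithin
        (fun t' => psiOne (P n) (p n t') (q n t') (m n t') t') (Icc 0 1) t) atTop (𝓝 0)) ∧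
    -- and it is exactly zero where the norms are common, `m₁ = 1` and all `φ_{k+1}` vanish
    (∀ n, 0 < n → (∀ i j, ‖(P n).x i‖ = ‖(P n).x j‖ ∧ ‖(P n).y i‖ = ‖(P n).y j‖) →
      ∀ t ∈ Icc (0 : ℝ) 1, m n t 1 = 1 →
        (∀ k ∈ Finset.Icc 1 r, phi (P n) (p n t) (q n t) (m n t) t (k + 1) = 0) →
        derivWithin (fun t' => psiOne (P n) (p n t') (q n t') (m n t') t') (Icc 0 1) t = 0) ∧
    -- the values at `t`, at `0` and at `1` have the same limiting behaviour
    (∀ t ∈ Icc (0 : ℝ) 1,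
      Tendsto (fun n => psiOne (P n) (p n t) (q n t) (m n t) t
        - psiOne (P n) (p n 0) (q n 0) (m n 0) 0) atTop (𝓝 0) ∧
      Tendsto (fun n => psiOne (P n) (p n t) (q n t) (m n t) t
        - psiOne (P n) (p n 1) (q n 1) (m n 1) 1) atTop (𝓝 0) ∧
      ∀ L : ℝ,
        (Tendsto (fun n => psiOne (P n) (p n t) (q n t) (m n t) t) atTop (𝓝 L) ↔
          Tendsto (fun n => psiOne (P n) (p n 0) (q n 0) (m n 0) 0) atTop (𝓝 L)) ∧
        (Tendsto (fun n => psiOne (P n) (p n t) (q n t) (m n t) t) atTop (𝓝 L) ↔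
          Tendsto (fun n => psiOne (P n) (p n 1) (q n 1) (m n 1) 1) atTop (𝓝 L))) := by
  obtain ⟨R, hR⟩ := hnorm
  obtain ⟨M, hM⟩ := hmb
  have hne : ∀ n, 0 < n → NeZero (l n) := fun n hn => ⟨(hl n hn).ne'⟩
  have hsn : ∀ n, 0 < n → (P n).s ≠ 0 := fun n hn => by rw [hPs n hn]; exact hs
  set g : ℕ → ℝ → ℝ := fun n t => psiOne (P n) (p n t) (q n t) (m n t) t with hg
  have hent : ∀ n, 0 < n → ∀ t ∈ Icc (0 : ℝ) 1, ∀ k, |entry (m n t) k| ≤ M :=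
    fun n hn t ht => abs_entry_le (hM n hn t ht)
  -- the total derivative
  have hder : ∀ n, 0 < n → ∀ t ∈ Icc (0 : ℝ) 1, HasDerivWithinAt (g n)
      (totalRate (P n) (p n t) (q n t) (m n t) t) (Icc 0 1) t := by
    intro n hn t ht
    have := hne n hn
    exact hasDerivWithinAt_psiOne_path (hp n hn) (hq n hn) (hm n hn) (hpd n hn) (hqd n hn)
      (hmd n hn) hn (hPβ n hn) (hsn n hn) ht (hstat n hn t ht)
      (hasDerivWithinAt_psiOne (hp n hn t ht) (hq n hn t ht) (hm n hn t ht) hn (hPβ n hn)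
        (hsn n hn) ht)
  have hdw : ∀ n, 0 < n → ∀ t ∈ Icc (0 : ℝ) 1, derivWithin (g n) (Icc 0 1) t
      = totalRate (P n) (p n t) (q n t) (m n t) t := fun n hn t ht =>
    (hder n hn t ht).derivWithin (uniqueDiffOn_Icc_zero_one t ht)
  -- its bound by the `φ_k`, up to an error of order `1 / √n`
  have hbound : ∃ C₁ C₂ : ℝ, 0 ≤ C₁ ∧ 0 ≤ C₂ ∧ ∀ n, 0 < n → ∀ t ∈ Icc (0 : ℝ) 1,
      |totalRate (P n) (p n t) (q n t) (m n t) t| ≤ C₁ / √(n : ℝ)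
        + C₂ * ∑ k ∈ Finset.range (r + 1), |phi (P n) (p n t) (q n t) (m n t) t (k + 1)| := by
    rcases hscale with ⟨B, hB⟩ | ⟨⟨B, hB⟩, hcom⟩
    · choose K hK0 hK using fun k => exists_normMean_speed_bound r k R |s| B M
      have hB0 : 0 ≤ B := (hPβ 1 one_pos).le.trans (hB 1 one_pos)
      have hM0 : 0 ≤ M := (abs_nonneg _).trans (hM 1 one_pos 0 ⟨le_rfl, zero_le_one⟩ 0)
      have hKs : 0 ≤ ∑ k ∈ Finset.range (r + 1), K k := Finset.sum_nonneg fun k _ => hK0 k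
      refine ⟨|s| * B / 2 * ((r + 1) * (2 * M * ∑ k ∈ Finset.range (r + 1), K k)), B / 2,
        by positivity, by positivity, fun n hn t ht => ?_⟩
      have := hne n hn
      have h1 := abs_totalRate_le (P := P n) (hp n hn t ht) (hq n hn t ht) (hsn n hn) (hPβ n hn)
        (hB n hn) hn (hent n hn t ht) (t := t) (K := ∑ k ∈ Finset.range (r + 1), K k)
        fun k hk => ?_
      · rwa [hPs n hn] at h1
      · have hd := differentiableOn_gammaMean (P := P n) (hp n hn t ht) (hq n hn t ht)
          (hm n hn t ht) hk fun i₁ i₂ p₁ p₂ =>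
            ‖(P n).x i₁‖ * ‖(P n).x p₁‖ * ‖(P n).y i₂‖ * ‖(P n).y p₂‖
        refine (abs_le_of_hasDerivWithinAt_Icc (K := K k) hd.continuousOn (fun t' ht' => ?_) ht
          (hd t ht).hasDerivWithinAt).trans
          (Finset.single_le_sum (fun k _ => hK0 k) (Finset.mem_range.2 (by omega)))
        exact hK k n (d n) (l n) this (P n) _ _ _ t' hk (hp n hn t ht) (hq n hn t ht)
          (hm n hn t ht) (hR n hn) (by rw [hPs n hn])
          (by rw [abs_of_pos (hPβ n hn)]; exact hB n hn) (hent n hn t ht) ht'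
    · have hB0 : 0 ≤ B := by
        have h1 := hB 1 one_pos
        have h2 := hPβ 1 one_pos
        rw [Nat.cast_one, Real.sqrt_one, mul_one] at h1
        linarith
      refine ⟨0, B / 2, le_rfl, by positivity, fun n hn t ht => ?_⟩
      have := hne n hn
      rw [totalRate_of_common_norms (hcom n hn), zero_div, zero_add]
      exact abs_phiTerm_le (hsn n hn) (hPβ n hn) (hB n hn) hn _ _ _ _
  obtain ⟨C₁, C₂, hC₁, hC₂, hC⟩ := hbound
  -- the `φ_k` are bounded and tend to zero
  have hphib : ∀ n, 0 < n → ∀ t ∈ Icc (0 : ℝ) 1, ∀ k ≤ r,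
      |phi (P n) (p n t) (q n t) (m n t) t (k + 1)|
        ≤ |s| * (2 * M) * (2 * R ^ 2 * (2 * R ^ 2)) := by
    intro n hn t ht k hk
    have := hne n hn
    refine (abs_phi_le (hp n hn t ht) (hq n hn t ht) (hR n hn) _ t hk).trans ?_
    rw [hPs n hn]
    have h1 : |entry (m n t) k - entry (m n t) (k + 1)| ≤ 2 * M := by
      refine (abs_sub _ _).trans ?_
      linarith [hent n hn t ht k, hent n hn t ht (k + 1)]
    gcongr
  have hphi : ∀ t ∈ Icc (0 : ℝ) 1, ∀ k ≤ r,
      Tendsto (fun n => |phi (P n) (p n t) (q n t) (m n t) t (k + 1)|) atTop (𝓝 0) := by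
    intro t ht k hk
    rcases Nat.eq_zero_or_pos k with rfl | hk0
    · have h1 : Tendsto (fun n => |s| * |1 - m n t 1| * (2 * R ^ 2 * (2 * R ^ 2))) atTop
          (𝓝 (|s| * |1 - 1| * (2 * R ^ 2 * (2 * R ^ 2)))) :=
        ((((hm1 t ht).const_sub 1).abs).const_mul _).mul_const _
      rw [sub_self, abs_zero, mul_zero, zero_mul] at h1
      refine squeeze_zero' (Eventually.of_forall fun n => abs_nonneg _) ?_ h1
      filter_upwards [eventually_gt_atTop 0] with n hn
      have := hne n hn
      have h2 := abs_phi_le (P := P n) (hp n hn t ht) (hq n hn t ht) (hR n hn) (m n t) t hk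
      have h3 : entry (m n t) 0 = 1 := (hm n hn t ht).1
      rwa [hPs n hn, zero_add, entry_one hr, h3] at h2
    · rcases hconc t ht k (Finset.mem_Icc.2 ⟨hk0, hk⟩) with ⟨hx, hy⟩ | h0
      · have h1 : Tendsto (fun n => |s| * (2 * M) *
            (1 / 2 * (xOverlapVar (P n) (p n t) (q n t) (m n t) t k
              + yOverlapVar (P n) (p n t) (q n t) (m n t) t k))) atTop
            (𝓝 (|s| * (2 * M) * (1 / 2 * (0 + 0)))) := ((hx.add hy).const_mul _).const_mul _
        rw [add_zero, mul_zero, mul_zero] at h1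
        refine squeeze_zero' (Eventually.of_forall fun n => abs_nonneg _) ?_ h1
        filter_upwards [eventually_gt_atTop 0] with n hn
        have := hne n hn
        refine (abs_phi_le_overlapVar (P := P n) _ _ (m n t) t hk).trans ?_
        rw [hPs n hn]
        have h2 : |entry (m n t) k - entry (m n t) (k + 1)| ≤ 2 * M := by
          refine (abs_sub _ _).trans ?_
          linarith [hent n hn t ht k, hent n hn t ht (k + 1)]
        have h3 := (abs_nonneg _).trans
          (abs_gammaMean_dev_le (P n) (p n t) (q n t) (m n t) t hk)
        gcongr
      · refine tendsto_const_nhds.congr' ?_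
        filter_upwards [h0] with n hn
        rw [hn, abs_zero]
  have hdiff : ∀ n, 0 < n → DifferentiableOn ℝ (g n) (Icc 0 1) := fun n hn t ht =>
    (hder n hn t ht).differentiableWithinAt
  have hlim : ∀ t ∈ Icc (0 : ℝ) 1,
      Tendsto (fun n => derivWithin (g n) (Icc 0 1) t) atTop (𝓝 0) := by
    intro t ht
    have h1 : Tendsto (fun n : ℕ => C₁ / √(n : ℝ)) atTop (𝓝 0) :=
      tendsto_const_nhds.div_atTop (Real.tendsto_sqrt_atTop.comp tendsto_natCast_atTop_atTop)
    have h2 := (tendsto_finsetSum (Finset.range (r + 1)) fun k hk =>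
      hphi t ht k (by have := Finset.mem_range.1 hk; omega)).const_mul C₂
    have h3 := h1.add h2
    rw [Finset.sum_const_zero, mul_zero, add_zero] at h3
    refine squeeze_zero_norm' ?_ h3
    filter_upwards [eventually_gt_atTop 0] with n hn
    rw [hdw n hn t ht]
    exact hC n hn t ht
  have hbd : ∀ᶠ n in atTop, ∀ t ∈ Icc (0 : ℝ) 1, |derivWithin (g n) (Icc 0 1) t|
      ≤ C₁ + C₂ * ∑ _k ∈ Finset.range (r + 1), |s| * (2 * M) * (2 * R ^ 2 * (2 * R ^ 2)) := by
    filter_upwards [eventually_gt_atTop 0] with n hn t ht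
    rw [hdw n hn t ht]
    have hsq : 1 ≤ √(n : ℝ) := Real.one_le_sqrt.2 (by exact_mod_cast hn)
    refine (hC n hn t ht).trans (add_le_add (div_le_self hC₁ hsq)
      (mul_le_mul_of_nonneg_left (Finset.sum_le_sum fun k hk => ?_) hC₂))
    exact hphib n hn t ht k (by have := Finset.mem_range.1 hk; omega)
  have hinc : ∀ {a b : ℝ}, 0 ≤ a → a ≤ b → b ≤ 1 →
      Tendsto (fun n => g n b - g n a) atTop (𝓝 0) := fun ha hab hb =>
    tendsto_sub_of_tendsto_derivWithin
      ((eventually_gt_atTop 0).mono fun n hn => hdiff n hn) hbd hlim ha hab hb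
  refine ⟨hdiff, hlim, fun n hn hcom t ht hmt hφ => ?_, fun t ht => ?_⟩
  · have := hne n hn
    change derivWithin (g n) (Icc 0 1) t = 0
    rw [hdw n hn t ht, totalRate_of_common_norms hcom, Finset.sum_eq_zero, mul_zero]
    intro k hk
    rcases Nat.eq_zero_or_pos k with rfl | hk0
    · have h3 : entry (m n t) 0 = 1 := (hm n hn t ht).1
      rw [phi, zero_add, entry_one hr, hmt, Nat.sub_self, h3, sub_self, mul_zero, zero_mul]
    · exact hφ k (Finset.mem_Icc.2 ⟨hk0, by have := Finset.mem_range.1 hk; omega⟩)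
  · have h0 := hinc le_rfl ht.1 ht.2
    have h1 : Tendsto (fun n => g n t - g n 1) atTop (𝓝 0) := by
      have := (hinc ht.1 ht.2 le_rfl).neg
      simpa using this
    have hiff : ∀ {b : ℝ}, Tendsto (fun n => g n t - g n b) atTop (𝓝 0) → ∀ L,
        Tendsto (fun n => g n t) atTop (𝓝 L) ↔ Tendsto (fun n => g n b) atTop (𝓝 L) := by
      intro b hb L
      refine ⟨fun h => ?_, fun h => ?_⟩
      · simpa using h.sub hb
      · simpa using h.add hb
    exact ⟨h0, h1, fun L => ⟨hiff h0 L, hiff h1 L⟩⟩
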